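/- Let $k=\mathbb R$ or $\mathbb C$, and let $(A=\bigoplus_i A^i,d,\cdot)$ be a unital differential graded algebra over $k$ with $d$ of degree $+1$; write $A^{ev}$, $A^{odd}$ for its even and odd parts, $A^*$ for its graded dual, $\bar A=A/k$ and $\|a_1\otimes\dots\otimes a_n\|=\sum_i(|a_i|-1)$. Let $\mathrm{Tr}\in A^*$ be a closed graded trace of even degree: $\mathrm{Tr}(da)=0$, $\mathrm{Tr}(ab)=(-1)^{|a||b|}\mathrm{Tr}(ba)$, $\mathrm{Tr}|_{A^{odd}}=0$, such that the bimodule map $\omega:A\to A^*$, $\omega(a)(b)=\mathrm{Tr}(ab)$, is a quasi-isomorphism. For $M=A$ or $A^*$ let $C^\bullet(A,M)$ be the normalized Hochschild cochains, i.e. finite sums of homogeneous maps $\bar A^{\otimes n}\to M$, with the Hochschild differential $\delta^*$ (with Koszul signs), and let $HH^\bullet(A,M)$ be its cohomology. Let $\cup$ be the cup product on $HH^\bullet(A,A)$, and let $B^*$ be the graded transpose of Connes' operator. Assume that the map $HH^\bullet(A,A)\to HH^\bullet(A,A^*)$, $f\mapsto\omega\circ f$, is bijective, so that $\cup$ can be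 transferred to a product $\sqcup$ on $HH^\bullet(A,A^*)$, and that $(HH^\bullet(A,A^*),\sqcup,\Delta)$ with $\Delta=[B^*]$ is a BV algebra: $\sqcup$ is associative and graded commutative, $\Delta^2=0$, and $(-1)^{|x|}\Delta(x\sqcup y)-(-1)^{|x|}\Delta(x)\sqcup y-x\sqcup\Delta(y)$ is a derivation in each variable. Let $HC_-^\bullet(A)$ be the cohomology of the finite sums $\sum_{i\ge0}\alpha_iv^{-i}$, $\alpha_i\in C^\bullet(A,A^*)$, $|v|=-2$, with differential $\delta^*+vB^*$. Let $I:HH^\bullet(A,A^*)\to HC_-^\bullet(A)$ be induced by the inclusion $f\mapsto fv^0$, let $\mathcal B:HC_-^\bullet(A)\to HH^\bullet(A,A^*)$ be the connecting map $[\sum\alpha_iv^{-i}]\mapsto[B^*\alpha_0]$, and put $\{x,y\}=I(\mathcal Bx\sqcup\mathcal By)$. Let $MC$ be the scheme $\{a\in A^{odd}: da+a\cdot a=0\}$: its functions are the polynomial functions on $A^{odd}$ modulo those of the form $a\mapsto G(a)(da+a\cdot a)$ with $G$ a polynomial map to linear functionals, and its tangent space at $a$ is the kernel of $d_aY=dY+aY+Ya$.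 Let $\mathcal O(\mathcal{MC})$ be the functions on $MC$ annihilated by the vector fields $\xi_x(a)=[x,a]-dx$, $x\in A^{ev}$. A Hamiltonian vector field of $\psi\in\mathcal O(\mathcal{MC})$ is a polynomial vector field $X^\psi$ tangent to $MC$ with $\mathrm{Tr}(X^\psi Y)=d\psi(Y)$ for $Y$ tangent to $MC$ (equality of one-forms on the scheme $MC$); put $\{\psi,\chi\}=\mathrm{Tr}(X^\psi X^\chi)$ for functions $\psi,\chi$ that have Hamiltonian vector fields. Then the maps $\cup$, $f\mapsto\omega\circ f$, $\Delta$, $I$, $\mathcal B$ are well defined on cohomology; $\{x,y\}=I(\mathcal Bx\sqcup\mathcal By)$ makes the even part $HC_-^{2\bullet}(A)$ a Lie algebra; the functions in $\mathcal O(\mathcal{MC})$ that have Hamiltonian vector fields form a Lie algebra under the (well-defined) bracket $\{\psi,\chi\}$; and $$\rho([\alpha])(a)=\langle\alpha,R(a)\rangle=\sum_{n\ge0}\alpha_0(a^{\otimes n})(1),\qquad R(a)=\sum_{n\ge0}1\otimes a^{\otimes n},$$ is a well-defined map $HC_-^\bullet(A)\to\mathcal O(\mathcal{MC})$ (it depends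 only on the class $[\alpha]$ and is gauge invariant). It restricts to a homomorphism of Lie algebras from $HC_-^{2\bullet}(A)$ to the functions that have Hamiltonian vector fields. Moreover, if $\alpha,\beta$ are even cocycles and $\gamma$ is a cocycle representing $\{[\alpha],[\beta]\}$, then at each $a\in A^{odd}$ with $da+a\cdot a=0$ one has $\langle\gamma,R(a)\rangle=\mathrm{Tr}(XY)$ for all $X,Y\in\ker d_a$ with $\mathrm{Tr}(XZ)=d\langle\alpha,R(\cdot)\rangle_a(Z)$ and $\mathrm{Tr}(YZ)=d\langle\beta,R(\cdot)\rangle_a(Z)$ for all $Z\in\ker d_a$. -/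

import Mathlib

/-!
# Hochschild and negative cyclic cohomology of a dga with trace, and the functions on its
Maurer-Cartan moduli space
-/

noncomputable section

namespace MCRep

/-! ## Generalities: subquotients and signs -/

section General

variable {k : Type*} [Field k] {M M' M'' : Type*} [AddCommGroup M] [Module k M]
  [AddCommGroup M'] [Module k M'] [AddCommGroup M''] [Module k M'']

/-- The subquotient `Z / (Z ∩ B)` of `M` (cycles modulo boundaries). -/
abbrev Homology (Z B : Submodule k M) : Type _ := ↥Z ⧸ B.submoduleOf Z

/-- The class of an element of `Z`. -/
abbrev cls {Z : Submodule k M} (B : Submodule k M) (z : Z) : Homology Z B :=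
  Submodule.Quotient.mk z

/-- `T` sends `Z` to `Z'` and induces a map `Z / (Z ∩ B) → Z' / (Z' ∩ B')`. -/
def Induces (Z B : Submodule k M) (Z' B' : Submodule k M') (T : M → M') : Prop :=
  (∀ x ∈ Z, T x ∈ Z') ∧ ∀ x ∈ Z, ∀ y ∈ Z, x - y ∈ B → T x - T y ∈ B'

/-- The binary version of `Induces`. -/
def Induces₂ (Z B : Submodule k M) (Z' B' : Submodule k M') (Z'' B'' : Submodule k M'')
    (T : M → M' → M'') : Prop :=
  (∀ x ∈ Z, ∀ y ∈ Z', T x y ∈ Z'') ∧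
    ∀ x₁ ∈ Z, ∀ x₂ ∈ Z, ∀ y₁ ∈ Z', ∀ y₂ ∈ Z', x₁ - x₂ ∈ B → y₁ - y₂ ∈ B' →
      T x₁ y₁ - T x₂ y₂ ∈ B''

open Classical in
/-- The map `[x] ↦ [T x]` of subquotients (the constant map `0` if `T` does not induce one). -/
def induced (Z B : Submodule k M) (Z' B' : Submodule k M') (T : M → M')
    (x : Homology Z B) : Homology Z' B' :=
  if h : Induces Z B Z' B' T then
    Quotient.liftOn' x (fun z => cls B' ⟨T z, h.1 z z.2⟩) (by
      intro a b hab
      have hab' : a - b ∈ B.submoduleOf Z := (Submodule.quotientRel_def _).1 hab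
      exact (Submodule.Quotient.eq _).2 (h.2 a a.2 b b.2 hab'))
  else 0

open Classical in
/-- The map `([x], [y]) ↦ [T x y]` of subquotients (`0` if `T` does not induce one). -/
def induced₂ (Z B : Submodule k M) (Z' B' : Submodule k M') (Z'' B'' : Submodule k M'')
    (T : M → M' → M'') (x : Homology Z B) (y : Homology Z' B') : Homology Z'' B'' :=
  if h : Induces₂ Z B Z' B' Z'' B'' T then
    Quotient.liftOn₂' x y (fun z w => cls B'' ⟨T z w, h.1 z z.2 w w.2⟩) (by
      intro a b a' b' haa hbb
      have haa' : a - a' ∈ B.submoduleOf Z := (Submodule.quotientRel_def _).1 haa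
      have hbb' : b - b' ∈ B'.submoduleOf Z' := (Submodule.quotientRel_def _).1 hbb
      exact (Submodule.Quotient.eq _).2
        (h.2 a a.2 a' a'.2 b b.2 b' b'.2 haa' hbb'))
  else 0

/-- A Lie bracket on a vector space. -/
def IsLieBracket (br : M →ₗ[k] M →ₗ[k] M) : Prop :=
  (∀ x, br x x = 0) ∧ ∀ x y z, br x (br y z) = br (br x y) z + br y (br x z)

/-- `E x y` with the Koszul sign `(-1)^{|x| |y|}` inserted, where the involutions `s` and `t`
stand for `x ↦ (-1)^{|x|} x` and `y ↦ (-1)^{|y|} y`: for `E` bilinear and `x`, `y` of definite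
parity this is `(-1)^{|x| |y|} E x y`. -/
def koszul (k : Type*) [Field k] {M X Y : Type*} [AddCommGroup M] [Module k M]
    (s : X → X) (t : Y → Y) (E : X → Y → M) (x : X) (y : Y) : M :=
  (2⁻¹ : k) • (E x y + E (s x) y + E x (t y) - E (s x) (t y))

end General

/-! ## Differential graded algebras and traces -/

section DGA

variable {k : Type*} [Field k] {A : Type*} [Ring A] [Algebra k A]
  (𝒜 : ℤ → Submodule k A)

/-- The span of the homogeneous elements of parity `q`: `A^{even}` for `q = 0`, `A^{odd}` for
`q = 1`. -/
def parityPart (q : ZMod 2) : Submodule k A := ⨆ (i : ℤ) (_ : (i : ZMod 2) = q), 𝒜 i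

theorem parityPart_induction {q : ZMod 2} {P : A → Prop}
    (hom : ∀ i : ℤ, (i : ZMod 2) = q → ∀ a ∈ 𝒜 i, P a) (zero : P 0)
    (add : ∀ a b, P a → P b → P (a + b)) {a : A} (ha : a ∈ parityPart 𝒜 q) : P a := by
  unfold parityPart at ha
  refine Submodule.iSup_induction _ (motive := P) ha (fun i x hx => ?_) zero add
  refine Submodule.iSup_induction _ (motive := P) hx (fun h y hy => hom i h y hy) zero add

theorem mem_parityPart {q : ZMod 2} {i : ℤ} (h : (i : ZMod 2) = q) {a : A} (ha : a ∈ 𝒜 i) :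
    a ∈ parityPart 𝒜 q :=
  Submodule.mem_iSup_of_mem i (Submodule.mem_iSup_of_mem h ha)

variable [GradedAlgebra 𝒜]

/-- The parity involution `a ↦ (-1)^{|a|} a`. -/
def par : A →ₗ[k] A :=
  (DirectSum.toModule k ℤ A fun i => ((i.negOnePow : ℤˣ) : ℤ) • (𝒜 i).subtype) ∘ₗ
    (DirectSum.decomposeLinearEquiv 𝒜).toLinearMap

/-- The parity involution `a ↦ (-1)^{|a| - 1} a` of the shifted space `sA`. -/
def spar : A →ₗ[k] A := -par 𝒜

/-- `d` makes the graded algebra `A` into a (cohomologically graded) dga. -/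
structure IsDGA (d : A →ₗ[k] A) : Prop where
  degree : ∀ i, ∀ a ∈ 𝒜 i, d a ∈ 𝒜 (i + 1)
  square : ∀ a, d (d a) = 0
  leibniz : ∀ i, ∀ a ∈ 𝒜 i, ∀ b, d (a * b) = d a * b + ((i.negOnePow : ℤˣ) : ℤ) • (a * d b)

/-- The degree `i` part of the graded dual of `A`: the functionals that vanish on `A^j`
for `j ≠ -i`. -/
def dualGrading (i : ℤ) : Submodule k (A → k) where
  carrier := {φ | IsLinearMap k φ ∧ ∀ j, j ≠ -i → ∀ a ∈ 𝒜 j, φ a = 0}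
  add_mem' := by
    rintro φ ψ ⟨h1, h2⟩ ⟨h3, h4⟩
    refine ⟨⟨fun x y => ?_, fun c x => ?_⟩, fun j hj a ha => ?_⟩
    · simp only [Pi.add_apply, h1.map_add, h3.map_add]; ring
    · simp only [Pi.add_apply, h1.map_smul, h3.map_smul, smul_add]
    · simp [h2 j hj a ha, h4 j hj a ha]
  zero_mem' := ⟨⟨fun _ _ => by simp, fun _ _ => by simp⟩, fun _ _ _ _ => rfl⟩
  smul_mem' := by
    rintro c φ ⟨h1, h2⟩
    refine ⟨⟨fun x y => ?_, fun c' x => ?_⟩, fun j hj a ha => ?_⟩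
    · simp only [Pi.smul_apply, h1.map_add, smul_add]
    · simp only [Pi.smul_apply, h1.map_smul, smul_eq_mul]; ring
    · simp [h2 j hj a ha]

/-- The graded dual `A^*`, inside the space of all functions `A → k`. -/
def gradedDual : Submodule k (A → k) := ⨆ i, dualGrading 𝒜 i

/-! The differential graded `A`-bimodule `A^*`:
`(dφ)(b) = -(-1)^{|φ|} φ(db)`, `(aφ)(b) = (-1)^{|a| (|φ| + |b|)} φ(ba)`, `(φa)(b) = φ(ab)`.
On the degrees where `φ(db)`, resp. `φ(ba)`, can be nonzero the signs are `(-1)^{|b|}`,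
resp. `(-1)^{|a|}`. -/

/-- `φ ↦ (-1)^{|φ|} φ` on `A^*`. -/
def dualPar : (A → k) →ₗ[k] (A → k) := LinearMap.funLeft k k (par 𝒜)

/-- The differential of `A^*`. -/
def dualD (d : A →ₗ[k] A) : (A → k) →ₗ[k] (A → k) := LinearMap.funLeft k k fun b => d (par 𝒜 b)

/-- The left action of `A` on `A^*`. -/
def dualLeft (a : A) : (A → k) →ₗ[k] (A → k) := LinearMap.funLeft k k fun b => b * par 𝒜 a

/-- The right action of `A` on `A^*`. -/
def dualRight (a : A) : (A → k) →ₗ[k] (A → k) := LinearMap.funLeft k k fun b => a * b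

/-- The map `ω : A → A^*`, `ω(a)(b) = Tr(ab)`. -/
def omega (Tr : A →ₗ[k] k) (a : A) : A → k := fun b => Tr (a * b)

/-- A closed graded trace of even degree on the dga `(A, d)` whose pairing is a
quasi-isomorphism `A → A^*`. -/
structure IsSymmetricTrace (d : A →ₗ[k] A) (Tr : A →ₗ[k] k) : Prop where
  mem_dual : (fun a => Tr a) ∈ gradedDual 𝒜
  even : ∀ a ∈ parityPart 𝒜 1, Tr a = 0
  closed : ∀ a, Tr (d a) = 0
  cyclic : ∀ i j, ∀ a ∈ 𝒜 i, ∀ b ∈ 𝒜 j,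
    Tr (a * b) = (((i * j).negOnePow : ℤˣ) : ℤ) • Tr (b * a)
  quasiIso : Induces (LinearMap.ker d) (LinearMap.range d)
      (gradedDual 𝒜 ⊓ LinearMap.ker (dualD 𝒜 d)) ((gradedDual 𝒜).map (dualD 𝒜 d)) (omega Tr) ∧
    Function.Bijective (induced (LinearMap.ker d) (LinearMap.range d)
      (gradedDual 𝒜 ⊓ LinearMap.ker (dualD 𝒜 d)) ((gradedDual 𝒜).map (dualD 𝒜 d)) (omega Tr))

/-! ## Hochschild cochains

A linear map `⊕ₙ A^{⊗n} → M` is a function on finite words in `A` that is linear in each letter. -/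

section Cochains

variable {M : Type*} [AddCommGroup M] [Module k M]

/-- Normalized Hochschild cochains of degree `p` with values in a graded module `M`:
linear in each letter, zero if some letter is `1`, zero on all long words, and sending
`a₁, …, aₙ` to degree `p + ∑ (|aᵢ| - 1)`. -/
def homCochains (ℳ : ℤ → Submodule k M) (p : ℤ) : Submodule k (List A → M) where
  carrier := {f | (∀ l r, IsLinearMap k fun a => f (l ++ a :: r)) ∧
    (∀ l r, f (l ++ 1 :: r) = 0) ∧
    (∃ N : ℕ, ∀ l, N < l.length → f l = 0) ∧
    ∀ (l : List A) (is : List ℤ), List.Forall₂ (fun a i => a ∈ 𝒜 i) l is →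
      f l ∈ ℳ (p + (is.map fun i => i - 1).sum)}
  add_mem' := by
    rintro f g ⟨h1, h2, ⟨N, h3⟩, h4⟩ ⟨h1', h2', ⟨N', h3'⟩, h4'⟩
    refine ⟨fun l r => ⟨fun x y => ?_, fun c x => ?_⟩, fun l r => ?_, ⟨max N N', fun l hl => ?_⟩,
      fun l is hl => ?_⟩
    · simp only [Pi.add_apply, (h1 l r).map_add, (h1' l r).map_add]; abel
    · simp only [Pi.add_apply, (h1 l r).map_smul, (h1' l r).map_smul, smul_add]
    · simp [h2, h2']
    · simp [h3 l (lt_of_le_of_lt (le_max_left _ _) hl),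
        h3' l (lt_of_le_of_lt (le_max_right _ _) hl)]
    · exact (ℳ _).add_mem (h4 l is hl) (h4' l is hl)
  zero_mem' := ⟨fun _ _ => ⟨fun _ _ => by simp, fun _ _ => by simp⟩, fun _ _ => rfl,
    ⟨0, fun _ _ => rfl⟩, fun _ _ _ => (ℳ _).zero_mem⟩
  smul_mem' := by
    rintro c f ⟨h1, h2, ⟨N, h3⟩, h4⟩
    refine ⟨fun l r => ⟨fun x y => ?_, fun c x => ?_⟩, fun l r => ?_, ⟨N, fun l hl => ?_⟩,
      fun l is hl => ?_⟩
    · simp only [Pi.smul_apply, (h1 l r).map_add, smul_add]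
    · simp only [Pi.smul_apply, (h1 l r).map_smul]; rw [smul_comm]
    · simp [h2]
    · simp [h3 l hl]
    · exact (ℳ _).smul_mem c (h4 l is hl)

/-- The total space `C^•(A, M)` of normalized cochains: finite sums of homogeneous ones. -/
def cochains (ℳ : ℤ → Submodule k M) : Submodule k (List A → M) := ⨆ p, homCochains 𝒜 ℳ p

/-- The cochains of parity `q`. -/
def parityCochains (ℳ : ℤ → Submodule k M) (q : ZMod 2) : Submodule k (List A → M) :=
  ⨆ (p : ℤ) (_ : (p : ZMod 2) = q), homCochains 𝒜 ℳ p

/-- The sign `w ↦ (-1)^{‖w‖} w` on words, `‖a₁ … aₙ‖ = ∑ (|aᵢ| - 1)`. -/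
def wpar (l : List A) : List A := l.map (spar 𝒜)

/-- `f ↦ (-1)^{|f|} f` on cochains. -/
def hat (σM : M →ₗ[k] M) (f : List A → M) : List A → M := fun l => σM (f (wpar 𝒜 l))

/-- `F ∘ b'`, where `b'` is the differential of the bar construction `T(sA)`, determined by
`sa ↦ -s(da)` and `sa ⊗ sb ↦ (-1)^{|a|} s(ab)`: apply `d` to the first letter, multiply the first
two letters, or go on past the first letter with the Koszul sign. -/
def barD (d : A →ₗ[k] A) : (List A → M) → List A → M
  | _, [] => 0
  | F, [a] => -F [d a]
  | F, a :: b :: l => -F (d a :: b :: l) + F ((par 𝒜 a * b) :: l) +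
      barD d (fun r => F (spar 𝒜 a :: r)) (b :: l)

theorem barD_add (d : A →ₗ[k] A) (l : List A) : ∀ F G : List A → M,
    barD 𝒜 d (F + G) l = barD 𝒜 d F l + barD 𝒜 d G l := by
  induction l with
  | nil => intro F G; simp [barD]
  | cons a l ih =>
    intro F G
    cases l with
    | nil => simp only [barD, Pi.add_apply]; abel
    | cons b l =>
      have := ih (fun r => F (spar 𝒜 a :: r)) (fun r => G (spar 𝒜 a :: r))
      have e : (fun r => (F + G) (spar 𝒜 a :: r)) =
        (fun r => F (spar 𝒜 a :: r)) + fun r => G (spar 𝒜 a :: r) := rfl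
      rw [barD, e, this]; simp only [barD, Pi.add_apply]; abel

theorem barD_smul (d : A →ₗ[k] A) (c : k) (l : List A) : ∀ F : List A → M,
    barD 𝒜 d (c • F) l = c • barD 𝒜 d F l := by
  induction l with
  | nil => intro F; simp [barD]
  | cons a l ih =>
    intro F
    cases l with
    | nil => simp only [barD, Pi.smul_apply, smul_neg]
    | cons b l =>
      have := ih (fun r => F (spar 𝒜 a :: r))
      have e : (fun r => (c • F) (spar 𝒜 a :: r)) = c • (fun r => F (spar 𝒜 a :: r)) := rfl
      rw [barD, e, this]; simp only [barD, Pi.smul_apply, smul_add, smul_neg]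

/-- The terms of the Hochschild differential that involve the two actions of `A` on `M`:
`(-1)^{|f| (|a₁| - 1)} a₁ · f(a₂, …, aₙ) - (-1)^{|f| + ‖a₁ … aₙ₋₁‖} f(a₁, …, aₙ₋₁) · aₙ`. -/
def actionTerms (σM : M →ₗ[k] M) (lft rgt : A → M →ₗ[k] M) (f : List A → M) : List A → M
  | [] => 0
  | a :: l => koszul k (spar 𝒜) (hat 𝒜 σM) (fun b g => lft b (g l)) a f -
      rgt ((a :: l).getLast (List.cons_ne_nil a l)) (hat 𝒜 σM f (wpar 𝒜 (a :: l).dropLast))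

/-- The Hochschild differential on cochains with values in the dg bimodule `M`. -/
def hochD (d : A →ₗ[k] A) (σM dM : M →ₗ[k] M) (lft rgt : A → M →ₗ[k] M) :
    (List A → M) →ₗ[k] (List A → M) where
  toFun f := fun l => dM (f l) - barD 𝒜 d (hat 𝒜 σM f) l + actionTerms 𝒜 σM lft rgt f l
  map_add' f g := by
    funext l
    have e : hat 𝒜 σM (f + g) = hat 𝒜 σM f + hat 𝒜 σM g := by
      funext r; simp [hat]
    have h2 : actionTerms 𝒜 σM lft rgt (f + g) l =
        actionTerms 𝒜 σM lft rgt f l + actionTerms 𝒜 σM lft rgt g l := by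
      cases l with
      | nil => simp [actionTerms]
      | cons a l =>
        simp only [actionTerms, koszul, e, Pi.add_apply, map_add]
        module
    simp only [e, barD_add, h2, Pi.add_apply, map_add]
    abel
  map_smul' c f := by
    funext l
    have e : hat 𝒜 σM (c • f) = c • hat 𝒜 σM f := by
      funext r; simp [hat]
    have h2 : actionTerms 𝒜 σM lft rgt (c • f) l = c • actionTerms 𝒜 σM lft rgt f l := by
      cases l with
      | nil => simp [actionTerms]
      | cons a l =>
        simp only [actionTerms, koszul, e, Pi.smul_apply, map_smul]
        module
    simp only [e, barD_smul, h2, Pi.smul_apply, map_smul, RingHom.id_apply, smul_add, smul_sub]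

end Cochains

/-- The Hochschild differential on `C^•(A, A)`. -/
def selfD (d : A →ₗ[k] A) : (List A → A) →ₗ[k] (List A → A) :=
  hochD 𝒜 d (par 𝒜) d (fun a => LinearMap.mulLeft k a) (fun a => LinearMap.mulRight k a)

/-- The Hochschild differential on `C^•(A, A^*)`; here a cochain `f` is viewed as the function
`f(a₁, …, aₙ)(a₀)`. -/
def coD (d : A →ₗ[k] A) : (List A → A → k) →ₗ[k] (List A → A → k) :=
  hochD 𝒜 d (dualPar 𝒜) (dualD 𝒜 d) (dualLeft 𝒜) dualRight

/-- The cup product on `C^•(A, A)`: `(f ∪ g)(a₁, …, aₙ)` is the sum over all `i` of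
`(-1)^{|g| ‖a₁ … aᵢ‖} f(a₁, …, aᵢ) g(aᵢ₊₁, …, aₙ)`. -/
def cup (f g : List A → A) : List A → A := fun l =>
  ∑ i ∈ Finset.range (l.length + 1),
    koszul k (wpar 𝒜) (hat 𝒜 (par 𝒜)) (fun w h => f w * h (l.drop i)) (l.take i) g

/-- The map `ω_♯ : C^•(A, A) → C^•(A, A^*)`, `f ↦ ω ∘ f`. -/
def omegaSharp (Tr : A →ₗ[k] k) (f : List A → A) : List A → A → k := fun l => omega Tr (f l)

/-- `f ∘ B`, for Connes' operator
`B(a₀ ⊗ … ⊗ aₙ) = ∑ᵢ (-1)^{‖aᵢ … aₙ‖ ‖a₀ … aᵢ₋₁‖} 1 ⊗ aᵢ ⊗ … ⊗ aₙ ⊗ a₀ ⊗ … ⊗ aᵢ₋₁`. -/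
def rotSum (f : List A → A → k) (a : A) (l : List A) : k :=
  ∑ i ∈ Finset.range (l.length + 1),
    koszul k (wpar 𝒜) (wpar 𝒜) (fun u v => f (u ++ v) 1) ((a :: l).drop i) ((a :: l).take i)

/-- The graded transpose `B^* f = -(-1)^{|f|} f ∘ B` of Connes' operator, with respect to the
pairing `⟨f, a₀ ⊗ a₁ ⊗ … ⊗ aₙ⟩ = (-1)^{|a₀| ‖a₁ … aₙ‖} f(a₁, …, aₙ)(a₀)` of `C^•(A, A^*)` with
Hochschild chains; the Hochschild differential of `C^•(A, A^*)` is the transpose of the one on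
chains in the same sense. -/
def connes : (List A → A → k) →ₗ[k] (List A → A → k) where
  toFun f := fun l a =>
    -koszul k (par 𝒜) (wpar 𝒜) (fun x m => rotSum 𝒜 (hat 𝒜 (dualPar 𝒜) f) x m) a l
  map_add' f g := by
    have e : hat 𝒜 (dualPar 𝒜) (f + g) = hat 𝒜 (dualPar 𝒜) f + hat 𝒜 (dualPar 𝒜) g := by
      funext r; simp [hat]
    have h (x : A) (m : List A) (F G : List A → A → k) :
        rotSum 𝒜 (F + G) x m = rotSum 𝒜 F x m + rotSum 𝒜 G x m := by
      simp only [rotSum, ← Finset.sum_add_distrib]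
      refine Finset.sum_congr rfl fun i _ => ?_
      simp only [koszul, Pi.add_apply]; module
    funext l a
    simp only [e, koszul, h, Pi.add_apply]; module
  map_smul' c f := by
    have e : hat 𝒜 (dualPar 𝒜) (c • f) = c • hat 𝒜 (dualPar 𝒜) f := by
      funext r; simp [hat]
    have h (x : A) (m : List A) (F : List A → A → k) :
        rotSum 𝒜 (c • F) x m = c • rotSum 𝒜 F x m := by
      simp only [rotSum, Finset.smul_sum]
      refine Finset.sum_congr rfl fun i _ => ?_
      simp only [koszul, Pi.smul_apply]; module
    funext l a
    simp only [e, koszul, h, Pi.smul_apply, RingHom.id_apply]; module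

/-! ## Hochschild cohomology and the BV structure -/

/-- Cocycles of `C^•(A, A)`. -/
def selfZ (d : A →ₗ[k] A) : Submodule k (List A → A) := cochains 𝒜 𝒜 ⊓ LinearMap.ker (selfD 𝒜 d)
/-- Coboundaries of `C^•(A, A)`. -/
def selfB (d : A →ₗ[k] A) : Submodule k (List A → A) := (cochains 𝒜 𝒜).map (selfD 𝒜 d)
/-- `HH^•(A, A)`. -/
abbrev HHself (d : A →ₗ[k] A) : Type _ := Homology (selfZ 𝒜 d) (selfB 𝒜 d)

/-- Cocycles of `C^•(A, A^*)`. -/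
def coZ (d : A →ₗ[k] A) : Submodule k (List A → A → k) :=
  cochains 𝒜 (dualGrading 𝒜) ⊓ LinearMap.ker (coD 𝒜 d)
/-- Coboundaries of `C^•(A, A^*)`. -/
def coB (d : A →ₗ[k] A) : Submodule k (List A → A → k) :=
  (cochains 𝒜 (dualGrading 𝒜)).map (coD 𝒜 d)
/-- `HH^•(A, A^*)`. -/
abbrev HHdual (d : A →ₗ[k] A) : Type _ := Homology (coZ 𝒜 d) (coB 𝒜 d)

/-- The cup product on `HH^•(A, A)`. -/
def cupHH (d : A →ₗ[k] A) : HHself 𝒜 d → HHself 𝒜 d → HHself 𝒜 d :=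
  induced₂ (selfZ 𝒜 d) (selfB 𝒜 d) (selfZ 𝒜 d) (selfB 𝒜 d) (selfZ 𝒜 d) (selfB 𝒜 d) (cup 𝒜)

/-- The map `HH^•(A, A) → HH^•(A, A^*)` induced by `ω_♯`. -/
def omegaHH (d : A →ₗ[k] A) (Tr : A →ₗ[k] k) : HHself 𝒜 d → HHdual 𝒜 d :=
  induced (selfZ 𝒜 d) (selfB 𝒜 d) (coZ 𝒜 d) (coB 𝒜 d) (omegaSharp Tr)

/-- The operator `Δ` on `HH^•(A, A^*)`, the dual of Connes' operator. -/
def Delta (d : A →ₗ[k] A) : HHdual 𝒜 d → HHdual 𝒜 d :=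
  induced (coZ 𝒜 d) (coB 𝒜 d) (coZ 𝒜 d) (coB 𝒜 d) (connes 𝒜)

/-- The transferred product `x ⊔ y = ω_♯ (ω_♯⁻¹ x ∪ ω_♯⁻¹ y)` on `HH^•(A, A^*)`. -/
def sqcup (d : A →ₗ[k] A) (Tr : A →ₗ[k] k) (hω : Function.Bijective (omegaHH 𝒜 d Tr))
    (x y : HHdual 𝒜 d) : HHdual 𝒜 d :=
  omegaHH 𝒜 d Tr (cupHH 𝒜 d ((Equiv.ofBijective _ hω).symm x) ((Equiv.ofBijective _ hω).symm y))

/-- The class `x` is represented by a cocycle of parity `p` (where `p : ℕ` is read mod 2). -/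
def HasParity (d : A →ₗ[k] A) (p : ℕ) (x : HHdual 𝒜 d) : Prop :=
  ∃ z : coZ 𝒜 d, (z : List A → A → k) ∈ parityCochains 𝒜 (dualGrading 𝒜) (p : ZMod 2) ∧
    cls (coB 𝒜 d) z = x

/-- The BV bracket `{x, y} = (-1)^{|x|} Δ(x ⊔ y) - (-1)^{|x|} Δ(x) ⊔ y - x ⊔ Δ(y)`, for `x` of
parity `p`. -/
def bvBracket (d : A →ₗ[k] A) (Tr : A →ₗ[k] k) (hω : Function.Bijective (omegaHH 𝒜 d Tr))
    (p : ℕ) (x y : HHdual 𝒜 d) : HHdual 𝒜 d :=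
  (-1 : k) ^ p • Delta 𝒜 d (sqcup 𝒜 d Tr hω x y) -
    (-1 : k) ^ p • sqcup 𝒜 d Tr hω (Delta 𝒜 d x) y - sqcup 𝒜 d Tr hω x (Delta 𝒜 d y)

/-- `(HH^•(A, A^*), ⊔, Δ)` is a BV algebra. -/
structure IsBVAlgebra (d : A →ₗ[k] A) (Tr : A →ₗ[k] k)
    (hω : Function.Bijective (omegaHH 𝒜 d Tr)) : Prop where
  assoc : ∀ x y z, sqcup 𝒜 d Tr hω (sqcup 𝒜 d Tr hω x y) z =
    sqcup 𝒜 d Tr hω x (sqcup 𝒜 d Tr hω y z)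
  comm : ∀ p q x y, HasParity 𝒜 d p x → HasParity 𝒜 d q y →
    sqcup 𝒜 d Tr hω x y = (-1 : k) ^ (p * q) • sqcup 𝒜 d Tr hω y x
  delta_sq : ∀ x, Delta 𝒜 d (Delta 𝒜 d x) = 0
  deriv_right : ∀ p q r x y z, HasParity 𝒜 d p x → HasParity 𝒜 d q y → HasParity 𝒜 d r z →
    bvBracket 𝒜 d Tr hω p x (sqcup 𝒜 d Tr hω y z) =
      sqcup 𝒜 d Tr hω (bvBracket 𝒜 d Tr hω p x y) z +
        (-1 : k) ^ ((p + 1) * q) • sqcup 𝒜 d Tr hω y (bvBracket 𝒜 d Tr hω p x z)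
  deriv_left : ∀ p q r x y z, HasParity 𝒜 d p x → HasParity 𝒜 d q y → HasParity 𝒜 d r z →
    bvBracket 𝒜 d Tr hω (p + q) (sqcup 𝒜 d Tr hω x y) z =
      sqcup 𝒜 d Tr hω x (bvBracket 𝒜 d Tr hω q y z) +
        (-1 : k) ^ (q * (r + 1)) • sqcup 𝒜 d Tr hω (bvBracket 𝒜 d Tr hω p x z) y

/-! ## Negative cyclic cohomology -/

/-- Negative cyclic cochains: finite sums `∑ᵢ αᵢ v⁻ⁱ` with `αᵢ` in `C^•(A, A^*)`. -/
def cyc : Submodule k (ℕ → List A → A → k) where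
  carrier := {α | (∀ i, α i ∈ cochains 𝒜 (dualGrading 𝒜)) ∧ ∃ N : ℕ, ∀ i, N < i → α i = 0}
  add_mem' := by
    rintro α β ⟨h1, N, h2⟩ ⟨h1', N', h2'⟩
    exact ⟨fun i => add_mem (h1 i) (h1' i), max N N', fun i hi => by
      simp [h2 i (lt_of_le_of_lt (le_max_left _ _) hi),
        h2' i (lt_of_le_of_lt (le_max_right _ _) hi)]⟩
  zero_mem' := ⟨fun _ => zero_mem _, 0, fun _ _ => rfl⟩
  smul_mem' := by
    rintro c α ⟨h1, N, h2⟩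
    exact ⟨fun i => Submodule.smul_mem _ c (h1 i), N, fun i hi => by simp [h2 i hi]⟩

/-- The differential `δ^* + v B^*`. -/
def cycD (d : A →ₗ[k] A) : (ℕ → List A → A → k) →ₗ[k] (ℕ → List A → A → k) where
  toFun α := fun i => coD 𝒜 d (α i) + connes 𝒜 (α (i + 1))
  map_add' α β := by funext i; simp only [Pi.add_apply, map_add]; abel
  map_smul' c α := by
    funext i; simp only [Pi.smul_apply, map_smul, RingHom.id_apply, smul_add]

/-- Negative cyclic cocycles. -/
def cycZ (d : A →ₗ[k] A) : Submodule k (ℕ → List A → A → k) := cyc 𝒜 ⊓ LinearMap.ker (cycD 𝒜 d)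
/-- Negative cyclic coboundaries. -/
def cycB (d : A →ₗ[k] A) : Submodule k (ℕ → List A → A → k) := (cyc 𝒜).map (cycD 𝒜 d)
/-- Negative cyclic cohomology `HC_-^•(A)`. -/
abbrev HC (d : A →ₗ[k] A) : Type _ := Homology (cycZ 𝒜 d) (cycB 𝒜 d)

/-- The even cocycles `∑ᵢ αᵢ v⁻ⁱ`: all `αᵢ` are even (`v` has degree `-2`). -/
def cycZeven (d : A →ₗ[k] A) : Submodule k (ℕ → List A → A → k) :=
  cycZ 𝒜 d ⊓ Submodule.pi Set.univ fun _ => parityCochains 𝒜 (dualGrading 𝒜) 0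

/-- The even part `HC_-^{2•}(A)`. -/
def HCeven (d : A →ₗ[k] A) : Submodule k (HC 𝒜 d) :=
  ((cycZeven 𝒜 d).submoduleOf (cycZ 𝒜 d)).map ((cycB 𝒜 d).submoduleOf (cycZ 𝒜 d)).mkQ

/-- The map `I : HH^•(A, A^*) → HC_-^•(A)` induced by the inclusion of the `v⁰` part. -/
def mapI (d : A →ₗ[k] A) : HHdual 𝒜 d → HC 𝒜 d :=
  induced (coZ 𝒜 d) (coB 𝒜 d) (cycZ 𝒜 d) (cycB 𝒜 d) fun f => Pi.single 0 f

/-- The connecting map `𝓑 : HC_-^•(A) → HH^•(A, A^*)`, `∑ᵢ αᵢ v⁻ⁱ ↦ B^* α₀`. -/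
def mapB (d : A →ₗ[k] A) : HC 𝒜 d → HHdual 𝒜 d :=
  induced (cycZ 𝒜 d) (cycB 𝒜 d) (coZ 𝒜 d) (coB 𝒜 d) fun α => connes 𝒜 (α 0)

/-- The bracket `{x, y} = I(𝓑 x ⊔ 𝓑 y)` on `HC_-^•(A)`. -/
def cycBracket (d : A →ₗ[k] A) (Tr : A →ₗ[k] k) (hω : Function.Bijective (omegaHH 𝒜 d Tr))
    (x y : HC 𝒜 d) : HC 𝒜 d :=
  mapI 𝒜 d (sqcup 𝒜 d Tr hω (mapB 𝒜 d x) (mapB 𝒜 d y))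

/-! ## Parities of products and differentials -/

theorem mul_mem_parityPart {p q : ZMod 2} {a b : A} (ha : a ∈ parityPart 𝒜 p)
    (hb : b ∈ parityPart 𝒜 q) : a * b ∈ parityPart 𝒜 (p + q) := by
  refine parityPart_induction 𝒜 (P := fun a => a * b ∈ parityPart 𝒜 (p + q))
    (fun i hi a ha => ?_) (by simp) (fun x y hx hy => by rw [add_mul]; exact add_mem hx hy) ha
  refine parityPart_induction 𝒜 (P := fun b => a * b ∈ parityPart 𝒜 (p + q))
    (fun j hj b hb => ?_) (by simp) (fun x y hx hy => by rw [mul_add]; exact add_mem hx hy) hb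
  exact mem_parityPart 𝒜 (i := i + j) (by push_cast; rw [hi, hj]) (SetLike.mul_mem_graded ha hb)

theorem d_mem_parityPart {d : A →ₗ[k] A} (hd : IsDGA 𝒜 d) {p : ZMod 2} {a : A}
    (ha : a ∈ parityPart 𝒜 p) : d a ∈ parityPart 𝒜 (p + 1) := by
  refine parityPart_induction 𝒜 (P := fun a => d a ∈ parityPart 𝒜 (p + 1))
    (fun i hi a ha => ?_) (by simp) (fun x y hx hy => by rw [map_add]; exact add_mem hx hy) ha
  exact mem_parityPart 𝒜 (i := i + 1) (by push_cast; rw [hi]) (hd.degree i a ha)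

/-- The space `A^{odd}`. -/
abbrev OddPart : Submodule k A := parityPart 𝒜 1

/-- The curvature `da + a · a`. -/
def curv (d : A →ₗ[k] A) (a : OddPart 𝒜) : A := d a + a * a

/-- The twisted differential `d_a y = dy + [a, y]` of odd elements `y`: the derivative of the
curvature at `a`. -/
def twD (d : A →ₗ[k] A) (a y : OddPart 𝒜) : A := d y + (a * y + y * a)

/-- The Maurer-Cartan set. -/
def MC (d : A →ₗ[k] A) : Set (OddPart 𝒜) := {a | curv 𝒜 d a = 0}

/-- The vector field `ξ_x(a) = [x, a] - dx` on `A^{odd}` of an even element `x`. -/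
def gauge {d : A →ₗ[k] A} (hd : IsDGA 𝒜 d) (x : parityPart 𝒜 0) (a : OddPart 𝒜) : OddPart 𝒜 :=
  ⟨x * a - a * x - d x, by
    have h1 := mul_mem_parityPart 𝒜 x.2 a.2
    have h2 := mul_mem_parityPart 𝒜 a.2 x.2
    have h3 := d_mem_parityPart 𝒜 hd x.2
    rw [zero_add] at h1 h3
    rw [add_zero] at h2
    exact sub_mem (sub_mem h1 h2) h3⟩

end DGA

/-! ## Functions on the Maurer-Cartan moduli space -/

section Functions

variable {k : Type*} [RCLike k]

/-- Polynomial maps between vector spaces: finite sums of maps `a ↦ f(a, …, a)` with `f`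
multilinear. -/
def Pol (k : Type*) [RCLike k] (V U : Type*) [AddCommGroup V] [Module k V] [AddCommGroup U]
    [Module k U] : Submodule k (V → U) :=
  Submodule.span k {p | ∃ (n : ℕ) (f : MultilinearMap k (fun _ : Fin n => V) U),
    p = fun a => f fun _ => a}

variable {A : Type*} [Ring A] [Algebra k A] (𝒜 : ℤ → Submodule k A)

/-- The polynomial maps on `A^{odd}` that vanish on the scheme `da + a · a = 0`: those of the form
`a ↦ G(a)(da + a · a)` with `G` a polynomial map to linear maps. -/
def vanish (d : A →ₗ[k] A) (U : Type*) [AddCommGroup U] [Module k U] :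
    Submodule k (OddPart 𝒜 → U) :=
  (Pol k (OddPart 𝒜) (A →ₗ[k] U)).map
    ({ toFun := fun G a => G a (curv 𝒜 d a)
       map_add' := fun _ _ => rfl
       map_smul' := fun _ _ => rfl } : (OddPart 𝒜 → A →ₗ[k] U) →ₗ[k] (OddPart 𝒜 → U))

variable [GradedAlgebra 𝒜]

/-- The polynomial functions on `A^{odd}` whose restriction to the Maurer-Cartan scheme is
invariant under the infinitesimal action of `A^{even}`: for every even `x` the derivative of `ψ`
along `ξ_x` vanishes on that scheme. -/
def invariants {d : A →ₗ[k] A} (hd : IsDGA 𝒜 d) : Submodule k (OddPart 𝒜 → k) where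
  carrier := {ψ | ψ ∈ Pol k (OddPart 𝒜) k ∧ ∀ x : parityPart 𝒜 0, ∃ g ∈ vanish 𝒜 d k,
    ∀ a, HasDerivAt (fun t : k => ψ (a + t • gauge 𝒜 hd x a)) (g a) 0}
  add_mem' := by
    rintro ψ χ ⟨h1, h2⟩ ⟨h3, h4⟩
    refine ⟨add_mem h1 h3, fun x => ?_⟩
    obtain ⟨g, hg, h⟩ := h2 x
    obtain ⟨g', hg', h'⟩ := h4 x
    exact ⟨g + g', add_mem hg hg', fun a => (h a).add (h' a)⟩
  zero_mem' := ⟨zero_mem _, fun _ => ⟨0, zero_mem _, fun _ => hasDerivAt_const _ _⟩⟩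
  smul_mem' := by
    rintro c ψ ⟨h1, h2⟩
    refine ⟨Submodule.smul_mem _ c h1, fun x => ?_⟩
    obtain ⟨g, hg, h⟩ := h2 x
    exact ⟨c • g, Submodule.smul_mem _ c hg, fun a => (h a).const_smul c⟩

/-- The space `𝒪(ℳ𝒞)` of functions on the moduli space: gauge invariant functions on the
Maurer-Cartan scheme. -/
abbrev Fun {d : A →ₗ[k] A} (hd : IsDGA 𝒜 d) : Type _ :=
  Homology (invariants 𝒜 hd) (vanish 𝒜 d k)

/-- `X` is a Hamiltonian vector field on the Maurer-Cartan scheme for the function `ψ`: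
it is tangent to that scheme (`d_a X_a = 0` along it), and `ω(X_a, Y) = dψ_a(Y)` for tangent
vectors `Y`, i.e. up to terms that vanish when `d_a Y = 0` and terms that vanish when
`da + a · a = 0`. -/
structure IsHamiltonianField (d : A →ₗ[k] A) (Tr : A →ₗ[k] k) (ψ : OddPart 𝒜 → k)
    (X : OddPart 𝒜 → OddPart 𝒜) : Prop where
  poly : X ∈ Pol k (OddPart 𝒜) (OddPart 𝒜)
  tangent : (fun a => twD 𝒜 d a (X a)) ∈ vanish 𝒜 d A
  hamilton : ∃ H ∈ Pol k (OddPart 𝒜) (A →ₗ[k] k), ∃ K ∈ vanish 𝒜 d (OddPart 𝒜 →ₗ[k] k),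
    ∀ a Y : OddPart 𝒜, HasDerivAt (fun t : k => ψ (a + t • Y))
      (Tr ((X a : A) * Y) + H a (twD 𝒜 d a Y) + K a Y) 0

/-- The Hamiltonian functions in `𝒪(ℳ𝒞)`, those that have a Hamiltonian vector field: the
domain of the Poisson bracket. -/
def hamFun {d : A →ₗ[k] A} (hd : IsDGA 𝒜 d) (Tr : A →ₗ[k] k) : Submodule k (Fun 𝒜 hd) where
  carrier := {ψ | ∃ (p : invariants 𝒜 hd) (X : OddPart 𝒜 → OddPart 𝒜),
    cls (vanish 𝒜 d k) p = ψ ∧ IsHamiltonianField 𝒜 d Tr p X}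
  add_mem' := by
    rintro _ _ ⟨p, X, rfl, hX⟩ ⟨q, Y, rfl, hY⟩
    refine ⟨p + q, X + Y, rfl, add_mem hX.poly hY.poly, ?_, ?_⟩
    · convert add_mem hX.tangent hY.tangent using 1
      funext a
      simp only [twD, Pi.add_apply, Submodule.coe_add, map_add, mul_add, add_mul]
      abel
    · obtain ⟨H, hH, K, hK, h⟩ := hX.hamilton
      obtain ⟨H', hH', K', hK', h'⟩ := hY.hamilton
      refine ⟨H + H', add_mem hH hH', K + K', add_mem hK hK', fun a Z => ?_⟩
      refine ((h a Z).add (h' a Z)).congr_deriv ?_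
      simp only [Pi.add_apply, Submodule.coe_add, add_mul, map_add, LinearMap.add_apply]
      ring
  zero_mem' := ⟨0, 0, rfl, zero_mem _, by
      have e : (fun a => twD 𝒜 d a ((0 : OddPart 𝒜 → OddPart 𝒜) a)) = 0 := by
        funext a
        simp [twD]
      rw [e]
      exact zero_mem _, 0, zero_mem _, 0, zero_mem _, fun a Z => by
      simpa using hasDerivAt_const (0 : k) (0 : k)⟩
  smul_mem' := by
    rintro c _ ⟨p, X, rfl, hX⟩
    refine ⟨c • p, c • X, rfl, Submodule.smul_mem _ c hX.poly, ?_, ?_⟩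
    · have e : (fun a => twD 𝒜 d a ((c • X) a)) = c • fun a => twD 𝒜 d a (X a) := by
        funext a
        simp [twD, smul_add]
      rw [e]
      exact Submodule.smul_mem _ c hX.tangent
    · obtain ⟨H, hH, K, hK, h⟩ := hX.hamilton
      refine ⟨c • H, Submodule.smul_mem _ c hH, c • K, Submodule.smul_mem _ c hK, fun a Z => ?_⟩
      refine ((h a Z).const_smul c).congr_deriv ?_
      simp [smul_eq_mul, mul_add]

/-- `θ` is a Poisson bracket `{ψ, χ} = ω(X^ψ, X^χ)`, formed with Hamiltonian vector fields of
`ψ` and `χ`. -/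
def IsPoissonBracket {d : A →ₗ[k] A} (hd : IsDGA 𝒜 d) (Tr : A →ₗ[k] k)
    (ψ χ θ : Fun 𝒜 hd) : Prop :=
  ∃ (p q r : invariants 𝒜 hd) (X Y : OddPart 𝒜 → OddPart 𝒜),
    cls (vanish 𝒜 d k) p = ψ ∧ cls (vanish 𝒜 d k) q = χ ∧ cls (vanish 𝒜 d k) r = θ ∧
    IsHamiltonianField 𝒜 d Tr p X ∧ IsHamiltonianField 𝒜 d Tr q Y ∧
    ∀ a, (r : OddPart 𝒜 → k) a = Tr ((X a : A) * Y a)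

/-- `X` is a Hamiltonian vector of `ψ` at the point `a`: it lies in the Zariski tangent space
`ker d_a`, and `ω(X, Y) = dψ_a(Y)` for all `Y` there. -/
def IsHamiltonianVector (d : A →ₗ[k] A) (Tr : A →ₗ[k] k) (ψ : OddPart 𝒜 → k) (a X : OddPart 𝒜) : Prop :=
  twD 𝒜 d a X = 0 ∧ ∀ Y : OddPart 𝒜, twD 𝒜 d a Y = 0 →
    HasDerivAt (fun t : k => ψ (a + t • Y)) (Tr ((X : A) * Y)) 0

/-! ## The map `ρ` -/

/-- The pairing `⟨α, R(a)⟩` of a negative cyclic cochain with `R(a) = ∑ₙ 1 ⊗ a^{⊗n}`. -/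
def pairR (α : ℕ → List A → A → k) (a : OddPart 𝒜) : k :=
  ∑ᶠ n : ℕ, α 0 (List.replicate n (a : A)) 1

/-- The map `ρ : HC_-^•(A) → 𝒪(ℳ𝒞)`, `[α] ↦ (a ↦ ⟨α, R(a)⟩)`. -/
def rho {d : A →ₗ[k] A} (hd : IsDGA 𝒜 d) : HC 𝒜 d → Fun 𝒜 hd :=
  induced (cycZ 𝒜 d) (cycB 𝒜 d) (invariants 𝒜 hd) (vanish 𝒜 d k) (pairR 𝒜)

/-- The maps `∪`, `ω_♯`, `Δ`, `I`, `𝓑` send cocycles to cocycles and descend to cohomology. -/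
def StructureMapsWellDefined (d : A →ₗ[k] A) (Tr : A →ₗ[k] k) : Prop :=
  Induces₂ (selfZ 𝒜 d) (selfB 𝒜 d) (selfZ 𝒜 d) (selfB 𝒜 d) (selfZ 𝒜 d) (selfB 𝒜 d) (cup 𝒜) ∧
  Induces (selfZ 𝒜 d) (selfB 𝒜 d) (coZ 𝒜 d) (coB 𝒜 d) (omegaSharp Tr) ∧
  Induces (coZ 𝒜 d) (coB 𝒜 d) (coZ 𝒜 d) (coB 𝒜 d) (connes 𝒜) ∧
  Induces (coZ 𝒜 d) (coB 𝒜 d) (cycZ 𝒜 d) (cycB 𝒜 d) (fun f => Pi.single 0 f) ∧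
  Induces (cycZ 𝒜 d) (cycB 𝒜 d) (coZ 𝒜 d) (coB 𝒜 d) (fun α => connes 𝒜 (α 0))

/-- `ρ` is well defined: `⟨α, R(a)⟩` is a polynomial function of `a`, gauge invariant on the
Maurer-Cartan scheme, and depends there only on the class of `α`. -/
def RhoWellDefined {d : A →ₗ[k] A} (hd : IsDGA 𝒜 d) : Prop :=
  Induces (cycZ 𝒜 d) (cycB 𝒜 d) (invariants 𝒜 hd) (vanish 𝒜 d k) (pairR 𝒜)

end Functions

end MCRep

end

/-! The theorem comes from evaluating cochains on words `a … a` with `a` odd. Such an `a` has even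
degree in the shifted space, so all Koszul signs disappear, and the sum `S_g(a) = ∑ₙ g(a, …, a)`
(`wordSum`) turns Hochschild calculus into calculus on the Maurer-Cartan scheme. The Hochschild
differential becomes the differential twisted by `a`, up to multiples of the curvature
(`wordSum_hochD`, `exists_wordSum_coD`). The cup product becomes multiplication in `A`
(`wordSum_cup`). Since the rotations of `y a … a` put `y` in every position, Connes' operator
becomes differentiation: the derivative of `⟨α, R(a)⟩` is `-S_g(a)` for `g = B^* α₀` (`isPD_pairR`).

These facts give the properties of `ρ`. By `exists_wordSum_coD`, the value of `S_{δg}(a)` at `y` is,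
modulo the curvature, the value of `S_g(a)` at a vector that is `0` for `y = 1`, `-ξ_y(a)` for `y`
even and `-d_a y` for `y` odd. The first case shows that `ρ` depends only on the class, the second
that `⟨α, R(a)⟩` is gauge invariant, because `B^* α₀` is a cocycle. For the third, bijectivity of
`ω_♯` on cohomology provides, for even `α`, an odd cocycle `f` of `C(A, A)` with `ω ∘ f`
cohomologous to `B^* α₀`; then `X(a) = -S_f(a)` is tangent to the scheme and is a Hamiltonian field
of `⟨α, R(a)⟩` (`isHamiltonianField_wordField`). If `g` plays the same role for `β`, the bracket is
represented by `ω ∘ (f ∪ g)`, whose image under `ρ` is `Tr(S_f S_g) = Tr(XY)` (`rho_cycBracket`).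

Two Lie algebra structures remain. On cyclic cohomology, `𝓑 I = Δ`, `I Δ = 0` and `Δ 𝓑 = 0` reduce
the Jacobi identity to the derivation property of the BV bracket (`isLieBracket_evenBracket`). On
functions one argues as on a symplectic manifold, with all identities read modulo one-forms and
functions that vanish on the scheme. Differentiating the Hamilton equation gives the symmetry
`IsHamiltonianField.symm`, and from it the Hamiltonian field of a bracket and the Jacobi identity
follow.

The laborious part is that the structure maps descend to cohomology: the Leibniz rule `selfD_cup`
and the anticommutation `coD_connes` of `δ^*` with `B^*`. Both are identities between multilinear
functions of words. They are checked on letters of definite parity, where every Koszul sign is a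
scalar, and the second is reduced to identities for cyclic sums. -/

noncomputable section

namespace MCRep

/-! ## Maps between subquotients -/

section Subquotients

variable {k : Type*} [Field k] {M M' M'' : Type*} [AddCommGroup M] [Module k M]
  [AddCommGroup M'] [Module k M'] [AddCommGroup M''] [Module k M'']
  {Z B : Submodule k M} {Z' B' : Submodule k M'} {Z'' B'' : Submodule k M''}

theorem cls_eq_cls {z w : Z} : cls B z = cls B w ↔ (z : M) - w ∈ B := Submodule.Quotient.eq _

theorem cls_surjective (x : Homology Z B) : ∃ z : Z, cls B z = x := Submodule.mkQ_surjective _ x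

theorem Induces.induced_cls {T : M → M'} (h : Induces Z B Z' B' T) (z : Z) :
    induced Z B Z' B' T (cls B z) = cls B' ⟨T z, h.1 z z.2⟩ := by
  rw [induced, dif_pos h]; rfl

theorem Induces₂.induced₂_cls {T : M → M' → M''} (h : Induces₂ Z B Z' B' Z'' B'' T) (z : Z)
    (w : Z') : induced₂ Z B Z' B' Z'' B'' T (cls B z) (cls B' w) =
      cls B'' ⟨T z w, h.1 z z.2 w w.2⟩ := by
  rw [induced₂, dif_pos h]; rfl

/-- `induced` is only a function of sets, given by a case distinction; linearity has to be recovered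
from that of `T` on cocycles. -/
theorem Induces.isLinearMap {T : M → M'} (h : Induces Z B Z' B' T)
    (hadd : ∀ x ∈ Z, ∀ y ∈ Z, T (x + y) = T x + T y)
    (hsmul : ∀ c : k, ∀ x ∈ Z, T (c • x) = c • T x) :
    IsLinearMap k (induced Z B Z' B' T) := by
  refine ⟨fun x y => ?_, fun c x => ?_⟩
  · obtain ⟨x, rfl⟩ := cls_surjective x
    obtain ⟨y, rfl⟩ := cls_surjective y
    have e : cls B x + cls B y = cls B (x + y) := rfl
    rw [e, h.induced_cls, h.induced_cls, h.induced_cls]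
    refine (cls_eq_cls (w := ⟨T x, h.1 x x.2⟩ + ⟨T y, h.1 y y.2⟩)).2 ?_
    simp [hadd x x.2 y y.2]
  · obtain ⟨x, rfl⟩ := cls_surjective x
    have e : c • cls B x = cls B (c • x) := rfl
    rw [e, h.induced_cls, h.induced_cls]
    refine (cls_eq_cls (w := c • ⟨T x, h.1 x x.2⟩)).2 ?_
    simp [hsmul c x x.2]

theorem Induces₂.isLinearMap_left {T : M → M' → M''} (h : Induces₂ Z B Z' B' Z'' B'' T)
    (hadd : ∀ x ∈ Z, ∀ y ∈ Z, ∀ w ∈ Z', T (x + y) w = T x w + T y w)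
    (hsmul : ∀ c : k, ∀ x ∈ Z, ∀ w ∈ Z', T (c • x) w = c • T x w) (w : Homology Z' B') :
    IsLinearMap k (fun x => induced₂ Z B Z' B' Z'' B'' T x w) := by
  obtain ⟨w, rfl⟩ := cls_surjective w
  refine ⟨fun x y => ?_, fun c x => ?_⟩
  · obtain ⟨x, rfl⟩ := cls_surjective x
    obtain ⟨y, rfl⟩ := cls_surjective y
    have e : cls B x + cls B y = cls B (x + y) := rfl
    rw [e, h.induced₂_cls, h.induced₂_cls, h.induced₂_cls]
    refine (cls_eq_cls (w := ⟨T x w, h.1 x x.2 w w.2⟩ + ⟨T y w, h.1 y y.2 w w.2⟩)).2 ?_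
    simp [hadd x x.2 y y.2 w w.2]
  · obtain ⟨x, rfl⟩ := cls_surjective x
    have e : c • cls B x = cls B (c • x) := rfl
    rw [e, h.induced₂_cls, h.induced₂_cls]
    refine (cls_eq_cls (w := c • ⟨T x w, h.1 x x.2 w w.2⟩)).2 ?_
    simp [hsmul c x x.2 w w.2]

theorem Induces₂.isLinearMap_right {T : M → M' → M''} (h : Induces₂ Z B Z' B' Z'' B'' T)
    (hadd : ∀ x ∈ Z, ∀ y ∈ Z', ∀ w ∈ Z', T x (y + w) = T x y + T x w)
    (hsmul : ∀ c : k, ∀ x ∈ Z, ∀ w ∈ Z', T x (c • w) = c • T x w) (x : Homology Z B) :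
    IsLinearMap k (fun w => induced₂ Z B Z' B' Z'' B'' T x w) := by
  obtain ⟨x, rfl⟩ := cls_surjective x
  refine ⟨fun y w => ?_, fun c w => ?_⟩
  · obtain ⟨y, rfl⟩ := cls_surjective y
    obtain ⟨w, rfl⟩ := cls_surjective w
    have e : cls B' y + cls B' w = cls B' (y + w) := rfl
    rw [e, h.induced₂_cls, h.induced₂_cls, h.induced₂_cls]
    refine (cls_eq_cls (w := ⟨T x y, h.1 x x.2 y y.2⟩ + ⟨T x w, h.1 x x.2 w w.2⟩)).2 ?_
    simp [hadd x x.2 y y.2 w w.2]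
  · obtain ⟨w, rfl⟩ := cls_surjective w
    have e : c • cls B' w = cls B' (c • w) := rfl
    rw [e, h.induced₂_cls, h.induced₂_cls]
    refine (cls_eq_cls (w := c • ⟨T x w, h.1 x x.2 w w.2⟩)).2 ?_
    simp [hsmul c x x.2 w w.2]

end Subquotients

/-! ## Multilinear functions on words -/

section Linear

variable {k : Type*} [Field k] {A M M' : Type*} [AddCommGroup A] [Module k A]
  [AddCommGroup M] [Module k M] [AddCommGroup M'] [Module k M']

theorem isLinearMap_add {f g : A → M} (hf : IsLinearMap k f) (hg : IsLinearMap k g) :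
    IsLinearMap k fun a => f a + g a := (hf.mk' f + hg.mk' g).isLinear

theorem isLinearMap_sub {f g : A → M} (hf : IsLinearMap k f) (hg : IsLinearMap k g) :
    IsLinearMap k fun a => f a - g a := (hf.mk' f - hg.mk' g).isLinear

theorem isLinearMap_neg {f : A → M} (hf : IsLinearMap k f) :
    IsLinearMap k fun a => -f a := (-hf.mk' f).isLinear

theorem isLinearMap_smul (c : k) {f : A → M} (hf : IsLinearMap k f) :
    IsLinearMap k fun a => c • f a := (c • hf.mk' f).isLinear

theorem isLinearMap_comp {g : M → M'} {f : A → M} (hg : IsLinearMap k g) (hf : IsLinearMap k f) :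
    IsLinearMap k fun a => g (f a) := (hg.mk' g ∘ₗ hf.mk' f).isLinear

theorem isLinearMap_sum {ι : Type*} (s : Finset ι) {f : ι → A → M}
    (hf : ∀ i ∈ s, IsLinearMap k (f i)) : IsLinearMap k fun a => ∑ i ∈ s, f i a := by
  refine ⟨fun x y => ?_, fun c x => ?_⟩
  · rw [← Finset.sum_add_distrib]
    exact Finset.sum_congr rfl fun i hi => (hf i hi).map_add x y
  · rw [Finset.smul_sum]
    exact Finset.sum_congr rfl fun i hi => (hf i hi).map_smul c x

theorem isLinearMap_pi {ι : Type*} {f : A → ι → M} (hf : ∀ i, IsLinearMap k fun a => f a i) :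
    IsLinearMap k f :=
  ⟨fun x y => funext fun i => (hf i).map_add x y, fun c x => funext fun i => (hf i).map_smul c x⟩

variable (k) in
/-- The function `F` on words is linear in each letter. -/
def Multilin (F : List A → M) : Prop := ∀ l r, IsLinearMap k fun a => F (l ++ a :: r)

namespace Multilin

variable {F G : List A → M}

theorem add (hF : Multilin k F) (hG : Multilin k G) : Multilin k fun l => F l + G l :=
  fun l r => isLinearMap_add (hF l r) (hG l r)

theorem sub (hF : Multilin k F) (hG : Multilin k G) : Multilin k fun l => F l - G l :=
  fun l r => isLinearMap_sub (hF l r) (hG l r)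

theorem neg (hF : Multilin k F) : Multilin k fun l => -F l := fun l r => isLinearMap_neg (hF l r)

theorem smul (c : k) (hF : Multilin k F) : Multilin k fun l => c • F l :=
  fun l r => isLinearMap_smul c (hF l r)

theorem linear_comp {T : M → M'} (hT : IsLinearMap k T) (hF : Multilin k F) :
    Multilin k fun l => T (F l) := fun l r => isLinearMap_comp hT (hF l r)

theorem pi {ι : Type*} {F : List A → ι → M} (hF : ∀ i, Multilin k fun l => F l i) :
    Multilin k F := fun l r => isLinearMap_pi fun i => hF i l r

theorem apply {ι : Type*} {F : List A → ι → M} (hF : Multilin k F) (i : ι) :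
    Multilin k fun l => F l i := fun l r =>
  ⟨fun x y => congrFun ((hF l r).map_add x y) i, fun c x => congrFun ((hF l r).map_smul c x) i⟩

theorem append_left (hF : Multilin k F) (u : List A) : Multilin k fun l => F (u ++ l) :=
  fun l r => by simpa only [List.append_assoc] using hF (u ++ l) r

theorem append_right (hF : Multilin k F) (v : List A) : Multilin k fun l => F (l ++ v) :=
  fun l r => by simpa only [List.append_assoc, List.cons_append] using hF l (r ++ v)

theorem cons (hF : Multilin k F) (a : A) : Multilin k fun l => F (a :: l) := hF.append_left [a]

theorem head (hF : Multilin k F) (l : List A) : IsLinearMap k fun a => F (a :: l) := hF [] l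

theorem comp_map (hF : Multilin k F) (T : A →ₗ[k] A) : Multilin k fun l => F (l.map T) :=
  fun l r => by
    simpa only [List.map_append, List.map_cons] using
      isLinearMap_comp (hF (l.map T) (r.map T)) T.isLinear

/-- At every cut a given letter lies either in the prefix or in the suffix, and the number of cuts
depends only on the length of the word. The bound `n` is left free: the cup product uses all cuts, a
sum of rotations leaves out the last one. -/
theorem splitSum {E : List A → List A → M} (h1 : ∀ v, Multilin k fun u => E u v)
    (h2 : ∀ u, Multilin k fun v => E u v) (n : ℕ → ℕ) :
    Multilin k fun l => ∑ i ∈ Finset.range (n l.length), E (l.take i) (l.drop i) := by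
  intro l r
  have hlen (a : A) : (l ++ a :: r).length = l.length + (r.length + 1) := by simp
  simp only [hlen]
  refine isLinearMap_sum _ fun i _ => ?_
  rcases le_or_gt i l.length with h | h
  · have e (a : A) : (l ++ a :: r).take i = l.take i := List.take_append_of_le_length h
    have e' (a : A) : (l ++ a :: r).drop i = l.drop i ++ a :: r := List.drop_append_of_le_length h
    simp only [e, e']
    exact h2 _ _ _
  · obtain ⟨j, rfl⟩ := Nat.exists_eq_add_of_lt h
    have e (a : A) : (l ++ a :: r).take (l.length + j + 1) = l ++ a :: r.take j := by
      rw [add_assoc, List.take_length_add_append, List.take_succ_cons]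
    have e' (a : A) : (l ++ a :: r).drop (l.length + j + 1) = r.drop j := by
      rw [add_assoc, List.drop_length_add_append, List.drop_succ_cons]
    simp only [e, e']
    exact h1 _ _ _

/-- Letters are treated one at a time: both sides are linear in the first letter not yet restricted,
so it may be taken in `S` and joins the prefix `u`. -/
theorem ext_span {S : Set A} (hS : Submodule.span k S = ⊤) (hF : Multilin k F)
    (hG : Multilin k G) (h : ∀ l : List A, (∀ a ∈ l, a ∈ S) → F l = G l) : F = G := by
  have key : ∀ l u : List A, (∀ a ∈ u, a ∈ S) → F (u ++ l) = G (u ++ l) := by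
    intro l
    induction l with
    | nil => intro u hu; simpa using h u hu
    | cons a l ih =>
      intro u hu
      have e : (hF u l).mk' _ a = (hG u l).mk' _ a := by
        refine LinearMap.eqOn_span (s := S) (fun b hb => ?_) (hS ▸ Submodule.mem_top)
        have := ih (u ++ [b]) (by
          intro c hc
          rcases List.mem_append.1 hc with hc | hc
          · exact hu c hc
          · rw [List.mem_singleton.1 hc]; exact hb)
        simpa using this
      exact e
  exact funext fun l => key l [] (by simp)

end Multilin

end Linear

/-! ## The parity involution -/

section Parity

variable {k : Type*} [Field k] {A : Type*} [Ring A] [Algebra k A]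
  (𝒜 : ℤ → Submodule k A) [GradedAlgebra 𝒜]

theorem par_of_mem {i : ℤ} {a : A} (ha : a ∈ 𝒜 i) :
    par 𝒜 a = ((i.negOnePow : ℤˣ) : ℤ) • a := by
  simp only [par, LinearMap.comp_apply]
  have : (DirectSum.decomposeLinearEquiv 𝒜).toLinearMap a = DirectSum.of (fun i => 𝒜 i) i ⟨a, ha⟩ :=
    DirectSum.decompose_of_mem 𝒜 ha
  rw [this]
  erw [DirectSum.toModule_lof]
  simp

theorem par_mem {i : ℤ} {a : A} (ha : a ∈ 𝒜 i) : par 𝒜 a ∈ 𝒜 i := by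
  rw [par_of_mem 𝒜 ha]; exact zsmul_mem ha _

theorem spar_mem {i : ℤ} {a : A} (ha : a ∈ 𝒜 i) : spar 𝒜 a ∈ 𝒜 i := neg_mem (par_mem 𝒜 ha)

theorem spar_apply (a : A) : spar 𝒜 a = -par 𝒜 a := rfl

theorem units_smul_smul (u : ℤˣ) (a : A) : (u : ℤ) • (u : ℤ) • a = a := by
  rcases Int.units_eq_one_or u with rfl | rfl <;> simp

@[simp] theorem par_par (a : A) : par 𝒜 (par 𝒜 a) = a := by
  induction a using DirectSum.Decomposition.inductionOn 𝒜 with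
  | zero => simp
  | homogeneous a =>
    rw [par_of_mem 𝒜 a.2, map_zsmul, par_of_mem 𝒜 a.2, units_smul_smul]
  | add a b ha hb => rw [map_add, map_add, ha, hb]

@[simp] theorem spar_spar (a : A) : spar 𝒜 (spar 𝒜 a) = a := by simp [spar_apply]

@[simp] theorem par_one : par 𝒜 1 = 1 := by
  rw [par_of_mem 𝒜 SetLike.GradedOne.one_mem]; simp

theorem par_mul (a b : A) : par 𝒜 (a * b) = par 𝒜 a * par 𝒜 b := by
  induction a using DirectSum.Decomposition.inductionOn 𝒜 with
  | zero => simp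
  | homogeneous a =>
    rename_i i
    induction b using DirectSum.Decomposition.inductionOn 𝒜 with
    | zero => simp
    | homogeneous b =>
      rename_i j
      rw [par_of_mem 𝒜 a.2, par_of_mem 𝒜 b.2, par_of_mem 𝒜 (SetLike.mul_mem_graded a.2 b.2),
        Int.negOnePow_add, smul_mul_smul_comm]
      simp
    | add b c hb hc => rw [mul_add, map_add, map_add, hb, hc, mul_add]
  | add a c ha hc => rw [add_mul, map_add, map_add, ha, hc, add_mul]

variable {𝒜} in
theorem IsDGA.d_par {d : A →ₗ[k] A} (hd : IsDGA 𝒜 d) (a : A) : d (par 𝒜 a) = -par 𝒜 (d a) := by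
  induction a using DirectSum.Decomposition.inductionOn 𝒜 with
  | zero => simp
  | homogeneous a =>
    rename_i i
    rw [par_of_mem 𝒜 a.2, par_of_mem 𝒜 (hd.degree i a a.2), map_zsmul, Int.negOnePow_succ]
    simp
  | add a b ha hb => rw [map_add, map_add, map_add, map_add, ha, hb, neg_add]

variable {𝒜} in
theorem IsDGA.d_spar {d : A →ₗ[k] A} (hd : IsDGA 𝒜 d) (a : A) :
    d (spar 𝒜 a) = -spar 𝒜 (d a) := by simp [spar_apply, hd.d_par]

variable {𝒜} in
theorem IsDGA.d_mul {d : A →ₗ[k] A} (hd : IsDGA 𝒜 d) (a b : A) :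
    d (a * b) = d a * b + par 𝒜 a * d b := by
  induction a using DirectSum.Decomposition.inductionOn 𝒜 with
  | zero => simp
  | homogeneous a =>
    rename_i i
    rw [hd.leibniz i a a.2, par_of_mem 𝒜 a.2, smul_mul_assoc]
  | add a c ha hc => simp only [add_mul, map_add, ha, hc]; abel

variable {𝒜} in
theorem IsDGA.d_one {d : A →ₗ[k] A} (hd : IsDGA 𝒜 d) : d 1 = 0 := by
  simpa using hd.d_mul 1 1

theorem par_of_even {a : A} (ha : a ∈ parityPart 𝒜 0) : par 𝒜 a = a := by
  refine parityPart_induction 𝒜 (P := fun a => par 𝒜 a = a) (fun i hi a ha => ?_) (by simp)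
    (fun a b ha hb => by rw [map_add, ha, hb]) ha
  rw [par_of_mem 𝒜 ha, Int.negOnePow_even i ((ZMod.intCast_eq_zero_iff_even).1 hi)]
  simp

theorem par_of_odd {a : A} (ha : a ∈ parityPart 𝒜 1) : par 𝒜 a = -a := by
  refine parityPart_induction 𝒜 (P := fun a => par 𝒜 a = -a) (fun i hi a ha => ?_) (by simp)
    (fun a b ha hb => by rw [map_add, ha, hb, neg_add]) ha
  rw [par_of_mem 𝒜 ha, Int.negOnePow_odd i ((ZMod.intCast_eq_one_iff_odd).1 hi)]
  simp

theorem spar_of_odd {a : A} (ha : a ∈ parityPart 𝒜 1) : spar 𝒜 a = a := by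
  rw [spar_apply, par_of_odd 𝒜 ha, neg_neg]

end Parity

/-! ## Koszul signs -/

section Signs

variable {k : Type*} [Field k]

/-- The Koszul sign `(-1)^{pq}` in terms of `s = (-1)^p` and `t = (-1)^q`. -/
def ksgn (s t : k) : k := 2⁻¹ * (1 + s + t - s * t)

variable [CharZero k]

@[simp] theorem ksgn_one_left (t : k) : ksgn 1 t = 1 := by
  rw [ksgn]; field_simp; ring
@[simp] theorem ksgn_one_right (t : k) : ksgn t 1 = 1 := by
  rw [ksgn]; field_simp; ring
@[simp] theorem ksgn_neg_one_left (t : k) : ksgn (-1) t = t := by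
  rw [ksgn]; field_simp; ring
@[simp] theorem ksgn_neg_one_right (t : k) : ksgn t (-1) = t := by
  rw [ksgn]; field_simp; ring

/-- `s` is `1` or `-1`. -/
def IsSign (s : k) : Prop := s = 1 ∨ s = -1

omit [CharZero k] in
theorem IsSign.mul {s t : k} (hs : IsSign s) (ht : IsSign t) : IsSign (s * t) := by
  rcases hs with rfl | rfl <;> rcases ht with rfl | rfl <;> simp [IsSign]

omit [CharZero k] in
theorem IsSign.neg {s : k} (hs : IsSign s) : IsSign (-s) := by
  rcases hs with rfl | rfl <;> simp [IsSign]

omit [CharZero k] in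
theorem isSign_one : IsSign (1 : k) := Or.inl rfl

omit [CharZero k] in
theorem isSign_neg_one : IsSign (-1 : k) := Or.inr rfl

omit [CharZero k] in
theorem IsSign.mul_self {s : k} (hs : IsSign s) : s * s = 1 := by
  rcases hs with rfl | rfl <;> simp

theorem ksgn_mul_left (s t : k) {u : k} (hu : IsSign u) :
    ksgn (s * t) u = ksgn s u * ksgn t u := by
  rcases hu with rfl | rfl <;> simp

theorem ksgn_mul_right {s : k} (t u : k) (hs : IsSign s) :
    ksgn s (t * u) = ksgn s t * ksgn s u := by
  rcases hs with rfl | rfl <;> simp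

omit [CharZero k] in
theorem ksgn_comm (s t : k) : ksgn s t = ksgn t s := by simp only [ksgn]; ring

-- The four terms of `koszul` match the four terms of `ksgn`. On eigenvectors of the two involutions
-- the sign thus becomes a scalar. Since `E` need not be bilinear, the mixed term has its own
-- hypothesis.
omit [CharZero k] in
theorem koszul_of_eigen {M X Y : Type*} [AddCommGroup M] [Module k M] {s : X → X} {t : Y → Y}
    {E : X → Y → M} {x : X} {y : Y} {c e : k} (h1 : E (s x) y = c • E x y)
    (h2 : E x (t y) = e • E x y) (h3 : E (s x) (t y) = (c * e) • E x y) :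
    koszul k s t E x y = ksgn c e • E x y := by
  rw [koszul, h1, h2, h3, ksgn]; module

end Signs

/-! ## Words of letters of definite parity -/

section Letters

variable {k : Type*} [Field k] {A : Type*} [Ring A] [Algebra k A]
  (𝒜 : ℤ → Submodule k A) [GradedAlgebra 𝒜]

/-- An element of `A` with a sign `s = (-1)^{|a| - 1}`. -/
structure Letter where
  /-- the element -/
  val : A
  /-- its shifted sign -/
  sgn : k
  isSign : IsSign sgn
  spar_val : spar 𝒜 val = sgn • val

variable {𝒜}

theorem Letter.par_val (a : Letter 𝒜) : par 𝒜 a.val = (-a.sgn) • a.val := by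
  have := a.spar_val
  rw [spar_apply] at this
  rw [neg_smul, ← this, neg_neg]

/-- The underlying word of a word of letters. -/
def wd (l : List (Letter 𝒜)) : List A := l.map Letter.val

@[simp] theorem wd_nil : wd ([] : List (Letter 𝒜)) = [] := rfl
@[simp] theorem wd_cons (a : Letter 𝒜) (l : List (Letter 𝒜)) : wd (a :: l) = a.val :: wd l := rfl
@[simp] theorem wd_append (l r : List (Letter 𝒜)) : wd (l ++ r) = wd l ++ wd r :=
  List.map_append

/-- The sign `(-1)^{‖l‖}` of a word of letters. -/
def wsgn (l : List (Letter 𝒜)) : k := (l.map Letter.sgn).prod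

@[simp] theorem wsgn_nil : wsgn ([] : List (Letter 𝒜)) = 1 := rfl
@[simp] theorem wsgn_cons (a : Letter 𝒜) (l : List (Letter 𝒜)) :
    wsgn (a :: l) = a.sgn * wsgn l := by simp [wsgn]
@[simp] theorem wsgn_append (l r : List (Letter 𝒜)) : wsgn (l ++ r) = wsgn l * wsgn r := by
  simp [wsgn]

theorem isSign_wsgn (l : List (Letter 𝒜)) : IsSign (wsgn l) := by
  induction l with
  | nil => exact isSign_one
  | cons a l ih => rw [wsgn_cons]; exact a.isSign.mul ih

section

variable {M : Type*} [AddCommGroup M] [Module k M]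

theorem Multilin.wpar_wd {F : List A → M} (hF : Multilin k F) (l : List (Letter 𝒜)) :
    F (wpar 𝒜 (wd l)) = wsgn l • F (wd l) := by
  induction l generalizing F with
  | nil => simp [wpar]
  | cons a l ih =>
    have : F (wpar 𝒜 (wd (a :: l))) = F (spar 𝒜 a.val :: wpar 𝒜 (wd l)) := rfl
    rw [this, ih (hF.cons _), a.spar_val, (hF.head _).map_smul, wsgn_cons, wd_cons, smul_smul,
      mul_comm]

theorem Multilin.wpar {F : List A → M} (hF : Multilin k F) :
    Multilin k fun l => F (wpar 𝒜 l) := hF.comp_map (spar 𝒜)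

/-- Signs only see parity, so letters need not be homogeneous in the `ℤ`-grading: `a + spar a` and
`a - spar a` are letters of sign `1` and `-1`, and `a` is half their sum. -/
theorem span_letters [CharZero k] :
    Submodule.span k (Set.range (Letter.val : Letter 𝒜 → A)) = ⊤ := by
  rw [eq_top_iff]
  rintro a -
  have h1 : a + spar 𝒜 a ∈ Set.range (Letter.val : Letter 𝒜 → A) :=
    ⟨⟨a + spar 𝒜 a, 1, isSign_one, by rw [map_add, spar_spar]; module⟩, rfl⟩
  have h2 : a - spar 𝒜 a ∈ Set.range (Letter.val : Letter 𝒜 → A) :=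
    ⟨⟨a - spar 𝒜 a, -1, isSign_neg_one, by rw [map_sub, spar_spar]; module⟩, rfl⟩
  have e : a = (2⁻¹ : k) • (a + spar 𝒜 a) + (2⁻¹ : k) • (a - spar 𝒜 a) := by
    match_scalars <;> field_simp <;> norm_num
  rw [e]
  exact add_mem (Submodule.smul_mem _ _ (Submodule.subset_span h1))
    (Submodule.smul_mem _ _ (Submodule.subset_span h2))

/-- The tool behind the long sign identities: it suffices to compare two multilinear functions where
all signs are scalars. -/
theorem Multilin.ext_letters [CharZero k] {F G : List A → M} (hF : Multilin k F)
    (hG : Multilin k G) (h : ∀ l : List (Letter 𝒜), F (wd l) = G (wd l)) : F = G := by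
  refine hF.ext_span (span_letters (𝒜 := 𝒜)) hG fun l hl => ?_
  obtain ⟨l, rfl⟩ : ∃ l' : List (Letter 𝒜), wd l' = l := by
    induction l with
    | nil => exact ⟨[], rfl⟩
    | cons a l ih =>
      obtain ⟨l', hl'⟩ := ih fun b hb => hl b (List.mem_cons_of_mem _ hb)
      obtain ⟨b, hb⟩ := hl a List.mem_cons_self
      exact ⟨b :: l', by rw [wd_cons, hb, hl']⟩
  exact h l

end

variable {d : A →ₗ[k] A} (hd : IsDGA 𝒜 d)

/-- The letter `da`. -/
@[simps] def Letter.diff (a : Letter 𝒜) : Letter 𝒜 where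
  val := d a.val
  sgn := -a.sgn
  isSign := a.isSign.neg
  spar_val := by
    have := hd.d_spar a.val
    rw [a.spar_val, map_smul] at this
    rw [neg_smul, this, neg_neg]

/-- The letter `ab`. -/
@[simps] def Letter.mul (a b : Letter 𝒜) : Letter 𝒜 where
  val := a.val * b.val
  sgn := -(a.sgn * b.sgn)
  isSign := (a.isSign.mul b.isSign).neg
  spar_val := by
    rw [spar_apply, par_mul, a.par_val, b.par_val, smul_mul_smul_comm]; module

variable {M : Type*} [AddCommGroup M] [Module k M]

/-- The terms of `F ∘ b'` that involve the first letter. -/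
def headD (F : List (Letter 𝒜) → M) : List (Letter 𝒜) → M
  | [] => 0
  | [a] => -F [a.diff hd]
  | a :: b :: l => -F (a.diff hd :: b :: l) - a.sgn • F (a.mul b :: l)

/-- `F ∘ b'` on words of letters. -/
def bD : (List (Letter 𝒜) → M) → List (Letter 𝒜) → M
  | _, [] => 0
  | F, a :: l => headD hd F (a :: l) + a.sgn • bD (fun r => F (a :: r)) l

theorem headD_add (F G : List (Letter 𝒜) → M) (l) :
    headD hd (fun r => F r + G r) l = headD hd F l + headD hd G l := by
  match l with
  | [] => simp [headD]
  | [a] => simp only [headD]; module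
  | a :: b :: l => simp only [headD]; module

theorem headD_smul (c : k) (F : List (Letter 𝒜) → M) (l) :
    headD hd (fun r => c • F r) l = c • headD hd F l := by
  match l with
  | [] => simp [headD]
  | [a] => simp only [headD]; module
  | a :: b :: l => simp only [headD]; module

theorem bD_add (F G : List (Letter 𝒜) → M) (l) :
    bD hd (fun r => F r + G r) l = bD hd F l + bD hd G l := by
  induction l generalizing F G with
  | nil => simp [bD]
  | cons a l ih => simp only [bD, ih, headD_add]; module

theorem bD_smul (c : k) (F : List (Letter 𝒜) → M) (l) :
    bD hd (fun r => c • F r) l = c • bD hd F l := by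
  induction l generalizing F with
  | nil => simp [bD]
  | cons a l ih => simp only [bD, ih, headD_smul]; module

theorem bD_apply {ι : Type*} (F : List (Letter 𝒜) → ι → M) (l) (i : ι) :
    bD hd F l i = bD hd (fun r => F r i) l := by
  induction l generalizing F with
  | nil => simp [bD]
  | cons a l ih =>
    rw [bD, Pi.add_apply, Pi.smul_apply, ih, bD]
    congr 1
    cases l <;> rfl

/-- `barD` twists each letter that it passes by `spar`; on letters this twist is the scalar `a.sgn`,
which multilinearity pulls out. -/
theorem barD_wd {F : List A → M} (hF : Multilin k F) (l : List (Letter 𝒜)) :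
    barD 𝒜 d F (wd l) = bD hd (fun r => F (wd r)) l := by
  induction l generalizing F with
  | nil => simp [barD, bD]
  | cons a l ih =>
    cases l with
    | nil => simp [barD, bD, headD]
    | cons b l =>
      have e : (fun r => F (spar 𝒜 a.val :: r)) = a.sgn • fun r => F (a.val :: r) := by
        funext r
        rw [a.spar_val, (hF.head r).map_smul]; rfl
      have h := ih (hF.cons a.val)
      simp only [wd_cons, barD] at h ⊢
      rw [e, barD_smul, h]
      conv_rhs => rw [bD, headD]
      rw [a.par_val, smul_mul_assoc, (hF.head _).map_smul]
      simp only [wd_cons, Letter.diff_val, Letter.mul_val]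
      module

theorem Multilin.barD {F : List A → M} (hF : Multilin k F) : Multilin k (barD 𝒜 d F) := by
  -- In the recursive term of `barD` the first letter enters through the function rather than
  -- through the word, so linearity in the function is needed as well.
  have hlin (G : A → List A → M) (hG : ∀ l, IsLinearMap k fun a => G a l) (l : List A) :
      IsLinearMap k fun a => MCRep.barD 𝒜 d (G a) l := by
    refine ⟨fun x y => ?_, fun c x => ?_⟩
    · rw [← barD_add]; congr 1; funext l; exact (hG l).map_add x y
    · rw [← barD_smul]; congr 1; funext l; exact (hG l).map_smul c x
  intro l
  induction l generalizing F with
  | nil =>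
    intro r
    cases r with
    | nil => exact isLinearMap_neg (isLinearMap_comp (hF.head []) d.isLinear :)
    | cons b r =>
      refine isLinearMap_add (isLinearMap_add (isLinearMap_neg
        (isLinearMap_comp (hF.head (b :: r)) d.isLinear :)) ?_) ?_
      · exact (isLinearMap_comp (hF.head r) (LinearMap.mulRight k b ∘ₗ par 𝒜).isLinear :)
      · exact hlin _ (fun l => (isLinearMap_comp (hF.head l) (spar 𝒜).isLinear :)) _
  | cons c l ih =>
    intro r
    have h := ih (hF.cons (spar 𝒜 c)) r
    cases l with
    | nil =>
      refine isLinearMap_add (isLinearMap_add (isLinearMap_neg (hF [d c] r)) ?_) h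
      exact (isLinearMap_comp (hF.head r) (LinearMap.mulLeft k (par 𝒜 c)).isLinear :)
    | cons b l =>
      refine isLinearMap_add (isLinearMap_add (isLinearMap_neg ?_) ?_) h
      · exact hF (d c :: b :: l) r
      · exact hF ((par 𝒜 c * b) :: l) r

/-- The left action terms of the Hochschild differential of a cochain of sign `ε`. -/
def actL (lft : A → M →ₗ[k] M) (ε : k) (F : List (Letter 𝒜) → M) : List (Letter 𝒜) → M
  | [] => 0
  | a :: l => ksgn a.sgn ε • lft a.val (F l)

/-- The right action terms of the Hochschild differential. -/
def actR (rgt : A → M →ₗ[k] M) : (List (Letter 𝒜) → M) → List (Letter 𝒜) → M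
  | _, [] => 0
  | F, [a] => rgt a.val (F [])
  | F, a :: b :: l => a.sgn • actR rgt (fun r => F (a :: r)) (b :: l)

/-- `actR` recurses from the left, to match `bD` and `cupL`, although only the last letter acts;
every letter before it contributes its sign. -/
theorem actR_concat (rgt : A → M →ₗ[k] M) (F : List (Letter 𝒜) → M) (l : List (Letter 𝒜))
    (c : Letter 𝒜) : actR rgt F (l ++ [c]) = wsgn l • rgt c.val (F l) := by
  induction l generalizing F with
  | nil => simp [actR]
  | cons a l ih =>
    have := ih (fun r => F (a :: r))
    rw [wsgn_cons, mul_smul, ← this]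
    cases l <;> rfl

variable {σM dM : M →ₗ[k] M} {lft rgt : A → M →ₗ[k] M}

theorem Multilin.hat {f : List A → M} (hf : Multilin k f) : Multilin k (hat 𝒜 σM f) :=
  (linear_comp σM.isLinear (hf.wpar (𝒜 := 𝒜)) :)

theorem actionTerms_wd {f : List A → M} (hf : Multilin k f) {ε : k}
    (hε : MCRep.hat 𝒜 σM f = ε • f) (hl : ∀ l, IsLinearMap k fun a => lft a (f l))
    (l : List (Letter 𝒜)) :
    actionTerms 𝒜 σM lft rgt f (wd l) =
      actL lft ε (fun r => f (wd r)) l - ε • actR rgt (fun r => f (wd r)) l := by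
  cases l with
  | nil => simp [actionTerms, actL, actR]
  | cons a l =>
    have h : koszul k (spar 𝒜) (MCRep.hat 𝒜 σM) (fun b g => lft b (g (wd l))) a.val f =
        ksgn a.sgn ε • lft a.val (f (wd l)) := by
      refine koszul_of_eigen ?_ ?_ ?_
      · simp only [a.spar_val, (hl _).map_smul]
      · simp only [hε, Pi.smul_apply, map_smul]
      · simp only [hε, a.spar_val, (hl _).map_smul, Pi.smul_apply, map_smul, smul_smul,
          mul_comm]
    simp only [wd_cons, actionTerms, h, actL]
    congr 1
    rcases List.eq_nil_or_concat' (a :: l) with h0 | ⟨m, c, hm⟩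
    · simp at h0
    · have e : a.val :: wd l = wd m ++ [c.val] := by
        rw [← wd_cons, hm]; simp
      simp only [hm, e, actR_concat, hε]
      simp [hf.wpar_wd]

theorem hochD_wd {f : List A → M} (hf : Multilin k f) {ε : k}
    (hε : MCRep.hat 𝒜 σM f = ε • f) (hl : ∀ l, IsLinearMap k fun a => lft a (f l))
    (l : List (Letter 𝒜)) :
    hochD 𝒜 d σM dM lft rgt f (wd l) = dM (f (wd l)) - ε • bD hd (fun r => f (wd r)) l +
      (actL lft ε (fun r => f (wd r)) l - ε • actR rgt (fun r => f (wd r)) l) := by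
  change dM (f (wd l)) - MCRep.barD 𝒜 d (MCRep.hat 𝒜 σM f) (wd l) + actionTerms 𝒜 σM lft rgt f (wd l) = _
  rw [actionTerms_wd hf hε hl, hε, barD_smul, barD_wd hd hf]

theorem Multilin.actionTerms {f : List A → M} (hf : Multilin k f)
    (hl : ∀ l, IsLinearMap k fun a => lft a (f l))
    (hl' : ∀ l, IsLinearMap k fun a => lft a (MCRep.hat 𝒜 σM f l))
    (hr : ∀ l, IsLinearMap k fun a => rgt a (MCRep.hat 𝒜 σM f l)) :
    Multilin k (actionTerms 𝒜 σM lft rgt f) := by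
  -- The two actions use opposite ends of the word, so they are treated apart: `hL` by cases on what
  -- precedes the varying letter, `hR` by cases on what follows it.
  have hL : ∀ l r, IsLinearMap k fun a => (fun w : List A => match w with
      | [] => (0 : M)
      | a :: l => koszul k (spar 𝒜) (MCRep.hat 𝒜 σM) (fun b g => lft b (g l)) a f)
        (l ++ a :: r) := by
    intro l r
    cases l with
    | nil =>
      refine isLinearMap_smul _ (isLinearMap_sub (isLinearMap_add (isLinearMap_add ?_ ?_) ?_) ?_)
      · exact hl _
      · exact (isLinearMap_comp (hl r) (spar 𝒜).isLinear :)
      · exact hl' _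
      · exact (isLinearMap_comp (hl' r) (spar 𝒜).isLinear :)
    | cons c l =>
      refine isLinearMap_smul _ (isLinearMap_sub (isLinearMap_add (isLinearMap_add ?_ ?_) ?_) ?_)
      · exact isLinearMap_comp (lft c).isLinear (hf _ _)
      · exact isLinearMap_comp (lft _).isLinear (hf _ _)
      · exact isLinearMap_comp (lft c).isLinear (hf.hat _ _)
      · exact isLinearMap_comp (lft _).isLinear (hf.hat _ _)
  have hR : Multilin k fun w : List A => if h : w ≠ [] then
      rgt (w.getLast h) (MCRep.hat 𝒜 σM f (MCRep.wpar 𝒜 w.dropLast)) else 0 := by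
    intro l r
    rcases List.eq_nil_or_concat' r with rfl | ⟨m, c, rfl⟩
    · simpa using hr _
    · have e (a : A) : l ++ a :: (m ++ [c]) = (l ++ a :: m) ++ [c] := by simp
      have e' (a : A) (h : l ++ a :: (m ++ [c]) ≠ []) : (l ++ a :: (m ++ [c])).getLast h = c := by
        simp
      have e'' (a : A) : (l ++ a :: (m ++ [c])).dropLast = l ++ a :: m := by
        rw [e, List.dropLast_concat]
      have hne (a : A) : l ++ a :: (m ++ [c]) ≠ [] := by simp
      simp only [e', e'']
      simp only [dif_pos (hne _)]
      exact isLinearMap_comp (rgt c).isLinear ((hf.hat (𝒜 := 𝒜) (σM := σM)).wpar (𝒜 := 𝒜) l m)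
  intro l r
  convert isLinearMap_sub (hL l r) (hR l r) using 2 with a
  cases l <;> simp [MCRep.actionTerms]

theorem Multilin.hochD {f : List A → M} (hf : Multilin k f)
    (hl : ∀ l, IsLinearMap k fun a => lft a (f l))
    (hl' : ∀ l, IsLinearMap k fun a => lft a (MCRep.hat 𝒜 σM f l))
    (hr : ∀ l, IsLinearMap k fun a => rgt a (MCRep.hat 𝒜 σM f l)) :
    Multilin k (hochD 𝒜 d σM dM lft rgt f) :=
  ((linear_comp dM.isLinear hf).sub hf.hat.barD).add (hf.actionTerms hl hl' hr)

end Letters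

/-! ## The Leibniz rule for the cup product -/

section Letters

variable {k : Type*} [Field k] {A : Type*} [Ring A] [Algebra k A]
  {𝒜 : ℤ → Submodule k A} [GradedAlgebra 𝒜] {d : A →ₗ[k] A} (hd : IsDGA 𝒜 d)

section

variable {M M' : Type*} [AddCommGroup M] [Module k M] [AddCommGroup M'] [Module k M']

theorem headD_comp (T : M →ₗ[k] M') (F : List (Letter 𝒜) → M) (l) :
    headD hd (fun r => T (F r)) l = T (headD hd F l) := by
  match l with
  | [] => simp [headD]
  | [a] => simp [headD]
  | a :: b :: l => simp [headD]

theorem bD_comp (T : M →ₗ[k] M') (F : List (Letter 𝒜) → M) (l) :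
    bD hd (fun r => T (F r)) l = T (bD hd F l) := by
  induction l generalizing F with
  | nil => simp [bD]
  | cons a l ih => simp only [bD, ih, headD_comp, map_add, map_smul]

/-- Both `da` and `ab` have shifted parity opposite to that of the letters they replace, so every
term of the bar differential flips the sign of the word. -/
theorem bD_wsgn (F : List (Letter 𝒜) → M) (l) :
    bD hd (fun r => wsgn r • F r) l = -wsgn l • bD hd F l := by
  induction l generalizing F with
  | nil => simp [bD]
  | cons a l ih =>
    have h := ih (fun r => F (a :: r))
    have e : bD hd (fun r => wsgn (a :: r) • F (a :: r)) l =
        a.sgn • bD hd (fun r => wsgn r • F (a :: r)) l := by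
      rw [← bD_smul]; simp only [wsgn_cons, mul_smul]
    rw [bD, bD, e, h]
    cases l with
    | nil => simp only [headD, bD, wsgn_cons, wsgn_nil, Letter.diff_sgn]; module
    | cons b l =>
      simp only [headD, wsgn_cons, Letter.diff_sgn, Letter.mul_sgn]; module

variable (rgt : A → M →ₗ[k] M)

theorem actR_comp {rgt' : A → M' →ₗ[k] M'} (T : M →ₗ[k] M')
    (hT : ∀ a m, T (rgt a m) = rgt' a (T m)) (F : List (Letter 𝒜) → M) (l) :
    actR rgt' (fun r => T (F r)) l = T (actR rgt F l) := by
  induction l generalizing F with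
  | nil => simp [actR]
  | cons a l ih =>
    cases l with
    | nil => simp [actR, hT]
    | cons b l => rw [actR, ih, actR, map_smul]

theorem actR_add (F G : List (Letter 𝒜) → M) (l) :
    actR rgt (fun r => F r + G r) l = actR rgt F l + actR rgt G l := by
  rcases List.eq_nil_or_concat' l with rfl | ⟨m, c, rfl⟩
  · simp [actR]
  · simp only [actR_concat, map_add, smul_add]

theorem actR_smul (c : k) (F : List (Letter 𝒜) → M) (l) :
    actR rgt (fun r => c • F r) l = c • actR rgt F l :=
  actR_comp rgt (c • LinearMap.id) (fun a m => by simp) F l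

end

/-- The cup product of functions on words of letters, where the second one has sign `η`. -/
def cupL (η : k) : (List (Letter 𝒜) → A) → (List (Letter 𝒜) → A) → List (Letter 𝒜) → A
  | f, g, [] => f [] * g []
  | f, g, a :: l => f [] * g (a :: l) + ksgn a.sgn η • cupL η (fun r => f (a :: r)) g l

section

variable (η : k) (f f' g g' : List (Letter 𝒜) → A) (l : List (Letter 𝒜))

theorem cupL_add_left : cupL η (fun r => f r + f' r) g l = cupL η f g l + cupL η f' g l := by
  induction l generalizing f f' with
  | nil => simp only [cupL, add_mul]
  | cons a l ih => simp only [cupL, ih, add_mul]; module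

theorem cupL_smul_left (c : k) : cupL η (fun r => c • f r) g l = c • cupL η f g l := by
  induction l generalizing f with
  | nil => simp only [cupL, smul_mul_assoc]
  | cons a l ih => simp only [cupL, ih, smul_mul_assoc]; module

theorem cupL_add_right : cupL η f (fun r => g r + g' r) l = cupL η f g l + cupL η f g' l := by
  induction l generalizing f with
  | nil => simp only [cupL, mul_add]
  | cons a l ih => simp only [cupL, ih, mul_add]; module

theorem cupL_smul_right (c : k) : cupL η f (fun r => c • g r) l = c • cupL η f g l := by
  induction l generalizing f with
  | nil => simp only [cupL, mul_smul_comm]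
  | cons a l ih => simp only [cupL, ih, mul_smul_comm]; module

theorem cupL_sub_left : cupL η (fun r => f r - f' r) g l = cupL η f g l - cupL η f' g l := by
  induction l generalizing f f' with
  | nil => simp only [cupL, sub_mul]
  | cons a l ih => simp only [cupL, ih, sub_mul]; module

theorem cupL_sub_right : cupL η f (fun r => g r - g' r) l = cupL η f g l - cupL η f g' l := by
  induction l generalizing f with
  | nil => simp only [cupL, mul_sub]
  | cons a l ih => simp only [cupL, ih, mul_sub]; module

theorem cupL_mul_left (c : A) : cupL η (fun r => c * f r) g l = c * cupL η f g l := by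
  induction l generalizing f with
  | nil => simp only [cupL, mul_assoc]
  | cons a l ih => simp only [cupL, ih, mul_assoc, mul_add, mul_smul_comm]

variable [CharZero k]

/-- Changing the parity of the second factor multiplies the term of each cut by the sign of the
prefix. -/
theorem cupL_neg_sign : cupL (-η) f g l = cupL η (fun r => wsgn r • f r) g l := by
  induction l generalizing f with
  | nil => simp [cupL]
  | cons a l ih =>
    have e : ksgn a.sgn (-η) = ksgn a.sgn η * a.sgn := by
      rcases a.isSign with h | h <;> rw [h] <;> simp
    simp only [cupL, ih, wsgn_nil, one_smul, e, wsgn_cons, mul_smul, cupL_smul_left]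

include hd in
theorem cupL_d : d (cupL η f g l) = cupL η (fun r => d (f r)) g l +
    cupL η (fun r => par 𝒜 (f r)) (fun r => d (g r)) l := by
  induction l generalizing f with
  | nil => simp [cupL, hd.d_mul]
  | cons a l ih => simp only [cupL, map_add, map_smul, ih, hd.d_mul]; module

variable {η}

/-- If the cut precedes the first letter, the head terms fall on `g`; otherwise they fall on `f`. In
the latter case the replaced letter has the opposite parity when `g` moves past it, which accounts
for the factor `η`. -/
theorem headD_cupL (hη : IsSign η) (a : Letter 𝒜) :
    headD hd (cupL η f g) (a :: l) = f [] * headD hd g (a :: l) +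
      (η * ksgn a.sgn η) • cupL η (fun r => headD hd f (a :: r)) g l := by
  have e1 : ksgn (-a.sgn) η = η * ksgn a.sgn η := by
    rw [neg_eq_neg_one_mul, ksgn_mul_left _ _ hη]; simp
  cases l with
  | nil =>
    simp only [headD, cupL, Letter.diff_sgn, e1, mul_neg, neg_mul]; module
  | cons b l =>
    have e2 : ksgn (-(a.sgn * b.sgn)) η = η * ksgn a.sgn η * ksgn b.sgn η := by
      rw [neg_eq_neg_one_mul, ksgn_mul_left _ _ hη, ksgn_mul_left _ _ hη]; simp [mul_assoc]
    have e3 : cupL η (fun r => headD hd f (a :: b :: r)) g l =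
        (-1 : k) • cupL η (fun r => f (a.diff hd :: b :: r)) g l +
          (-a.sgn) • cupL η (fun r => f (a.mul b :: r)) g l := by
      rw [← cupL_smul_left, ← cupL_smul_left, ← cupL_add_left]
      congr 1; funext r; simp only [headD]; module
    rw [cupL.eq_2 η (fun r => headD hd f (a :: r)), e3]
    simp only [headD, cupL, Letter.diff_sgn, Letter.mul_sgn, e1, e2, mul_neg, neg_mul, mul_sub,
      mul_smul_comm]
    module

/-- Dual form of the fact that the bar differential is a coderivation for deconcatenation: each of
its terms takes place on one side of the cut. -/
theorem bD_cupL (hη : IsSign η) : bD hd (cupL η f g) l =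
    η • cupL η (bD hd f) g l + cupL η (fun r => wsgn r • f r) (bD hd g) l := by
  induction l generalizing f with
  | nil => simp [cupL, bD]
  | cons a l ih =>
    have e1 : bD hd (fun r => cupL η f g (a :: r)) l = f [] * bD hd (fun r => g (a :: r)) l +
        ksgn a.sgn η • bD hd (cupL η (fun r => f (a :: r)) g) l := by
      rw [← bD_smul, ← LinearMap.mulLeft_apply (R := k), ← bD_comp, ← bD_add]; rfl
    have e2 : cupL η (fun r => bD hd f (a :: r)) g l =
        cupL η (fun r => headD hd f (a :: r)) g l +
          a.sgn • cupL η (bD hd fun r => f (a :: r)) g l := by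
      rw [← cupL_smul_left, ← cupL_add_left]; rfl
    have e3 : cupL η (fun r => wsgn (a :: r) • f (a :: r)) (bD hd g) l =
        a.sgn • cupL η (fun r => wsgn r • f (a :: r)) (bD hd g) l := by
      rw [← cupL_smul_left]; simp only [wsgn_cons, mul_smul]
    rw [bD.eq_2 hd (cupL η f g), headD_cupL hd f g l hη, e1, ih, cupL.eq_2 η (bD hd f), e2,
      cupL.eq_2 η (fun r => wsgn r • f r), e3, bD.eq_1, bD.eq_2 hd g]
    simp only [wsgn_nil, one_smul, zero_mul, mul_add, mul_smul_comm]
    module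

theorem actL_cupL {ε : k} : actL (LinearMap.mulLeft k) (ε * η) (cupL η f g) l =
    cupL η (actL (LinearMap.mulLeft k) ε f) g l := by
  cases l with
  | nil => simp [cupL, actL]
  | cons a l =>
    have e : ksgn a.sgn (ε * η) = ksgn a.sgn ε * ksgn a.sgn η := ksgn_mul_right _ _ a.isSign
    simp only [cupL, actL, zero_mul, zero_add, LinearMap.mulLeft_apply, cupL_smul_left,
      cupL_mul_left, e]
    module

theorem actR_cupL : actR (LinearMap.mulRight k) (cupL η f g) l =
    cupL η (fun r => wsgn r • f r) (actR (LinearMap.mulRight k) g) l := by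
  induction l generalizing f with
  | nil => simp [cupL, actR]
  | cons a l ih =>
    cases l with
    | nil => simp [cupL, actR, mul_assoc]
    | cons b l =>
      have e1 : actR (LinearMap.mulRight k) (fun r => cupL η f g (a :: r)) (b :: l) =
          f [] * actR (LinearMap.mulRight k) (fun r => g (a :: r)) (b :: l) +
            ksgn a.sgn η •
              actR (LinearMap.mulRight k) (cupL η (fun r => f (a :: r)) g) (b :: l) := by
        have e0 : actR (LinearMap.mulRight k) (fun r => f [] * g (a :: r)) (b :: l) =
            f [] * actR (LinearMap.mulRight k) (fun r => g (a :: r)) (b :: l) :=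
          actR_comp (LinearMap.mulRight k : A → A →ₗ[k] A) (LinearMap.mulLeft k (f []))
            (fun a m => by simp [mul_assoc]) _ _
        rw [← actR_smul, ← e0, ← actR_add]; rfl
      have e3 : cupL η (fun r => wsgn (a :: r) • f (a :: r)) (actR (LinearMap.mulRight k) g)
          (b :: l) =
          a.sgn • cupL η (fun r => wsgn r • f (a :: r)) (actR (LinearMap.mulRight k) g)
            (b :: l) := by
        rw [← cupL_smul_left]; simp only [wsgn_cons, mul_smul]
      rw [actR, e1, ih, cupL.eq_2 η (fun r => wsgn r • f r), e3]
      simp only [actR, wsgn_nil, one_smul, mul_smul_comm]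
      module

/-- The product `f(u) · a · g(v)` is at once a right action term of `f` and a left action term of
`g`. These are the inner terms that cancel in the Leibniz rule. -/
theorem cupL_actR : cupL η (actR (LinearMap.mulRight k) f) g l =
    cupL η (fun r => wsgn r • f r) (actL (LinearMap.mulLeft k) η g) l := by
  induction l generalizing f with
  | nil => simp [cupL, actR, actL]
  | cons a l ih =>
    have e1 : cupL η (fun r => actR (LinearMap.mulRight k) f (a :: r)) g l =
        a.sgn • cupL η (actR (LinearMap.mulRight k) fun r => f (a :: r)) g l +
          f [] * (a.val * g l) := by
      rw [← cupL_smul_left]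
      cases l with
      | nil => simp [cupL, actR, mul_assoc]
      | cons b l => simp only [cupL, actR, LinearMap.mulRight_apply, smul_zero, zero_mul,
          mul_assoc]; abel
    have e3 : cupL η (fun r => wsgn (a :: r) • f (a :: r)) (actL (LinearMap.mulLeft k) η g) l =
        a.sgn • cupL η (fun r => wsgn r • f (a :: r)) (actL (LinearMap.mulLeft k) η g) l := by
      rw [← cupL_smul_left]; simp only [wsgn_cons, mul_smul]
    rw [cupL, e1, ih, cupL.eq_2 η (fun r => wsgn r • f r), e3]
    simp only [actL, actR, wsgn_nil, one_smul, mul_smul_comm, LinearMap.mulLeft_apply, zero_mul]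
    module

end

end Letters

/-! ### Parity of the Hochschild differential, and the Leibniz rule for multilinear cochains. -/

section Cup

variable {k : Type*} [Field k] {A : Type*} [Ring A] [Algebra k A]
  {𝒜 : ℤ → Submodule k A} [GradedAlgebra 𝒜] {d : A →ₗ[k] A}

section

variable {M : Type*} [AddCommGroup M] [Module k M] {σM : M →ₗ[k] M}

theorem hat_add (f g : List A → M) : hat 𝒜 σM (f + g) = hat 𝒜 σM f + hat 𝒜 σM g := by
  funext r; simp [hat]

theorem hat_sub (f g : List A → M) : hat 𝒜 σM (f - g) = hat 𝒜 σM f - hat 𝒜 σM g := by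
  funext r; simp [hat]

theorem hat_smul (c : k) (f : List A → M) : hat 𝒜 σM (c • f) = c • hat 𝒜 σM f := by
  funext r; simp [hat]

@[simp] theorem wpar_wpar (l : List A) : wpar 𝒜 (wpar 𝒜 l) = l := by
  simp [wpar, Function.comp_def]

theorem hat_hat (hσ : ∀ m, σM (σM m) = m) (f : List A → M) : hat 𝒜 σM (hat 𝒜 σM f) = f := by
  funext r; simp [hat, hσ]

/-- Splits a function of words into eigenvectors of the sign involution, so that identities proved
for cochains of definite sign extend by linearity. -/
theorem exists_add_of_hat [CharZero k] (hσ : ∀ m, σM (σM m) = m) (f : List A → M) :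
    f = (2⁻¹ : k) • (f + hat 𝒜 σM f) + (2⁻¹ : k) • (f - hat 𝒜 σM f) ∧
      hat 𝒜 σM ((2⁻¹ : k) • (f + hat 𝒜 σM f)) = (1 : k) • ((2⁻¹ : k) • (f + hat 𝒜 σM f)) ∧
      hat 𝒜 σM ((2⁻¹ : k) • (f - hat 𝒜 σM f)) = (-1 : k) • ((2⁻¹ : k) • (f - hat 𝒜 σM f)) := by
  refine ⟨?_, ?_, ?_⟩
  · match_scalars <;> field_simp <;> norm_num
  · rw [hat_smul, hat_add, hat_hat hσ]; module
  · rw [hat_smul, hat_sub, hat_hat hσ]; module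

end

theorem barD_comp {M M' : Type*} [AddCommGroup M] [Module k M] [AddCommGroup M'] [Module k M']
    (T : M →ₗ[k] M') (F : List A → M) (l : List A) :
    barD 𝒜 d (fun r => T (F r)) l = T (barD 𝒜 d F l) := by
  induction l generalizing F with
  | nil => simp [barD]
  | cons a l ih =>
    cases l with
    | nil => simp [barD]
    | cons b l =>
      have := ih fun r => F (spar 𝒜 a :: r)
      rw [barD, this, barD]; simp

section

variable {M : Type*} [AddCommGroup M] [Module k M] {σM dM : M →ₗ[k] M}
  {lft rgt : A → M →ₗ[k] M}

theorem barD_wpar (hd : IsDGA 𝒜 d) {F : List A → M} (hF : Multilin k F) (l : List A) :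
    barD 𝒜 d F (wpar 𝒜 l) = -barD 𝒜 d (fun r => F (wpar 𝒜 r)) l := by
  induction l generalizing F with
  | nil => simp [barD, wpar]
  | cons a l ih =>
    cases l with
    | nil =>
      have := (hF.head []).map_neg (spar 𝒜 (d a))
      simp only [wpar, List.map_cons, List.map_nil, barD, hd.d_spar, this]
    | cons b l =>
      have h1 := ih (hF.cons (spar 𝒜 (spar 𝒜 a)))
      have h2 := (hF.head (spar 𝒜 b :: wpar 𝒜 l)).map_neg (spar 𝒜 (d a))
      have h3 := (hF.head (wpar 𝒜 l)).map_neg (spar 𝒜 (par 𝒜 a * b))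
      have e : par 𝒜 (spar 𝒜 a) * spar 𝒜 b = -spar 𝒜 (par 𝒜 a * b) := by
        simp [spar_apply, par_mul]
      simp only [wpar, List.map_cons, barD] at h1 h2 h3 ⊢
      rw [h1, hd.d_spar, h2, e, h3]
      abel

/-- The Hochschild differential is odd, because the bar differential (`barD_wpar`) and the
differential of `M` are odd. The action terms are odd too: both actions are even maps, and they use
up one letter of the shifted space. -/
theorem hat_hochD (hd : IsDGA 𝒜 d) (hσ : ∀ m, σM (σM m) = m) {f : List A → M}
    (hf : Multilin k f) (hσd : ∀ l, dM (σM (f l)) = -σM (dM (f l)))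
    (hL : ∀ a m, σM (lft a m) = lft (par 𝒜 a) (σM m))
    (hR : ∀ a m, σM (rgt a m) = rgt (par 𝒜 a) (σM m))
    (hl : ∀ l, IsLinearMap k fun a => lft a (f l))
    (hl' : ∀ l, IsLinearMap k fun a => lft a (hat 𝒜 σM f l))
    (hr : ∀ l, IsLinearMap k fun a => rgt a (f l)) :
    hat 𝒜 σM (hochD 𝒜 d σM dM lft rgt f) = -hochD 𝒜 d σM dM lft rgt (hat 𝒜 σM f) := by
  have hA : ∀ l, σM (actionTerms 𝒜 σM lft rgt f (wpar 𝒜 l)) =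
      -actionTerms 𝒜 σM lft rgt (hat 𝒜 σM f) l := by
    intro l
    cases l with
    | nil => simp [actionTerms, wpar]
    | cons a l =>
      have h1 (b : A) : lft (par 𝒜 b) (hat 𝒜 σM f l) = -lft (spar 𝒜 b) (hat 𝒜 σM f l) := by
        rw [← (hl' l).map_neg, spar_apply, neg_neg]
      have h2 (b : A) : lft (par 𝒜 b) (f l) = -lft (spar 𝒜 b) (f l) := by
        rw [← (hl l).map_neg, spar_apply, neg_neg]
      have h3 : σM (f (wpar 𝒜 l)) = hat 𝒜 σM f l := rfl
      have h4 : σM (hat 𝒜 σM f (wpar 𝒜 l)) = f l := by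
        simp only [hat, wpar_wpar, hσ]
      have e : wpar 𝒜 (a :: l) = spar 𝒜 a :: wpar 𝒜 l := rfl
      have h5 : σM (rgt ((spar 𝒜 a :: wpar 𝒜 l).getLast (List.cons_ne_nil _ _))
          (hat 𝒜 σM f (wpar 𝒜 (spar 𝒜 a :: wpar 𝒜 l).dropLast))) =
          -rgt ((a :: l).getLast (List.cons_ne_nil a l))
            (hat 𝒜 σM (hat 𝒜 σM f) (wpar 𝒜 (a :: l).dropLast)) := by
        have e1 : (spar 𝒜 a :: wpar 𝒜 l).getLast (List.cons_ne_nil _ _) =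
            spar 𝒜 ((a :: l).getLast (List.cons_ne_nil a l)) := 
            List.getLast_map (f := spar 𝒜) (l := a :: l) (by simp)
        have e2 : (spar 𝒜 a :: wpar 𝒜 l).dropLast = wpar 𝒜 (a :: l).dropLast := by
          rw [← e]; simp [wpar, List.map_dropLast]
        rw [e1, e2, hR, hat_hat hσ, wpar_wpar]
        have : par 𝒜 (spar 𝒜 ((a :: l).getLast (List.cons_ne_nil a l))) =
          -(a :: l).getLast (List.cons_ne_nil a l) := by simp [spar_apply]
        rw [this, hat, hσ, (hr _).map_neg]
      rw [e]
      simp only [actionTerms, koszul, map_sub, map_smul, map_add, hL, h3, h4, h1, h2, h5,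
        hat_hat hσ, spar_spar]
      module
  funext l
  change σM (dM (f (wpar 𝒜 l)) - barD 𝒜 d (hat 𝒜 σM f) (wpar 𝒜 l) +
    actionTerms 𝒜 σM lft rgt f (wpar 𝒜 l)) = -(dM (σM (f (wpar 𝒜 l))) -
      barD 𝒜 d (hat 𝒜 σM (hat 𝒜 σM f)) l + actionTerms 𝒜 σM lft rgt (hat 𝒜 σM f) l)
  have hB : σM (barD 𝒜 d (hat 𝒜 σM f) (wpar 𝒜 l)) =
      -barD 𝒜 d (hat 𝒜 σM (hat 𝒜 σM f)) l := by
    rw [barD_wpar hd hf.hat, map_neg, ← barD_comp]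
    rfl
  rw [map_add, map_sub, hA, hB, hσd]
  abel

end

theorem cup_add_left (f f' g : List A → A) : cup 𝒜 (f + f') g = cup 𝒜 f g + cup 𝒜 f' g := by
  funext l
  simp only [cup, Pi.add_apply, ← Finset.sum_add_distrib]
  refine Finset.sum_congr rfl fun i _ => ?_
  simp only [koszul, add_mul]; module

theorem cup_smul_left (c : k) (f g : List A → A) : cup 𝒜 (c • f) g = c • cup 𝒜 f g := by
  funext l
  simp only [cup, Pi.smul_apply, Finset.smul_sum]
  refine Finset.sum_congr rfl fun i _ => ?_
  simp only [koszul, smul_mul_assoc]; module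

theorem cup_add_right (f g g' : List A → A) : cup 𝒜 f (g + g') = cup 𝒜 f g + cup 𝒜 f g' := by
  funext l
  simp only [cup, Pi.add_apply, ← Finset.sum_add_distrib]
  refine Finset.sum_congr rfl fun i _ => ?_
  simp only [koszul, hat_add, Pi.add_apply, mul_add]; module

theorem cup_smul_right (c : k) (f g : List A → A) : cup 𝒜 f (c • g) = c • cup 𝒜 f g := by
  funext l
  simp only [cup, Pi.smul_apply, Finset.smul_sum]
  refine Finset.sum_congr rfl fun i _ => ?_
  simp only [koszul, hat_smul, Pi.smul_apply, mul_smul_comm]; module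

theorem cup_sub_left (f f' g : List A → A) : cup 𝒜 (f - f') g = cup 𝒜 f g - cup 𝒜 f' g := by
  have := cup_smul_left (𝒜 := 𝒜) (-1 : k) f' g
  rw [sub_eq_add_neg, cup_add_left, ← neg_one_smul k f', this, neg_one_smul, ← sub_eq_add_neg]

theorem cup_sub_right (f g g' : List A → A) : cup 𝒜 f (g - g') = cup 𝒜 f g - cup 𝒜 f g' := by
  have := cup_smul_right (𝒜 := 𝒜) (-1 : k) f g'
  rw [sub_eq_add_neg, cup_add_right, ← neg_one_smul k g', this, neg_one_smul, ← sub_eq_add_neg]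

theorem Multilin.cup {f g : List A → A} (hf : Multilin k f) (hg : Multilin k g) :
    Multilin k (cup 𝒜 f g) := by
  refine splitSum (E := fun u v => koszul k (MCRep.wpar 𝒜) (MCRep.hat 𝒜 (par 𝒜))
    (fun w h => f w * h v) u g) (fun v => ?_) (fun u => ?_) (fun n => n + 1)
  · refine smul _ (((add ?_ ?_).add ?_).sub ?_)
    · exact (linear_comp (LinearMap.mulRight k (g v)).isLinear hf :)
    · exact (linear_comp (LinearMap.mulRight k (g v)).isLinear (hf.wpar (𝒜 := 𝒜)) :)
    · exact (linear_comp (LinearMap.mulRight k _).isLinear hf :)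
    · exact (linear_comp (LinearMap.mulRight k _).isLinear (hf.wpar (𝒜 := 𝒜)) :)
  · refine smul _ (((add ?_ ?_).add ?_).sub ?_)
    · exact (linear_comp (LinearMap.mulLeft k (f u)).isLinear hg :)
    · exact (linear_comp (LinearMap.mulLeft k _).isLinear hg :)
    · exact (linear_comp (LinearMap.mulLeft k (f u)).isLinear (hg.hat (𝒜 := 𝒜)) :)
    · exact (linear_comp (LinearMap.mulLeft k _).isLinear (hg.hat (𝒜 := 𝒜)) :)

theorem hat_cup (f g : List A → A) :
    hat 𝒜 (par 𝒜) (cup 𝒜 f g) = cup 𝒜 (hat 𝒜 (par 𝒜) f) (hat 𝒜 (par 𝒜) g) := by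
  funext l
  have hlen : (wpar 𝒜 l).length = l.length := by simp [wpar]
  have ht (i : ℕ) : (wpar 𝒜 l).take i = wpar 𝒜 (l.take i) := by simp [wpar]
  have hdr (i : ℕ) : (wpar 𝒜 l).drop i = wpar 𝒜 (l.drop i) := by simp [wpar]
  simp only [hat, cup, hlen, map_sum, ht, hdr]
  refine Finset.sum_congr rfl fun i _ => ?_
  simp only [koszul, hat, map_smul, map_sub, map_add, par_mul, wpar_wpar, par_par]

theorem Multilin.selfD {f : List A → A} (hf : Multilin k f) : Multilin k (selfD 𝒜 d f) :=
  hf.hochD (fun _ => (LinearMap.mulRight k _).isLinear) (fun _ => (LinearMap.mulRight k _).isLinear)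
    (fun _ => (LinearMap.mulLeft k _).isLinear)

variable (hd : IsDGA 𝒜 d)

include hd in
theorem selfD_wd {f : List A → A} (hf : Multilin k f) {ε : k} (hε : hat 𝒜 (par 𝒜) f = ε • f)
    (l : List (Letter 𝒜)) : selfD 𝒜 d f (wd l) =
      d (f (wd l)) - ε • bD hd (fun r => f (wd r)) l +
      (actL (LinearMap.mulLeft k) ε (fun r => f (wd r)) l -
        ε • actR (LinearMap.mulRight k) (fun r => f (wd r)) l) :=
  hochD_wd hd hf hε (fun _ => (LinearMap.mulRight k _).isLinear) l

variable [CharZero k]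

theorem cup_wd {f g : List A → A} (hf : Multilin k f) {η : k} (hη : IsSign η)
    (hg : hat 𝒜 (par 𝒜) g = η • g) (l : List (Letter 𝒜)) :
    cup 𝒜 f g (wd l) = cupL η (fun r => f (wd r)) (fun r => g (wd r)) l := by
  have h1 : cup 𝒜 f g (wd l) = ∑ i ∈ Finset.range (l.length + 1),
      ksgn (wsgn (l.take i)) η • (f (wd (l.take i)) * g (wd (l.drop i))) := by
    have hlen : (wd l).length = l.length := by simp [wd]
    have ht (i : ℕ) : (wd l).take i = wd (l.take i) := by simp [wd]
    have hdr (i : ℕ) : (wd l).drop i = wd (l.drop i) := by simp [wd]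
    simp only [cup, hlen, ht, hdr]
    refine Finset.sum_congr rfl fun i _ => ?_
    refine koszul_of_eigen ?_ ?_ ?_
    · rw [hf.wpar_wd, smul_mul_assoc]
    · rw [hg, Pi.smul_apply, mul_smul_comm]
    · rw [hf.wpar_wd, hg, Pi.smul_apply, smul_mul_smul_comm]
  rw [h1]
  have key : ∀ (F G : List (Letter 𝒜) → A), ∑ i ∈ Finset.range (l.length + 1),
      ksgn (wsgn (l.take i)) η • (F (l.take i) * G (l.drop i)) = cupL η F G l := by
    clear h1
    intro F G
    induction l generalizing F with
    | nil => simp [cupL]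
    | cons a l ih =>
      rw [List.length_cons, Finset.sum_range_succ', cupL, ← ih, Finset.smul_sum, add_comm]
      congr 1
      · simp
      · refine Finset.sum_congr rfl fun i _ => ?_
        rw [List.take_succ_cons, List.drop_succ_cons, wsgn_cons, ksgn_mul_left _ _ hη, mul_smul]
  exact key (fun r => f (wd r)) (fun r => g (wd r))

include hd in
theorem hat_selfD {f : List A → A} (hf : Multilin k f) :
    hat 𝒜 (par 𝒜) (selfD 𝒜 d f) = -selfD 𝒜 d (hat 𝒜 (par 𝒜) f) :=
  hat_hochD hd (par_par 𝒜) hf (fun _ => hd.d_par _) (fun _ _ => par_mul 𝒜 _ _)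
    (fun _ _ => par_mul 𝒜 _ _) (fun _ => (LinearMap.mulRight k _).isLinear)
    (fun _ => (LinearMap.mulRight k _).isLinear) (fun _ => (LinearMap.mulLeft k _).isLinear)

include hd in
theorem hat_selfD_of_sign {f : List A → A} (hf : Multilin k f) {ε : k}
    (hε : hat 𝒜 (par 𝒜) f = ε • f) : hat 𝒜 (par 𝒜) (selfD 𝒜 d f) = (-ε) • selfD 𝒜 d f := by
  rw [hat_selfD hd hf, hε, map_smul, neg_smul]

include hd in
theorem selfD_cup_of_sign {f g : List A → A} (hf : Multilin k f) (hg : Multilin k g) {ε η : k}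
    (hη : IsSign η) (hfε : hat 𝒜 (par 𝒜) f = ε • f)
    (hgη : hat 𝒜 (par 𝒜) g = η • g) :
    selfD 𝒜 d (cup 𝒜 f g) = cup 𝒜 (selfD 𝒜 d f) g + cup 𝒜 (hat 𝒜 (par 𝒜) f) (selfD 𝒜 d g) := by
  have hfg : hat 𝒜 (par 𝒜) (cup 𝒜 f g) = (ε * η) • cup 𝒜 f g := by
    rw [hat_cup, hfε, hgη, cup_smul_left, cup_smul_right, smul_smul]
  refine (hf.cup hg).selfD.ext_letters (𝒜 := 𝒜)
    ((hf.selfD.cup hg).add (hf.hat.cup hg.selfD)) fun l => ?_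
  rw [Pi.add_apply, selfD_wd hd (hf.cup hg) hfg, cup_wd hf.selfD hη hgη,
    cup_wd hf.hat hη.neg (hat_selfD_of_sign hd hg hgη), hfε]
  simp only [cup_wd hf hη hgη, selfD_wd hd hf hfε, selfD_wd hd hg hgη]
  -- The value `f(r)` has parity `|f| + ‖r‖`. This converts the sign in the Leibniz rule of `d` into
  -- `ε` times the sign of the prefix.
  have hv (r : List (Letter 𝒜)) : par 𝒜 (f (wd r)) = (ε * wsgn r) • f (wd r) := by
    have h := congrFun hfε (wpar 𝒜 (wd r))
    simp only [hat, Pi.smul_apply, wpar_wpar] at h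
    rw [h, hf.wpar_wd, smul_smul]
  have e : cupL η (fun r => par 𝒜 (f (wd r))) (fun r => d (g (wd r))) l =
      ε • cupL η (fun r => wsgn r • f (wd r)) (fun r => d (g (wd r))) l := by
    simp only [hv, mul_smul, cupL_smul_left]
  have h1 := bD_cupL hd (fun r => f (wd r)) (fun r => g (wd r)) l hη
  have h2 := actL_cupL (ε := ε) (fun r => f (wd r)) (fun r => g (wd r)) l (η := η)
  have h3 := actR_cupL (fun r => f (wd r)) (fun r => g (wd r)) l (η := η)
  have h4 := cupL_actR (fun r => f (wd r)) (fun r => g (wd r)) l (η := η)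
  simp only [Pi.smul_apply, cupL_neg_sign, cupL_smul_left, cupL_add_left, cupL_sub_left,
    cupL_add_right, cupL_sub_right, cupL_smul_right, cupL_d hd, e, h4]
  erw [h1, h2, h3]
  rcases hη with rfl | rfl <;> module

include hd in
theorem selfD_cup {f g : List A → A} (hf : Multilin k f) (hg : Multilin k g) :
    selfD 𝒜 d (cup 𝒜 f g) = cup 𝒜 (selfD 𝒜 d f) g + cup 𝒜 (hat 𝒜 (par 𝒜) f) (selfD 𝒜 d g) := by
  obtain ⟨e, h1, h2⟩ := exists_add_of_hat (𝒜 := 𝒜) (par_par 𝒜) f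
  obtain ⟨e', h1', h2'⟩ := exists_add_of_hat (𝒜 := 𝒜) (par_par 𝒜) g
  have hm1 : Multilin k ((2⁻¹ : k) • (f + hat 𝒜 (par 𝒜) f)) := (hf.add hf.hat).smul _
  have hm2 : Multilin k ((2⁻¹ : k) • (f - hat 𝒜 (par 𝒜) f)) := (hf.sub hf.hat).smul _
  have hm1' : Multilin k ((2⁻¹ : k) • (g + hat 𝒜 (par 𝒜) g)) := (hg.add hg.hat).smul _
  have hm2' : Multilin k ((2⁻¹ : k) • (g - hat 𝒜 (par 𝒜) g)) := (hg.sub hg.hat).smul _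
  generalize (2⁻¹ : k) • (f + hat 𝒜 (par 𝒜) f) = f₀ at *
  generalize (2⁻¹ : k) • (f - hat 𝒜 (par 𝒜) f) = f₁ at *
  generalize (2⁻¹ : k) • (g + hat 𝒜 (par 𝒜) g) = g₀ at *
  generalize (2⁻¹ : k) • (g - hat 𝒜 (par 𝒜) g) = g₁ at *
  subst e e'
  simp only [cup_add_left, cup_add_right, map_add, hat_add,
    selfD_cup_of_sign hd hm1 hm1' isSign_one h1 h1',
    selfD_cup_of_sign hd hm1 hm2' isSign_neg_one h1 h2',
    selfD_cup_of_sign hd hm2 hm1' isSign_one h2 h1',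
    selfD_cup_of_sign hd hm2 hm2' isSign_neg_one h2 h2']
  abel

end Cup

/-! ## Normalized cochains -/

section

variable {k : Type*} [Field k] {A : Type*} [Ring A] [Algebra k A]
  {𝒜 : ℤ → Submodule k A} {M : Type*} [AddCommGroup M] [Module k M] {ℳ : ℤ → Submodule k M}

theorem multilin_of_mem_homCochains {p : ℤ} {f : List A → M} (hf : f ∈ homCochains 𝒜 ℳ p) :
    Multilin k f := hf.1

theorem homCochains_le_cochains (p : ℤ) : homCochains 𝒜 ℳ p ≤ cochains 𝒜 ℳ :=
  le_iSup (fun p => homCochains 𝒜 ℳ p) p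

theorem cochains_induction {P : (List A → M) → Prop}
    (hom : ∀ p, ∀ f ∈ homCochains 𝒜 ℳ p, P f) (zero : P 0)
    (add : ∀ f g, P f → P g → P (f + g)) {f : List A → M} (hf : f ∈ cochains 𝒜 ℳ) : P f :=
  Submodule.iSup_induction _ (motive := P) hf hom zero add

theorem multilin_of_mem_cochains {f : List A → M} (hf : f ∈ cochains 𝒜 ℳ) : Multilin k f :=
  cochains_induction (P := Multilin k) (fun _ _ h => multilin_of_mem_homCochains h)
    (fun _ _ => ⟨fun _ _ => by simp, fun _ _ => by simp⟩) (fun _ _ h1 h2 => h1.add h2) hf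

theorem eq_zero_of_one_mem {f : List A → M} (hf : f ∈ cochains 𝒜 ℳ) {l : List A}
    (hl : (1 : A) ∈ l) : f l = 0 := by
  obtain ⟨s, t, rfl⟩ := List.append_of_mem hl
  exact cochains_induction (P := fun f => f (s ++ 1 :: t) = 0) (fun _ _ h => h.2.1 s t) rfl
    (fun f g h1 h2 => by rw [Pi.add_apply, h1, h2, add_zero]) hf

theorem exists_length_bound {f : List A → M} (hf : f ∈ cochains 𝒜 ℳ) :
    ∃ N : ℕ, ∀ l : List A, N < l.length → f l = 0 :=
  cochains_induction (P := fun f => ∃ N : ℕ, ∀ l : List A, N < l.length → f l = 0)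
    (fun _ _ h => h.2.2.1) ⟨0, fun _ _ => rfl⟩ (fun f g ⟨N, h1⟩ ⟨N', h2⟩ => ⟨max N N',
      fun l hl => by rw [Pi.add_apply, h1 l (lt_of_le_of_lt (le_max_left _ _) hl),
        h2 l (lt_of_le_of_lt (le_max_right _ _) hl), add_zero]⟩) hf

theorem parityCochains_induction {q : ZMod 2} {P : (List A → M) → Prop}
    (hom : ∀ p : ℤ, (p : ZMod 2) = q → ∀ f ∈ homCochains 𝒜 ℳ p, P f) (zero : P 0)
    (add : ∀ f g, P f → P g → P (f + g)) {f : List A → M}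
    (hf : f ∈ parityCochains 𝒜 ℳ q) : P f := by
  refine Submodule.iSup_induction _ (motive := P) hf (fun p f hf => ?_) zero add
  exact Submodule.iSup_induction _ (motive := P) hf (fun h f hf => hom p h f hf) zero add

theorem homCochains_le_parityCochains {p : ℤ} {q : ZMod 2} (h : (p : ZMod 2) = q) :
    homCochains 𝒜 ℳ p ≤ parityCochains 𝒜 ℳ q :=
  fun _ hf => Submodule.mem_iSup_of_mem p (Submodule.mem_iSup_of_mem h hf)

theorem parityCochains_le_cochains (q : ZMod 2) : parityCochains 𝒜 ℳ q ≤ cochains 𝒜 ℳ :=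
  fun _ hf => parityCochains_induction (fun p _ _ h => homCochains_le_cochains p h) (zero_mem _)
    (fun _ _ h1 h2 => add_mem h1 h2) hf

theorem exists_parity_decomposition {f : List A → M} (hf : f ∈ cochains 𝒜 ℳ) :
    ∃ f₀ ∈ parityCochains 𝒜 ℳ 0, ∃ f₁ ∈ parityCochains 𝒜 ℳ 1, f = f₀ + f₁ := by
  refine cochains_induction (P := fun f => ∃ f₀ ∈ parityCochains 𝒜 ℳ 0,
    ∃ f₁ ∈ parityCochains 𝒜 ℳ 1, f = f₀ + f₁) (fun p f hf => ?_)
    ⟨0, zero_mem _, 0, zero_mem _, by simp⟩ ?_ hf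
  · rcases Int.even_or_odd p with h | h
    · exact ⟨f, homCochains_le_parityCochains ((ZMod.intCast_eq_zero_iff_even).2 h) hf, 0,
        zero_mem _, by simp⟩
    · exact ⟨0, zero_mem _, f,
        homCochains_le_parityCochains ((ZMod.intCast_eq_one_iff_odd).2 h) hf, by simp⟩
  · rintro _ _ ⟨f, hf, g, hg, rfl⟩ ⟨f', hf', g', hg', rfl⟩
    exact ⟨f + f', add_mem hf hf', g + g', add_mem hg hg', by abel⟩

variable [GradedAlgebra 𝒜]

theorem forall₂_wpar {l : List A} {is : List ℤ} (h : List.Forall₂ (fun a i => a ∈ 𝒜 i) l is) :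
    List.Forall₂ (fun a i => a ∈ 𝒜 i) (wpar 𝒜 l) is := by
  induction h with
  | nil => exact List.Forall₂.nil
  | cons h _ ih => exact List.Forall₂.cons (spar_mem 𝒜 h) ih

theorem wpar_mem_homCochains {p : ℤ} {f : List A → M} (hf : f ∈ homCochains 𝒜 ℳ p) :
    (fun l => f (wpar 𝒜 l)) ∈ homCochains 𝒜 ℳ p := by
  obtain ⟨h1, h2, ⟨N, h3⟩, h4⟩ := hf
  refine ⟨Multilin.wpar (𝒜 := 𝒜) h1, fun l r => ?_, ⟨N, fun l hl => h3 _ (by simpa [wpar] using hl)⟩,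
    fun l is h => h4 _ _ (forall₂_wpar h)⟩
  have e : wpar 𝒜 (l ++ 1 :: r) = wpar 𝒜 l ++ (-1) :: wpar 𝒜 r := by
    simp [wpar, spar_apply]
  dsimp only
  rw [e, (h1 _ _).map_neg, h2, neg_zero]

theorem comp_mem_homCochains {p : ℤ} {f : List A → M} (hf : f ∈ homCochains 𝒜 ℳ p) {M' : Type*}
    [AddCommGroup M'] [Module k M'] {ℳ' : ℤ → Submodule k M'} (T : M →ₗ[k] M') {q : ℤ}
    (hT : ∀ i, ∀ m ∈ ℳ i, T m ∈ ℳ' (q + i)) :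
    (fun l => T (f l)) ∈ homCochains 𝒜 ℳ' (q + p) := by
  obtain ⟨h1, h2, ⟨N, h3⟩, h4⟩ := hf
  refine ⟨Multilin.linear_comp T.isLinear h1, fun l r => by simp [h2],
    ⟨N, fun l hl => by simp [h3 l hl]⟩,
    fun l is h => ?_⟩
  rw [add_assoc]
  exact hT _ _ (h4 l is h)

theorem hat_mem_homCochains {p : ℤ} {f : List A → M} (hf : f ∈ homCochains 𝒜 ℳ p)
    {σM : M →ₗ[k] M} (hσ : ∀ i, ∀ m ∈ ℳ i, σM m ∈ ℳ i) : hat 𝒜 σM f ∈ homCochains 𝒜 ℳ p := by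
  have := comp_mem_homCochains (wpar_mem_homCochains hf) (ℳ' := ℳ) σM (q := 0)
    (fun i m hm => by rw [zero_add]; exact hσ i m hm)
  rwa [zero_add] at this

theorem hat_mem_cochains {f : List A → M} (hf : f ∈ cochains 𝒜 ℳ)
    {σM : M →ₗ[k] M} (hσ : ∀ i, ∀ m ∈ ℳ i, σM m ∈ ℳ i) : hat 𝒜 σM f ∈ cochains 𝒜 ℳ :=
  cochains_induction (P := fun f => hat 𝒜 σM f ∈ cochains 𝒜 ℳ)
    (fun p _ h => homCochains_le_cochains p (hat_mem_homCochains h hσ))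
    (by
      have : hat 𝒜 σM (0 : List A → M) = 0 := by funext l; simp [hat]
      rw [this]; exact zero_mem _)
    (fun f g h1 h2 => by rw [hat_add]; exact add_mem h1 h2) hf

theorem apply_wpar_of_forall₂ {f : List A → M} (hf : Multilin k f) {l : List A} {is : List ℤ}
    (h : List.Forall₂ (fun a i => a ∈ 𝒜 i) l is) :
    f (wpar 𝒜 l) = (((is.map fun i => i - 1).sum.negOnePow : ℤˣ) : ℤ) • f l := by
  induction h generalizing f with
  | nil => simp [wpar]
  | @cons a i l is ha _ ih =>
    have e : wpar 𝒜 (a :: l) = spar 𝒜 a :: wpar 𝒜 l := rfl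
    rw [e, ih (hf.cons _), spar_apply, par_of_mem 𝒜 ha, (hf.head l).map_neg, List.map_cons,
      List.sum_cons, Int.negOnePow_add, Int.negOnePow_sub]
    rcases Int.units_eq_one_or i.negOnePow with h | h <;> rw [h] <;>
      simp [(hf.head l).map_neg]

theorem Multilin.ext_homogeneous {F G : List A → M} (hF : Multilin k F) (hG : Multilin k G)
    (h : ∀ l is, List.Forall₂ (fun a i => a ∈ 𝒜 i) l is → F l = G l) : F = G := by
  refine hF.ext_span (S := ⋃ i, (𝒜 i : Set A)) ?_ hG fun l hl => ?_
  · rw [Submodule.span_iUnion]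
    simpa using (DirectSum.Decomposition.isInternal 𝒜).submodule_iSup_eq_top
  · obtain ⟨is, his⟩ : ∃ is : List ℤ, List.Forall₂ (fun a i => a ∈ 𝒜 i) l is := by
      induction l with
      | nil => exact ⟨[], List.Forall₂.nil⟩
      | cons a l ih =>
        obtain ⟨is, h⟩ := ih fun b hb => hl b (List.mem_cons_of_mem _ hb)
        obtain ⟨i, hi⟩ := Set.mem_iUnion.1 (hl a List.mem_cons_self)
        exact ⟨i :: is, List.Forall₂.cons hi h⟩
    exact h l is his

/-- The sign of the word occurs twice, from `wpar` and from the degree of the value, and cancels;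
what remains is `(-1)^p`. -/
theorem hat_of_mem_homCochains {p : ℤ} {f : List A → M} (hf : f ∈ homCochains 𝒜 ℳ p)
    {σM : M →ₗ[k] M} (hσ : ∀ i, ∀ m ∈ ℳ i, σM m = ((i.negOnePow : ℤˣ) : ℤ) • m) :
    hat 𝒜 σM f = ((p.negOnePow : ℤˣ) : ℤ) • f := by
  have hm : Multilin k (((p.negOnePow : ℤˣ) : ℤ) • f) := by
    rcases Int.units_eq_one_or p.negOnePow with h | h <;> rw [h]
    · simpa using multilin_of_mem_homCochains hf
    · have : Multilin k (-f) := Multilin.neg (multilin_of_mem_homCochains hf)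
      simpa using this
  refine (multilin_of_mem_homCochains hf).hat.ext_homogeneous (𝒜 := 𝒜) hm fun l is his => ?_
  rw [hat, apply_wpar_of_forall₂ hf.1 his, map_zsmul, hσ _ _ (hf.2.2.2 l is his),
    Int.negOnePow_add, Pi.smul_apply, smul_smul]
  rcases Int.units_eq_one_or p.negOnePow with h | h <;> rw [h] <;>
  rcases Int.units_eq_one_or (is.map fun i => i - 1).sum.negOnePow with h | h <;> rw [h] <;> simp

theorem hat_of_even {f : List A → M} (hf : f ∈ parityCochains 𝒜 ℳ 0)
    {σM : M →ₗ[k] M} (hσ : ∀ i, ∀ m ∈ ℳ i, σM m = ((i.negOnePow : ℤˣ) : ℤ) • m) :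
    hat 𝒜 σM f = f := by
  refine parityCochains_induction (P := fun f => hat 𝒜 σM f = f) (fun p hp f hf => ?_)
    (by funext l; simp [hat]) (fun f g h1 h2 => by rw [hat_add, h1, h2]) hf
  rw [hat_of_mem_homCochains hf hσ, Int.negOnePow_even p ((ZMod.intCast_eq_zero_iff_even).1 hp)]
  simp

theorem hat_of_odd {f : List A → M} (hf : f ∈ parityCochains 𝒜 ℳ 1)
    {σM : M →ₗ[k] M} (hσ : ∀ i, ∀ m ∈ ℳ i, σM m = ((i.negOnePow : ℤˣ) : ℤ) • m) :
    hat 𝒜 σM f = -f := by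
  refine parityCochains_induction (P := fun f => hat 𝒜 σM f = -f) (fun p hp f hf => ?_)
    (by funext l; simp [hat]) (fun f g h1 h2 => by rw [hat_add, h1, h2, neg_add]) hf
  rw [hat_of_mem_homCochains hf hσ, Int.negOnePow_odd p ((ZMod.intCast_eq_one_iff_odd).1 hp)]
  simp

variable [CharZero k]

/-- Membership in the even part can be tested with the sign involution: the odd summand is reversed
by it, so it must vanish. This replaces a count of degrees for cup products and for values of `B^*`.
-/
theorem mem_even_of_hat {f : List A → M} (hf : f ∈ cochains 𝒜 ℳ)
    {σM : M →ₗ[k] M} (hσ : ∀ i, ∀ m ∈ ℳ i, σM m = ((i.negOnePow : ℤˣ) : ℤ) • m)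
    (h : hat 𝒜 σM f = f) : f ∈ parityCochains 𝒜 ℳ 0 := by
  obtain ⟨f₀, h0, f₁, h1, rfl⟩ := exists_parity_decomposition hf
  rw [hat_add, hat_of_even h0 hσ, hat_of_odd h1 hσ] at h
  have : (2 : k) • f₁ = 0 := by
    rw [two_smul]
    have := add_left_cancel h
    nth_rewrite 1 [← this]; simp
  rw [(smul_eq_zero.1 this).resolve_left two_ne_zero, add_zero]
  exact h0

theorem mem_odd_of_hat {f : List A → M} (hf : f ∈ cochains 𝒜 ℳ)
    {σM : M →ₗ[k] M} (hσ : ∀ i, ∀ m ∈ ℳ i, σM m = ((i.negOnePow : ℤˣ) : ℤ) • m)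
    (h : hat 𝒜 σM f = -f) : f ∈ parityCochains 𝒜 ℳ 1 := by
  obtain ⟨f₀, h0, f₁, h1, rfl⟩ := exists_parity_decomposition hf
  rw [hat_add, hat_of_even h0 hσ, hat_of_odd h1 hσ, neg_add] at h
  have : (2 : k) • f₀ = 0 := by
    rw [two_smul]
    have := add_right_cancel h
    nth_rewrite 1 [this]; simp
  rw [(smul_eq_zero.1 this).resolve_left two_ne_zero, zero_add]
  exact h1

end

/-! ### The cup product on Hochschild cohomology. -/

section

variable {k : Type*} [Field k] {A : Type*} [Ring A] [Algebra k A]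
  {𝒜 : ℤ → Submodule k A} [GradedAlgebra 𝒜]

theorem conv_mem_homCochains {p q : ℤ} {f g : List A → A} (hf : f ∈ homCochains 𝒜 𝒜 p)
    (hg : g ∈ homCochains 𝒜 𝒜 q) :
    (fun l => ∑ i ∈ Finset.range (l.length + 1), f (l.take i) * g (l.drop i)) ∈
      homCochains 𝒜 𝒜 (p + q) := by
  refine ⟨?_, fun l r => ?_, ?_, fun l is h => ?_⟩
  · exact Multilin.splitSum (E := fun u v => f u * g v)
      (fun v => Multilin.linear_comp (LinearMap.mulRight k (g v)).isLinear hf.1)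
      (fun u => Multilin.linear_comp (LinearMap.mulLeft k (f u)).isLinear hg.1) (fun n => n + 1)
  · refine Finset.sum_eq_zero fun i _ => ?_
    have : (1 : A) ∈ (l ++ 1 :: r).take i ++ (l ++ 1 :: r).drop i := by simp
    rcases List.mem_append.1 this with h | h
    · rw [eq_zero_of_one_mem (homCochains_le_cochains p hf) h, zero_mul]
    · rw [eq_zero_of_one_mem (homCochains_le_cochains q hg) h, mul_zero]
  · obtain ⟨N, h3⟩ := hf.2.2.1
    obtain ⟨N', h3'⟩ := hg.2.2.1
    refine ⟨N + N', fun l hl => Finset.sum_eq_zero fun i _ => ?_⟩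
    have : l.length = (l.take i).length + (l.drop i).length := by
      rw [← List.length_append, List.take_append_drop]
    rcases lt_or_ge N (l.take i).length with h | h
    · rw [h3 _ h, zero_mul]
    · rw [h3' _ (by omega), mul_zero]
  · refine sum_mem fun i _ => ?_
    have h1 := hf.2.2.2 _ _ (List.forall₂_take i h)
    have h2 := hg.2.2.2 _ _ (List.forall₂_drop i h)
    have e : (is.map fun i => i - 1).sum = ((is.take i).map fun i => i - 1).sum +
        ((is.drop i).map fun i => i - 1).sum := by
      rw [← List.sum_append, ← List.map_append, List.take_append_drop]
    rw [e, add_add_add_comm]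
    exact SetLike.mul_mem_graded h1 h2

theorem cup_mem_homCochains {p q : ℤ} {f g : List A → A} (hf : f ∈ homCochains 𝒜 𝒜 p)
    (hg : g ∈ homCochains 𝒜 𝒜 q) : cup 𝒜 f g ∈ homCochains 𝒜 𝒜 (p + q) := by
  have hf' := wpar_mem_homCochains hf
  have hg' := hat_mem_homCochains hg (σM := par 𝒜) fun i m hm => par_mem 𝒜 hm
  have := Submodule.smul_mem _ (2⁻¹ : k) (sub_mem (add_mem (add_mem (conv_mem_homCochains hf hg)
    (conv_mem_homCochains hf' hg)) (conv_mem_homCochains hf hg')) (conv_mem_homCochains hf' hg'))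
  convert this using 1
  funext l
  simp only [cup, koszul, Pi.smul_apply, Pi.add_apply, Pi.sub_apply, ← Finset.sum_add_distrib,
    ← Finset.sum_sub_distrib, Finset.smul_sum]

theorem cup_mem_cochains {f g : List A → A} (hf : f ∈ cochains 𝒜 𝒜) (hg : g ∈ cochains 𝒜 𝒜) :
    cup 𝒜 f g ∈ cochains 𝒜 𝒜 := by
  refine cochains_induction (P := fun f => cup 𝒜 f g ∈ cochains 𝒜 𝒜) (fun p f hf => ?_) ?_
    (fun f f' h1 h2 => by rw [cup_add_left]; exact add_mem h1 h2) hf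
  · refine cochains_induction (P := fun g => cup 𝒜 f g ∈ cochains 𝒜 𝒜) (fun q g hg => ?_) ?_
      (fun f f' h1 h2 => by rw [cup_add_right]; exact add_mem h1 h2) hg
    · exact homCochains_le_cochains _ (cup_mem_homCochains hf hg)
    · have := cup_smul_right (𝒜 := 𝒜) (0 : k) f 0
      rw [zero_smul, zero_smul] at this
      rw [this]; exact zero_mem _
  · have := cup_smul_left (𝒜 := 𝒜) (0 : k) 0 g
    rw [zero_smul, zero_smul] at this
    rw [this]; exact zero_mem _

variable {d : A →ₗ[k] A} [CharZero k]

theorem induces₂_cup (hd : IsDGA 𝒜 d) : Induces₂ (selfZ 𝒜 d) (selfB 𝒜 d) (selfZ 𝒜 d) (selfB 𝒜 d)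
    (selfZ 𝒜 d) (selfB 𝒜 d) (cup 𝒜) := by
  have hσ : ∀ i, ∀ m ∈ 𝒜 i, par 𝒜 m ∈ 𝒜 i := fun i m hm => par_mem 𝒜 hm
  have hat0 : hat 𝒜 (par 𝒜) (0 : List A → A) = 0 := by funext l; simp [hat]
  have z1 (f : List A → A) : cup 𝒜 0 f = 0 := by
    simpa using cup_smul_left (𝒜 := 𝒜) (0 : k) 0 f
  have z2 (f : List A → A) : cup 𝒜 f 0 = 0 := by
    simpa using cup_smul_right (𝒜 := 𝒜) (0 : k) f 0
  refine ⟨fun f hf g hg => ⟨cup_mem_cochains hf.1 hg.1, ?_⟩,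
    fun f₁ hf₁ f₂ hf₂ g₁ hg₁ g₂ hg₂ hf hg => ?_⟩
  · change selfD 𝒜 d (cup 𝒜 f g) = 0
    rw [selfD_cup hd (multilin_of_mem_cochains hf.1)
      (multilin_of_mem_cochains hg.1), LinearMap.mem_ker.1 hf.2, LinearMap.mem_ker.1 hg.2, z1, z2,
      add_zero]
  · obtain ⟨w, hw, hw'⟩ := hf
    obtain ⟨u, hu, hu'⟩ := hg
    have hm2 := multilin_of_mem_cochains hf₂.1
    have hc2 := hat_mem_cochains hf₂.1 (σM := par 𝒜) hσ
    -- `f₁ ∪ g₁ - f₂ ∪ g₂ = (f₁ - f₂) ∪ g₁ + f₂ ∪ (g₁ - g₂)`. The second cochain uses `hat f₂`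
    -- because the Leibniz rule applies `hat` once more.
    refine ⟨cup 𝒜 w g₁ + cup 𝒜 (hat 𝒜 (par 𝒜) f₂) u,
      add_mem (cup_mem_cochains hw hg₁.1) (cup_mem_cochains hc2 hu), ?_⟩
    have h2 : selfD 𝒜 d (hat 𝒜 (par 𝒜) f₂) = 0 := by
      rw [← neg_eq_zero, ← hat_selfD hd hm2, LinearMap.mem_ker.1 hf₂.2, hat0]
    rw [map_add, selfD_cup hd (multilin_of_mem_cochains hw) (multilin_of_mem_cochains hg₁.1),
      selfD_cup hd (multilin_of_mem_cochains hc2) (multilin_of_mem_cochains hu), h2,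
      LinearMap.mem_ker.1 hg₁.2, z1, z2, hat_hat (par_par 𝒜), hw', hu', cup_sub_left, cup_sub_right]
    abel

end

/-! ## The graded dual and the map `ω` -/

section

variable {k : Type*} [Field k] {A : Type*} [Ring A] [Algebra k A]
  {𝒜 : ℤ → Submodule k A} [GradedAlgebra 𝒜]

theorem dualPar_of_mem {i : ℤ} {φ : A → k} (hφ : φ ∈ dualGrading 𝒜 i) :
    dualPar 𝒜 φ = ((i.negOnePow : ℤˣ) : ℤ) • φ := by
  funext a
  change φ (par 𝒜 a) = ((i.negOnePow : ℤˣ) : ℤ) • φ a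
  induction a using DirectSum.Decomposition.inductionOn 𝒜 with
  | zero => simp [hφ.1.map_zero]
  | homogeneous a =>
    rename_i j
    by_cases h : j = -i
    · subst h
      rw [par_of_mem 𝒜 a.2, Int.negOnePow_neg]
      rcases Int.units_eq_one_or i.negOnePow with h | h <;> rw [h] <;> simp [hφ.1.map_neg]
    · rw [hφ.2 j h _ (par_mem 𝒜 a.2), hφ.2 j h _ a.2, smul_zero]
  | add a b ha hb => rw [map_add, hφ.1.map_add, hφ.1.map_add, ha, hb, smul_add]

theorem dualPar_mem {i : ℤ} {φ : A → k} (hφ : φ ∈ dualGrading 𝒜 i) :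
    dualPar 𝒜 φ ∈ dualGrading 𝒜 i := by
  rw [dualPar_of_mem hφ]; exact zsmul_mem hφ _

@[simp] theorem dualPar_dualPar (φ : A → k) : dualPar 𝒜 (dualPar 𝒜 φ) = φ := by
  funext a; simp [dualPar, LinearMap.funLeft]

/-- `homCochains` constrains values only on words of homogeneous letters. The failure of linearity
in the argument is itself multilinear in the word, so it vanishes on all words. -/
theorem isLinearMap_of_mem_cochains {f : List A → A → k} (hf : f ∈ cochains 𝒜 (dualGrading 𝒜))
    (l : List A) : IsLinearMap k (f l) := by
  refine cochains_induction (P := fun f => ∀ l, IsLinearMap k (f l)) (fun p f hf l => ?_)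
    (fun l => ⟨fun _ _ => by simp, fun _ _ => by simp⟩)
    (fun f g h1 h2 l => isLinearMap_add (h1 l) (h2 l)) hf l
  have hm := multilin_of_mem_homCochains hf
  have h0 : Multilin k (fun _ : List A => (0 : k)) := fun _ _ => (0 : A →ₗ[k] k).isLinear
  refine ⟨fun x y => ?_, fun c x => ?_⟩
  · have := ((hm.apply (x + y)).sub ((hm.apply x).add (hm.apply y))).ext_homogeneous (𝒜 := 𝒜) h0
      (fun l is h => by rw [(hf.2.2.2 l is h).1.map_add, sub_self])
    exact sub_eq_zero.1 (congrFun this l)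
  · have := ((hm.apply (c • x)).sub ((hm.apply x).smul c)).ext_homogeneous (𝒜 := 𝒜) h0
      (fun l is h => by rw [(hf.2.2.2 l is h).1.map_smul, sub_self])
    exact sub_eq_zero.1 (congrFun this l)

section Omega

variable {d : A →ₗ[k] A} {Tr : A →ₗ[k] k} (hTr : IsSymmetricTrace 𝒜 d Tr)
include hTr

theorem IsSymmetricTrace.par_eq (a : A) : Tr (par 𝒜 a) = Tr a := by
  induction a using DirectSum.Decomposition.inductionOn 𝒜 with
  | zero => simp
  | homogeneous a =>
    rename_i i
    rcases Int.even_or_odd i with h | h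
    · rw [par_of_mem 𝒜 a.2, Int.negOnePow_even i h]; simp
    · have ho := mem_parityPart 𝒜 ((ZMod.intCast_eq_one_iff_odd).2 h) a.2
      rw [par_of_odd 𝒜 ho, map_neg, hTr.even _ ho, neg_zero]
  | add a b ha hb => rw [map_add, map_add, map_add, ha, hb]

/-- `Tr(ab)` vanishes unless `|a| + |b|` is even, and then `|a| |b|` and `|a|` have the same parity.
The sign therefore depends on `a` alone. -/
theorem IsSymmetricTrace.mul_comm (a b : A) : Tr (a * b) = Tr (b * par 𝒜 a) := by
  induction a using DirectSum.Decomposition.inductionOn 𝒜 with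
  | zero => simp
  | homogeneous a =>
    rename_i i
    induction b using DirectSum.Decomposition.inductionOn 𝒜 with
    | zero => simp
    | homogeneous b =>
      rename_i j
      rcases Int.even_or_odd (i + j) with h | h
      · rw [hTr.cyclic i j a a.2 b b.2, par_of_mem 𝒜 a.2, mul_smul_comm, map_zsmul]
        have : (i * j).negOnePow = i.negOnePow := by
          rw [Int.negOnePow_eq_iff]
          rw [Int.even_add] at h
          rw [Int.even_sub, Int.even_mul]
          tauto
        rw [this]
      · have ho := mem_parityPart 𝒜 ((ZMod.intCast_eq_one_iff_odd).2 h)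
          (SetLike.mul_mem_graded a.2 b.2)
        have ho' := mem_parityPart 𝒜 ((ZMod.intCast_eq_one_iff_odd).2 (by rwa [add_comm] at h))
          (SetLike.mul_mem_graded b.2 (par_mem 𝒜 a.2))
        rw [hTr.even _ ho, hTr.even _ ho']
    | add b c hb hc => rw [mul_add, add_mul, map_add, map_add, hb, hc]
  | add a c ha hc => rw [add_mul, map_add, map_add, mul_add, map_add, ha, hc]

theorem IsSymmetricTrace.d_mul (hd : IsDGA 𝒜 d) (a b : A) :
    Tr (d a * b) = -Tr (par 𝒜 a * d b) := by
  have := hTr.closed (a * b)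
  rw [hd.d_mul, map_add] at this
  exact eq_neg_of_add_eq_zero_left this

end Omega

/-- The map `ω` as a linear map. -/
def omegaLin (Tr : A →ₗ[k] k) : A →ₗ[k] (A → k) where
  toFun := omega Tr
  map_add' a b := by funext c; simp [omega, add_mul]
  map_smul' c a := by funext b; simp [omega]

theorem hat_omegaSharp {d : A →ₗ[k] A} {Tr : A →ₗ[k] k} (hTr : IsSymmetricTrace 𝒜 d Tr)
    (f : List A → A) :
    hat 𝒜 (dualPar 𝒜) (omegaSharp Tr f) = omegaSharp Tr (hat 𝒜 (par 𝒜) f) := by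
  funext l b
  change Tr (f (wpar 𝒜 l) * par 𝒜 b) = Tr (par 𝒜 (f (wpar 𝒜 l)) * b)
  rw [← hTr.par_eq, par_mul, par_par]

/-- `ω` is a map of dg bimodules: the left action uses cyclicity of the trace, the right one
associativity, the differential closedness. -/
theorem coD_omegaSharp {d : A →ₗ[k] A} (hd : IsDGA 𝒜 d) {Tr : A →ₗ[k] k}
    (hTr : IsSymmetricTrace 𝒜 d Tr) (f : List A → A) :
    coD 𝒜 d (omegaSharp Tr f) = omegaSharp Tr (selfD 𝒜 d f) := by
  have hl (a x : A) : dualLeft 𝒜 a (omega Tr x) = omega Tr (a * x) := by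
    funext b
    change Tr (x * (b * par 𝒜 a)) = Tr (a * x * b)
    rw [mul_assoc, hTr.mul_comm a, mul_assoc]
  have hr (a x : A) : dualRight a (omega Tr x) = omega Tr (x * a) := by
    funext b
    change Tr (x * (a * b)) = Tr (x * a * b)
    rw [mul_assoc]
  have hdd (x : A) : dualD 𝒜 d (omega Tr x) = omega Tr (d x) := by
    funext b
    change Tr (x * d (par 𝒜 b)) = Tr (d x * b)
    rw [hTr.d_mul hd, hd.d_par, ← hTr.par_eq, mul_neg, map_neg, map_neg, par_mul, par_par]
  funext l
  have hA : actionTerms 𝒜 (dualPar 𝒜) (dualLeft 𝒜) dualRight (omegaSharp Tr f) l =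
      omegaLin Tr (actionTerms 𝒜 (par 𝒜) (fun a => LinearMap.mulLeft k a)
        (fun a => LinearMap.mulRight k a) f l) := by
    cases l with
    | nil => simp [actionTerms]
    | cons a l =>
      simp only [actionTerms, koszul, hat_omegaSharp hTr, map_sub, map_smul, map_add]
      simp only [omegaSharp, hl, hr]
      rfl
  change dualD 𝒜 d (omega Tr (f l)) - barD 𝒜 d (hat 𝒜 (dualPar 𝒜) (omegaSharp Tr f)) l +
    actionTerms 𝒜 (dualPar 𝒜) (dualLeft 𝒜) dualRight (omegaSharp Tr f) l = omegaLin Tr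
      (d (f l) - barD 𝒜 d (hat 𝒜 (par 𝒜) f) l + actionTerms 𝒜 (par 𝒜)
        (fun a => LinearMap.mulLeft k a) (fun a => LinearMap.mulRight k a) f l)
  rw [hA, hdd, hat_omegaSharp hTr, map_add, map_sub, ← barD_comp]
  rfl

theorem omegaSharp_mem_cochains {d : A →ₗ[k] A} {Tr : A →ₗ[k] k} (hTr : IsSymmetricTrace 𝒜 d Tr)
    {f : List A → A} (hf : f ∈ cochains 𝒜 𝒜) :
    omegaSharp Tr f ∈ cochains 𝒜 (dualGrading 𝒜) := by
  refine cochains_induction (P := fun f => omegaSharp Tr f ∈ cochains 𝒜 (dualGrading 𝒜))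
    (fun p f hf => ?_) ?_ (fun f g h1 h2 => ?_) hf
  -- `Tr` is only a finite sum of homogeneous functionals; each summand `φ` of degree `i` shifts the
  -- degree of the cochain by `i`.
  · refine Submodule.iSup_induction _ (motive := fun φ : A → k =>
      (fun (l : List A) b => φ (f l * b)) ∈ cochains 𝒜 (dualGrading 𝒜)) hTr.mem_dual
      (fun i φ hφ => ?_) (zero_mem _) (fun φ ψ h1 h2 => add_mem h1 h2)
    refine homCochains_le_cochains _ (comp_mem_homCochains hf (ℳ' := dualGrading 𝒜)
      ({ toFun := fun x b => φ (x * b)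
         map_add' := fun x y => by funext b; simp only [add_mul, hφ.1.map_add]; rfl
         map_smul' := fun c x => by
           funext b; simp only [smul_mul_assoc, hφ.1.map_smul]; rfl } : A →ₗ[k] (A → k))
      (q := i) fun j x hx => ⟨?_, fun m hm b hb => ?_⟩)
    · exact (isLinearMap_comp hφ.1 (LinearMap.mulLeft k x).isLinear :)
    · exact hφ.2 (j + m) (by omega) _ (SetLike.mul_mem_graded hx hb)
  · have : omegaSharp Tr (0 : List A → A) = 0 := by funext l b; simp [omegaSharp, omega]
    rw [this]; exact zero_mem _
  · have : omegaSharp Tr (f + g) = omegaSharp Tr f + omegaSharp Tr g := by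
      funext l b; simp [omegaSharp, omega, add_mul]
    rw [this]; exact add_mem h1 h2

theorem induces_omegaSharp {d : A →ₗ[k] A} (hd : IsDGA 𝒜 d) {Tr : A →ₗ[k] k}
    (hTr : IsSymmetricTrace 𝒜 d Tr) :
    Induces (selfZ 𝒜 d) (selfB 𝒜 d) (coZ 𝒜 d) (coB 𝒜 d) (omegaSharp Tr) := by
  have hsub (f g : List A → A) : omegaSharp Tr (f - g) = omegaSharp Tr f - omegaSharp Tr g := by
    funext l b; simp [omegaSharp, omega, sub_mul]
  refine ⟨fun f hf => ⟨omegaSharp_mem_cochains hTr hf.1, ?_⟩, fun f _ g _ h => ?_⟩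
  · change coD 𝒜 d (omegaSharp Tr f) = 0
    rw [coD_omegaSharp hd hTr, LinearMap.mem_ker.1 hf.2]
    funext l b; simp [omegaSharp, omega]
  · obtain ⟨w, hw, hw'⟩ := h
    exact ⟨omegaSharp Tr w, omegaSharp_mem_cochains hTr hw, by
      rw [coD_omegaSharp hd hTr, hw', hsub]⟩

/-! ## Connes' operator -/

/-- The sum of the rotations of a word, with Koszul signs. -/
def rotWord (f : List A → A → k) (w : List A) : k :=
  ∑ i ∈ Finset.range w.length,
    koszul k (wpar 𝒜) (wpar 𝒜) (fun u v => f (u ++ v) 1) (w.drop i) (w.take i)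

theorem rotSum_eq_rotWord (f : List A → A → k) (a : A) (l : List A) :
    rotSum 𝒜 f a l = rotWord (𝒜 := 𝒜) f (a :: l) := rfl

theorem Multilin.append_wpar_left {f : List A → k} (hf : Multilin k f) (v : List A) :
    Multilin k fun u => f (MCRep.wpar 𝒜 u ++ v) := (hf.append_right v).wpar (𝒜 := 𝒜)

theorem Multilin.append_wpar_right {f : List A → k} (hf : Multilin k f) (u : List A) :
    Multilin k fun v => f (u ++ MCRep.wpar 𝒜 v) := (hf.append_left u).wpar (𝒜 := 𝒜)

theorem multilin_rotWord {f : List A → A → k} (hf : Multilin k f) :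
    Multilin k (rotWord (𝒜 := 𝒜) f) := by
  have h := hf.apply 1
  refine Multilin.splitSum (E := fun v u => koszul k (wpar 𝒜) (wpar 𝒜)
    (fun u v => f (u ++ v) 1) u v) (fun v => ?_) (fun u => ?_) (fun n => n)
  · refine Multilin.smul _ (((Multilin.add ?_ ?_).add ?_).sub ?_)
    · exact h.append_left v
    · exact h.append_left _
    · exact h.append_wpar_right v
    · exact h.append_wpar_right _
  · refine Multilin.smul _ (((Multilin.add ?_ ?_).add ?_).sub ?_)
    · exact h.append_right u
    · exact h.append_wpar_left u
    · exact h.append_right _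
    · exact h.append_wpar_left _

theorem rotWord_hat {f : List A → A → k} (w : List A) :
    rotWord (𝒜 := 𝒜) (hat 𝒜 (dualPar 𝒜) f) w = rotWord (𝒜 := 𝒜) f (wpar 𝒜 w) := by
  have hlen : (wpar 𝒜 w).length = w.length := by simp [wpar]
  have ht (i : ℕ) : (wpar 𝒜 w).take i = wpar 𝒜 (w.take i) := by simp [wpar]
  have hdr (i : ℕ) : (wpar 𝒜 w).drop i = wpar 𝒜 (w.drop i) := by simp [wpar]
  have happ (u v : List A) : wpar 𝒜 (u ++ v) = wpar 𝒜 u ++ wpar 𝒜 v := by simp [wpar]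
  have h1 (u : List A) : hat 𝒜 (dualPar 𝒜) f u 1 = f (wpar 𝒜 u) 1 := by
    change f (wpar 𝒜 u) (par 𝒜 1) = _
    rw [par_one]
  simp only [rotWord, hlen, ht, hdr, koszul, h1, happ, wpar_wpar]

theorem hat_connes {f : List A → A → k} (hf : Multilin k f) :
    hat 𝒜 (dualPar 𝒜) (connes 𝒜 f) = -connes 𝒜 (hat 𝒜 (dualPar 𝒜) f) := by
  funext l a
  have hR (x : A) (m : List A) : rotSum 𝒜 (hat 𝒜 (dualPar 𝒜) f) x m =
      -rotSum 𝒜 f (par 𝒜 x) (wpar 𝒜 m) := by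
    rw [rotSum_eq_rotWord, rotWord_hat, rotSum_eq_rotWord,
      ← ((multilin_rotWord hf).head _).map_neg]
    rfl
  change -koszul k (par 𝒜) (wpar 𝒜)
      (fun x m => rotSum 𝒜 (hat 𝒜 (dualPar 𝒜) f) x m) (par 𝒜 a) (wpar 𝒜 l) =
    - -koszul k (par 𝒜) (wpar 𝒜)
      (fun x m => rotSum 𝒜 (hat 𝒜 (dualPar 𝒜) (hat 𝒜 (dualPar 𝒜) f)) x m) a l
  rw [hat_hat dualPar_dualPar]
  simp only [koszul, hR, par_par, wpar_wpar]
  module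

theorem rotWord_of_one_mem {f : List A → A → k} (hf : f ∈ cochains 𝒜 (dualGrading 𝒜))
    {w : List A} (hw : (1 : A) ∈ w) : rotWord (𝒜 := 𝒜) f w = 0 := by
  have hm := multilin_of_mem_cochains hf
  have hone {u : List A} (v : List A) (h : (1 : A) ∈ u) : f (wpar 𝒜 u ++ v) = 0 := by
    obtain ⟨s, t, rfl⟩ := List.append_of_mem h
    have e : wpar 𝒜 (s ++ 1 :: t) ++ v = wpar 𝒜 s ++ (-1) :: (wpar 𝒜 t ++ v) := by
      simp [wpar, spar_apply]
    rw [e, (hm _ _).map_neg, eq_zero_of_one_mem hf (by simp), neg_zero]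
  have hone' {v : List A} (u : List A) (h : (1 : A) ∈ v) : f (u ++ wpar 𝒜 v) = 0 := by
    obtain ⟨s, t, rfl⟩ := List.append_of_mem h
    have e : u ++ wpar 𝒜 (s ++ 1 :: t) = (u ++ wpar 𝒜 s) ++ (-1) :: (wpar 𝒜 t) := by
      simp [wpar, spar_apply]
    rw [e, (hm _ _).map_neg, eq_zero_of_one_mem hf (by simp), neg_zero]
  refine Finset.sum_eq_zero fun i _ => ?_
  have hmem : (1 : A) ∈ w.take i ++ w.drop i := by rwa [List.take_append_drop]
  rcases List.mem_append.1 hmem with h | h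
  · simp [koszul, hone' _ h, eq_zero_of_one_mem hf (List.mem_append_right _ h)]
  · simp [koszul, hone _ h, eq_zero_of_one_mem hf (List.mem_append_left _ h)]

theorem rotSum_mem_homCochains {p : ℤ} {f : List A → A → k}
    (hf : f ∈ homCochains 𝒜 (dualGrading 𝒜) p) :
    (fun l a => rotSum 𝒜 f a l) ∈ homCochains 𝒜 (dualGrading 𝒜) (-1 + p) := by
  have hm := multilin_rotWord (𝒜 := 𝒜) (multilin_of_mem_homCochains hf)
  have hc := homCochains_le_cochains p hf
  refine ⟨fun l r => isLinearMap_pi fun a => (hm.cons a) l r, fun l r => ?_, ?_, fun l is h => ?_⟩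
  · funext a
    exact rotWord_of_one_mem hc (by simp)
  · obtain ⟨N, hN⟩ := hf.2.2.1
    refine ⟨N, fun l hl => ?_⟩
    funext a
    refine Finset.sum_eq_zero fun i _ => ?_
    have hlen (v : List A) : (wpar 𝒜 v).length = v.length := by simp [wpar]
    have hlen' : ((a :: l).drop i).length + ((a :: l).take i).length = l.length + 1 := by
      rw [add_comm, ← List.length_append, List.take_append_drop, List.length_cons]
    rw [koszul, hN _ (by rw [List.length_append]; omega),
      hN _ (by rw [List.length_append, hlen]; omega),
      hN _ (by rw [List.length_append, hlen]; omega),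
      hN _ (by rw [List.length_append, hlen, hlen]; omega)]
    simp
  · refine ⟨hm.head l, fun j hj a ha => ?_⟩
    refine Finset.sum_eq_zero fun i _ => ?_
    have hw : List.Forall₂ (fun a i => a ∈ 𝒜 i) (a :: l) (j :: is) := List.Forall₂.cons ha h
    have hu := List.forall₂_drop i hw
    have hv := List.forall₂_take i hw
    have hsum : (((j :: is).drop i ++ (j :: is).take i).map fun i => i - 1).sum =
        (j - 1) + (is.map fun i => i - 1).sum := by
      rw [List.map_append, List.sum_append, add_comm, ← List.sum_append, ← List.map_append,
        List.take_append_drop, List.map_cons, List.sum_cons]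
    have key {u v : List A} (hu : List.Forall₂ (fun a i => a ∈ 𝒜 i) u ((j :: is).drop i))
        (hv : List.Forall₂ (fun a i => a ∈ 𝒜 i) v ((j :: is).take i)) : f (u ++ v) 1 = 0 :=
      (hf.2.2.2 _ _ (List.rel_append hu hv)).2 0 (by rw [hsum]; omega) 1
        SetLike.GradedOne.one_mem
    rw [koszul, key hu hv, key (forall₂_wpar hu) hv, key hu (forall₂_wpar hv),
      key (forall₂_wpar hu) (forall₂_wpar hv)]
    simp

theorem connes_mem_homCochains {p : ℤ} {f : List A → A → k}
    (hf : f ∈ homCochains 𝒜 (dualGrading 𝒜) p) :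
    connes 𝒜 f ∈ homCochains 𝒜 (dualGrading 𝒜) (-1 + p) := by
  have hσ : ∀ i, ∀ m ∈ dualGrading 𝒜 i, dualPar 𝒜 m ∈ dualGrading 𝒜 i :=
    fun i m hm => dualPar_mem hm
  have h0 := rotSum_mem_homCochains (hat_mem_homCochains hf hσ)
  have hP {q : ℤ} {g : List A → A → k} (hg : g ∈ homCochains 𝒜 (dualGrading 𝒜) q) :
      (fun l => dualPar 𝒜 (g l)) ∈ homCochains 𝒜 (dualGrading 𝒜) q := by
    have := comp_mem_homCochains hg (ℳ' := dualGrading 𝒜) (dualPar 𝒜) (q := 0)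
      (fun i m hm => by rw [zero_add]; exact hσ i m hm)
    rwa [zero_add] at this
  exact neg_mem (Submodule.smul_mem _ (2⁻¹ : k) (sub_mem (add_mem (add_mem h0 (hP h0))
    (wpar_mem_homCochains h0)) (hP (wpar_mem_homCochains h0))))

theorem connes_mem_cochains {f : List A → A → k} (hf : f ∈ cochains 𝒜 (dualGrading 𝒜)) :
    connes 𝒜 f ∈ cochains 𝒜 (dualGrading 𝒜) :=
  cochains_induction (P := fun f => connes 𝒜 f ∈ cochains 𝒜 (dualGrading 𝒜))
    (fun _ _ h => homCochains_le_cochains _ (connes_mem_homCochains h))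
    (by rw [map_zero]; exact zero_mem _) (fun f g h1 h2 => by rw [map_add]; exact add_mem h1 h2) hf

/-- With `a₀ = 1` every rotated word contains the letter `1`, and normalized cochains vanish on such
words. -/
theorem connes_apply_of_one_mem {f : List A → A → k} (hf : f ∈ cochains 𝒜 (dualGrading 𝒜))
    (l : List A) : connes 𝒜 f l 1 = 0 := by
  have hf' := hat_mem_cochains hf (σM := dualPar 𝒜) fun i m hm => dualPar_mem hm
  have hR (m : List A) : rotSum 𝒜 (hat 𝒜 (dualPar 𝒜) f) 1 m = 0 :=
    rotWord_of_one_mem hf' (by simp)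
  change -koszul k (par 𝒜) (wpar 𝒜)
      (fun x m => rotSum 𝒜 (hat 𝒜 (dualPar 𝒜) f) x m) 1 l = 0
  simp [koszul, hR]

/-- `B^*` reads its argument only through values at `1`, and those of `B^* f` are zero. -/
theorem connes_connes {f : List A → A → k} (hf : f ∈ cochains 𝒜 (dualGrading 𝒜)) :
    connes 𝒜 (connes 𝒜 f) = 0 := by
  have h1 (w : List A) : hat 𝒜 (dualPar 𝒜) (connes 𝒜 f) w 1 = 0 := by
    change connes 𝒜 f (wpar 𝒜 w) (par 𝒜 1) = 0
    rw [par_one, connes_apply_of_one_mem hf]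
  have hR (x : A) (m : List A) : rotSum 𝒜 (hat 𝒜 (dualPar 𝒜) (connes 𝒜 f)) x m = 0 :=
    Finset.sum_eq_zero fun i _ => by simp [koszul, h1]
  funext l a
  change -koszul k (par 𝒜) (wpar 𝒜)
      (fun x m => rotSum 𝒜 (hat 𝒜 (dualPar 𝒜) (connes 𝒜 f)) x m) a l = 0
  simp [koszul, hR]

end

/-! ## Rotations of words of letters -/

section Letters

variable {k : Type*} [Field k] {A : Type*} [Ring A] [Algebra k A]
  {𝒜 : ℤ → Submodule k A} [GradedAlgebra 𝒜] {d : A →ₗ[k] A} (hd : IsDGA 𝒜 d)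

/-- `F ∘ t`, where `t` moves the first letter to the end, with the Koszul sign. -/
def rotL (F : List (Letter 𝒜) → k) : List (Letter 𝒜) → k
  | [] => F []
  | a :: l => ksgn a.sgn (wsgn l) * F (l ++ [a])

/-- The sum of all rotations. -/
def rotN (F : List (Letter 𝒜) → k) (w : List (Letter 𝒜)) : k :=
  ∑ i ∈ Finset.range w.length, rotL^[i] F w

theorem rotL_iterate_congr {F G : List (Letter 𝒜) → k} (i : ℕ) (w : List (Letter 𝒜))
    (h : ∀ w', w'.length = w.length → F w' = G w') : rotL^[i] F w = rotL^[i] G w := by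
  induction i generalizing w with
  | zero => exact h w rfl
  | succ i ih =>
    rw [Function.iterate_succ_apply', Function.iterate_succ_apply']
    cases w with
    | nil => exact ih [] h
    | cons a l =>
      simp only [rotL]
      rw [ih (l ++ [a]) fun w' hw' => h w' (by simpa using hw')]

theorem rotN_congr {F G : List (Letter 𝒜) → k} (w : List (Letter 𝒜))
    (h : ∀ w', w'.length = w.length → F w' = G w') : rotN F w = rotN G w :=
  Finset.sum_congr rfl fun i _ => rotL_iterate_congr i w h

theorem rotL_sum {ι : Type*} (s : Finset ι) (F : ι → List (Letter 𝒜) → k)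
    (w : List (Letter 𝒜)) : rotL (fun w => ∑ j ∈ s, F j w) w = ∑ j ∈ s, rotL (F j) w := by
  cases w with
  | nil => rfl
  | cons a l => simp only [rotL, Finset.mul_sum]

theorem rotL_iterate_sum {ι : Type*} (s : Finset ι) (F : ι → List (Letter 𝒜) → k) (i : ℕ)
    (w : List (Letter 𝒜)) :
    rotL^[i] (fun w => ∑ j ∈ s, F j w) w = ∑ j ∈ s, rotL^[i] (F j) w := by
  induction i generalizing F with
  | zero => rfl
  | succ i ih =>
    simp only [Function.iterate_succ_apply]
    rw [← ih, funext (rotL_sum s F)]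

theorem rotN_sum {ι : Type*} (s : Finset ι) (F : ι → List (Letter 𝒜) → k)
    (w : List (Letter 𝒜)) : rotN (fun w => ∑ j ∈ s, F j w) w = ∑ j ∈ s, rotN (F j) w := by
  simp only [rotN, rotL_iterate_sum]
  exact Finset.sum_comm

theorem rotL_iterate_smul (c : k) (F : List (Letter 𝒜) → k) (i : ℕ) (w : List (Letter 𝒜)) :
    rotL^[i] (fun w => c * F w) w = c * rotL^[i] F w := by
  induction i generalizing w with
  | zero => rfl
  | succ i ih =>
    rw [Function.iterate_succ_apply', Function.iterate_succ_apply']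
    cases w with
    | nil => exact ih _
    | cons a l => simp only [rotL, ih]; ring

theorem rotN_smul (c : k) (F : List (Letter 𝒜) → k) (w : List (Letter 𝒜)) :
    rotN (fun w => c * F w) w = c * rotN F w := by
  simp only [rotN, rotL_iterate_smul, Finset.mul_sum]

theorem rotN_add (F G : List (Letter 𝒜) → k) (w : List (Letter 𝒜)) :
    rotN (fun w => F w + G w) w = rotN F w + rotN G w := by
  have := rotN_sum Finset.univ (fun b : Bool => if b then F else G) w
  simpa using this

/-- Rescaling by the sign of the word commutes with rotations. -/
theorem rotN_wsgn (F : List (Letter 𝒜) → k) (w : List (Letter 𝒜)) :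
    rotN (fun w => wsgn w * F w) w = wsgn w * rotN F w := by
  have key (i : ℕ) : ∀ w : List (Letter 𝒜), rotL^[i] (fun w => wsgn w * F w) w =
      wsgn w * rotL^[i] F w := by
    induction i with
    | zero => exact fun _ => rfl
    | succ i ih =>
      intro w
      rw [Function.iterate_succ_apply', Function.iterate_succ_apply']
      cases w with
      | nil => exact ih _
      | cons a l => simp only [rotL, ih, wsgn_append, wsgn_cons, wsgn_nil]; ring
  simp only [rotN, key, Finset.mul_sum]

variable [CharZero k]

/-- Moving the letters of `u` past `v` one by one costs the Koszul sign of moving the whole block: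
the signs between letters of `u` occur twice. -/
theorem rotL_iterate_append (u v : List (Letter 𝒜)) (F : List (Letter 𝒜) → k) :
    rotL^[u.length] F (u ++ v) = ksgn (wsgn u) (wsgn v) * F (v ++ u) := by
  induction u generalizing v with
  | nil => simp
  | cons a u ih =>
    rw [List.length_cons, Function.iterate_succ_apply', List.cons_append, rotL, List.append_assoc,
      ih, List.append_assoc, List.singleton_append, ← mul_assoc]
    congr 1
    rw [wsgn_append, wsgn_append, wsgn_cons, wsgn_cons, wsgn_nil, mul_one]
    rcases a.isSign with h | h <;> rcases isSign_wsgn u with h' | h' <;>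
    rcases isSign_wsgn v with h'' | h'' <;> simp [h, h', h'']

theorem rotL_iterate_length (F : List (Letter 𝒜) → k) (w : List (Letter 𝒜)) :
    rotL^[w.length] F w = F w := by
  have := rotL_iterate_append w [] F
  simpa using this

/-- The rotation `t` satisfies `tⁿ = 1` on words of length `n`, Koszul signs included, so a sum over
all powers is unchanged by a shift. -/
theorem rotN_rotL (F : List (Letter 𝒜) → k) (w : List (Letter 𝒜)) :
    rotN (rotL F) w = rotN F w := by
  have h := Finset.sum_range_succ' (fun i => rotL^[i] F w) w.length
  rw [Finset.sum_range_succ, rotL_iterate_length] at h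
  exact (add_right_cancel h).symm

theorem rotN_rotL_iterate (c : ℕ) (F : List (Letter 𝒜) → k) (w : List (Letter 𝒜)) :
    rotN (rotL^[c] F) w = rotN F w := by
  induction c with
  | zero => rfl
  | succ c ih => rw [Function.iterate_succ_apply', rotN_rotL, ih]

theorem rotL_rotN (F : List (Letter 𝒜) → k) : rotL (rotN F) = rotN F := by
  funext w
  rw [← rotN_rotL]
  cases w with
  | nil => rfl
  | cons a l =>
    simp only [rotL, rotN, Finset.mul_sum, List.length_append, List.length_cons, List.length_nil,
      zero_add]
    refine Finset.sum_congr rfl fun i _ => ?_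
    rw [← Function.iterate_succ_apply, Function.iterate_succ_apply']
    rfl

/-- Indexed one rotation later than `rotN_eq_sum`, so that in every term `a` is followed by a prefix
of `l`; this keeps the two letters involved in a head term next to each other. -/
theorem rotN_cons (F : List (Letter 𝒜) → k) (a : Letter 𝒜) (l : List (Letter 𝒜)) :
    rotN F (a :: l) = ∑ i ∈ Finset.range (l.length + 1),
      ksgn (a.sgn * wsgn (l.take i)) (wsgn (l.drop i)) * F (l.drop i ++ a :: l.take i) := by
  rw [← rotN_rotL]
  refine Finset.sum_congr rfl fun i hi => ?_
  have hi' : i ≤ l.length := by rw [Finset.mem_range] at hi; omega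
  rw [← Function.iterate_succ_apply]
  have := rotL_iterate_append (a :: l.take i) (l.drop i) F
  rw [List.cons_append, List.take_append_drop, wsgn_cons, List.length_cons, List.length_take,
    min_eq_left hi'] at this
  exact this

theorem rotN_eq_sum (F : List (Letter 𝒜) → k) (w : List (Letter 𝒜)) :
    rotN F w = ∑ i ∈ Finset.range w.length,
      ksgn (wsgn (w.take i)) (wsgn (w.drop i)) * F (w.drop i ++ w.take i) := by
  refine Finset.sum_congr rfl fun i hi => ?_
  have := rotL_iterate_append (w.take i) (w.drop i) F
  rwa [List.take_append_drop, List.length_take,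
    min_eq_left (le_of_lt (Finset.mem_range.1 hi))] at this

omit [CharZero k] in
theorem bD_eq_sum (F : List (Letter 𝒜) → k) (w : List (Letter 𝒜)) :
    bD hd F w = ∑ j ∈ Finset.range w.length,
      wsgn (w.take j) * headD hd (fun r => F (w.take j ++ r)) (w.drop j) := by
  induction w generalizing F with
  | nil => rfl
  | cons a l ih =>
    rw [bD, ih, List.length_cons, Finset.sum_range_succ', add_comm, Finset.smul_sum]
    simp [mul_assoc]

theorem ksgn_neg_left (s : k) {t : k} (ht : IsSign t) : ksgn (-s) t = t * ksgn s t := by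
  rw [neg_eq_neg_one_mul, ksgn_mul_left _ _ ht, ksgn_neg_one_left]

theorem ksgn_neg_right {s : k} (t : k) (hs : IsSign s) : ksgn s (-t) = s * ksgn s t := by
  rw [ksgn_comm, ksgn_neg_left _ hs, ksgn_comm]

/-- Replacing the head by a letter of opposite parity costs the sign of the block rotated in front
of it. A product shortens the word and so has one rotation fewer, in accordance with the term where
`a` stands last and has no right neighbour. -/
theorem headD_rotN (F : List (Letter 𝒜) → k) (a : Letter 𝒜) (l : List (Letter 𝒜)) :
    headD hd (rotN F) (a :: l) = ∑ i ∈ Finset.range (l.length + 1),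
      ksgn (a.sgn * wsgn (l.take i)) (wsgn (l.drop i)) *
        (wsgn (l.drop i) * headD hd (fun r => F (l.drop i ++ r)) (a :: l.take i)) := by
  have hs (i : ℕ) (s : k) (m : List (Letter 𝒜)) : ksgn (-s) (wsgn (m.drop i)) =
      wsgn (m.drop i) * ksgn s (wsgn (m.drop i)) := ksgn_neg_left _ (isSign_wsgn _)
  cases l with
  | nil => simp [headD, rotN_cons]
  | cons b l =>
    have hL : headD hd (rotN F) (a :: b :: l) =
      -rotN F (a.diff hd :: b :: l) - a.sgn * rotN F (a.mul b :: l) := rfl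
    rw [hL, rotN_cons, rotN_cons, List.length_cons, Finset.sum_range_succ' _ (l.length + 1),
      Finset.sum_range_succ' _ (l.length + 1)]
    simp only [Letter.diff_sgn, Letter.mul_sgn, neg_mul, hs]
    simp only [List.take_succ_cons, List.drop_succ_cons, headD, wsgn_cons, List.take_zero,
      List.drop_zero, smul_eq_mul]
    rw [neg_add, Finset.mul_sum, sub_eq_add_neg, add_right_comm, ← Finset.sum_neg_distrib,
      ← Finset.sum_neg_distrib, ← Finset.sum_add_distrib]
    congr 1
    · refine Finset.sum_congr rfl fun i _ => ?_
      ring_nf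
    · ring_nf

/-- A head term of a cyclic sum is the bar differential applied at some position and then rotated.
The outer cyclic sum absorbs the rotation, so summing over positions gives the whole bar
differential. -/
theorem rotN_headD_rotN (F : List (Letter 𝒜) → k) (w : List (Letter 𝒜)) :
    rotN (headD hd (rotN F)) w = rotN (bD hd F) w := by
  -- `H j` is the part of the bar differential at position `j`. `h2` exhibits the head terms of the
  -- cyclic sum as rotations of the `H j`, by an amount depending on `j`.
  let H (j : ℕ) (w : List (Letter 𝒜)) : k :=
    wsgn (w.take j) * headD hd (fun r => F (w.take j ++ r)) (w.drop j)
  have h1 : rotN (bD hd F) w = rotN (fun w' => ∑ j ∈ Finset.range w.length, H j w') w :=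
    rotN_congr w fun w' hw' => by rw [bD_eq_sum, hw']
  have h2 : rotN (headD hd (rotN F)) w =
      rotN (fun w' => ∑ j ∈ Finset.range w.length, rotL^[w.length - j] (H j) w') w := by
    refine rotN_congr w fun w' hw' => ?_
    cases w' with
    | nil => rw [← hw']; rfl
    | cons a l =>
      rw [headD_rotN, ← hw', List.length_cons, ← Finset.sum_range_reflect]
      refine Finset.sum_congr rfl fun j hj => ?_
      have hj' : j < l.length + 1 := Finset.mem_range.1 hj
      have e : l.length + 1 - 1 - j = l.length - j := by omega
      have e2 : l.length + 1 - j = (a :: l.take (l.length - j)).length := by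
        rw [List.length_cons, List.length_take]; omega
      have h := rotL_iterate_append (a :: l.take (l.length - j)) (l.drop (l.length - j)) (H j)
      rw [List.cons_append, List.take_append_drop, ← e2] at h
      have e3 : j = (l.drop (l.length - j)).length := by rw [List.length_drop]; omega
      rw [e, h, wsgn_cons]
      simp only [H]
      rw [List.take_append_of_le_length e3.le, List.drop_append_of_le_length e3.le,
        List.take_of_length_le e3.ge, List.drop_of_length_le e3.ge, List.nil_append]
  rw [h1, h2, rotN_sum, rotN_sum]
  exact Finset.sum_congr rfl fun j _ => rotN_rotL_iterate _ _ _

/-- The product of the last and the first letter of a cyclic word. -/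
def wrap (G : List (Letter 𝒜) → k) (c : Letter 𝒜) : List (Letter 𝒜) → k
  | [] => 0
  | a :: q => -(ksgn (a.sgn * wsgn q) c.sgn * c.sgn) * G (c.mul a :: q)

/-- Rotating each position to the front and using the invariance of `G` reproduces the bar
differential. The one additional term occurs when `c` is in front: its right neighbour is then the
first letter of the word. -/
theorem rotN_headD {G : List (Letter 𝒜) → k} (hG : rotL G = G) (q : List (Letter 𝒜))
    (c : Letter 𝒜) :
    rotN (headD hd G) (q ++ [c]) = bD hd G (q ++ [c]) + wrap G c q := by
  have hG' (u v : List (Letter 𝒜)) : G (u ++ v) = ksgn (wsgn u) (wsgn v) * G (v ++ u) := by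
    rw [← rotL_iterate_append, Function.iterate_fixed hG]
  have key (q t : List (Letter 𝒜)) (x y : Letter 𝒜) :
      ksgn (wsgn q) (wsgn (x :: y :: t)) * headD hd G (x :: y :: t ++ q) =
        wsgn q * headD hd (fun z => G (q ++ z)) (x :: y :: t) := by
    simp only [headD, List.cons_append, smul_eq_mul, hG' q, wsgn_cons, Letter.diff_sgn,
      Letter.mul_sgn, neg_mul]
    rw [ksgn_neg_right _ (isSign_wsgn q), ksgn_neg_right _ (isSign_wsgn q)]
    have := (isSign_wsgn q).mul_self
    simp only [← mul_assoc]
    linear_combination (ksgn (wsgn q) (x.sgn * y.sgn * wsgn t)) * (G (x.diff hd :: y :: (t ++ q)) +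
      x.sgn * G (x.mul y :: (t ++ q))) * this
  rw [rotN_eq_sum, bD_eq_sum, List.length_append, List.length_singleton, Finset.sum_range_succ,
    Finset.sum_range_succ, add_assoc]
  congr 1
  · refine Finset.sum_congr rfl fun j hj => ?_
    have hj' : j < q.length := Finset.mem_range.1 hj
    rw [List.take_append_of_le_length hj'.le, List.drop_append_of_le_length hj'.le]
    obtain ⟨x, t, hx⟩ := List.exists_cons_of_ne_nil (l := q.drop j) (by
      rw [Ne, List.drop_eq_nil_iff]; omega)
    obtain ⟨y, t', hy⟩ := List.exists_cons_of_ne_nil (l := t ++ [c]) (by simp)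
    rw [hx, List.cons_append, hy]
    exact key _ _ _ _
  · rw [List.take_left, List.drop_left]
    have hq := (isSign_wsgn q).mul_self
    have h0 : wsgn q * headD hd (fun r => G (q ++ r)) [c] =
        -(ksgn (wsgn q) c.sgn * G (c.diff hd :: q)) := by
      simp only [headD, hG' q, wsgn_cons, wsgn_nil, mul_one, Letter.diff_sgn,
        ksgn_neg_right _ (isSign_wsgn q), List.singleton_append]
      linear_combination -(ksgn (wsgn q) c.sgn * G (c.diff hd :: q)) * hq
    rw [h0]
    cases q with
    | nil => simp [headD, wrap]
    | cons a q =>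
      simp only [List.singleton_append, headD, wrap, smul_eq_mul, wsgn_cons, wsgn_nil, mul_one]
      ring

end Letters

/-! ## Connes' operator anticommutes with the Hochschild differential -/

section

variable {k : Type*} [Field k] {A : Type*} [Ring A] [Algebra k A]
  {𝒜 : ℤ → Submodule k A} [GradedAlgebra 𝒜] {d : A →ₗ[k] A}

theorem isLinearMap_dualLeft {φ : A → k} (hφ : IsLinearMap k φ) :
    IsLinearMap k fun a => dualLeft 𝒜 a φ :=
  isLinearMap_pi fun b => (isLinearMap_comp hφ (LinearMap.mulLeft k b ∘ₗ par 𝒜).isLinear :)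

theorem isLinearMap_dualRight {φ : A → k} (hφ : IsLinearMap k φ) :
    IsLinearMap k fun a => dualRight a φ :=
  isLinearMap_pi fun b => (isLinearMap_comp hφ (LinearMap.mulRight k b).isLinear :)

theorem isLinearMap_hat {f : List A → A → k} (hl : ∀ l, IsLinearMap k (f l)) (l : List A) :
    IsLinearMap k (hat 𝒜 (dualPar 𝒜) f l) :=
  (isLinearMap_comp (hl (wpar 𝒜 l)) (par 𝒜).isLinear :)

theorem Multilin.coD {f : List A → A → k} (hf : Multilin k f) (hl : ∀ l, IsLinearMap k (f l)) :
    Multilin k (coD 𝒜 d f) :=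
  hf.hochD (fun l => isLinearMap_dualLeft (hl l))
    (fun l => isLinearMap_dualLeft (isLinearMap_hat hl l))
    (fun l => isLinearMap_dualRight (isLinearMap_hat hl l))

theorem hat_coD (hd : IsDGA 𝒜 d) {f : List A → A → k} (hf : Multilin k f)
    (hl : ∀ l, IsLinearMap k (f l)) :
    hat 𝒜 (dualPar 𝒜) (coD 𝒜 d f) = -coD 𝒜 d (hat 𝒜 (dualPar 𝒜) f) := by
  refine hat_hochD hd dualPar_dualPar hf (fun l => ?_) (fun a φ => ?_) (fun a φ => ?_)
    (fun l => isLinearMap_dualLeft (hl l)) (fun l => isLinearMap_dualLeft (isLinearMap_hat hl l))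
    (fun l => isLinearMap_dualRight (hl l))
  · funext b
    change f l (par 𝒜 (d (par 𝒜 b))) = -f l (d (par 𝒜 (par 𝒜 b)))
    rw [par_par, hd.d_par, map_neg, (hl l).map_neg, par_par]
  · funext b
    change φ (par 𝒜 b * par 𝒜 a) = φ (par 𝒜 (b * par 𝒜 (par 𝒜 a)))
    rw [par_par, par_mul]
  · funext b
    change φ (a * par 𝒜 b) = φ (par 𝒜 (par 𝒜 a * b))
    rw [par_mul, par_par]

theorem isLinearMap_barD {f : List A → A → k} (hl : ∀ l, IsLinearMap k (f l)) (l : List A) :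
    IsLinearMap k (barD 𝒜 d f l) := by
  induction l generalizing f with
  | nil => exact (0 : A →ₗ[k] k).isLinear
  | cons a l ih =>
    cases l with
    | nil => exact isLinearMap_neg (hl _)
    | cons b l =>
      have h := ih (f := fun r => f (spar 𝒜 a :: r)) fun r => hl _
      exact isLinearMap_add (isLinearMap_add (isLinearMap_neg (hl (d a :: b :: l)))
        (hl ((par 𝒜 a * b) :: l))) h

theorem isLinearMap_coD {f : List A → A → k} (hl : ∀ l, IsLinearMap k (f l)) (l : List A) :
    IsLinearMap k (coD 𝒜 d f l) := by
  have h1 (a : A) {φ : A → k} (hφ : IsLinearMap k φ) : IsLinearMap k (dualLeft 𝒜 a φ) :=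
    (isLinearMap_comp hφ (LinearMap.mulRight k (par 𝒜 a)).isLinear :)
  have h2 (a : A) {φ : A → k} (hφ : IsLinearMap k φ) : IsLinearMap k (dualRight a φ) :=
    (isLinearMap_comp hφ (LinearMap.mulLeft k a).isLinear :)
  refine isLinearMap_add (isLinearMap_sub (isLinearMap_comp (hl l) (d ∘ₗ par 𝒜).isLinear :)
    (isLinearMap_barD (isLinearMap_hat hl) l)) ?_
  cases l with
  | nil => exact (0 : A →ₗ[k] k).isLinear
  | cons a l =>
    exact isLinearMap_sub (isLinearMap_smul _ (isLinearMap_sub (isLinearMap_add (isLinearMap_add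
      (h1 _ (hl _)) (h1 _ (hl _))) (h1 _ (isLinearMap_hat hl _))) (h1 _ (isLinearMap_hat hl _))))
      (h2 _ (isLinearMap_hat hl _))

theorem isLinearMap_connes {f : List A → A → k} (hf : Multilin k f) (l : List A) :
    IsLinearMap k (connes 𝒜 f l) := by
  have h := fun m : List A => (multilin_rotWord (𝒜 := 𝒜)
    (hf.hat (𝒜 := 𝒜) (σM := dualPar 𝒜))).head m
  exact isLinearMap_neg (isLinearMap_smul _ (isLinearMap_sub (isLinearMap_add (isLinearMap_add
    (h l) (isLinearMap_comp (h l) (par 𝒜).isLinear :)) (h (wpar 𝒜 l)))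
    (isLinearMap_comp (h (wpar 𝒜 l)) (par 𝒜).isLinear :)))

theorem Multilin.connes {f : List A → A → k} (hf : Multilin k f) :
    Multilin k (connes 𝒜 f) := by
  refine Multilin.pi fun a => ?_
  have h := fun x : A => (multilin_rotWord (𝒜 := 𝒜)
    (hf.hat (𝒜 := 𝒜) (σM := dualPar 𝒜))).cons x
  exact neg (smul _ ((((h a).add (h _)).add ((h a).wpar (𝒜 := 𝒜))).sub ((h _).wpar (𝒜 := 𝒜))))

variable [CharZero k]

theorem rotWord_wd {f : List A → A → k} (hf : Multilin k f) (w : List (Letter 𝒜)) :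
    rotWord (𝒜 := 𝒜) f (wd w) = rotN (fun r => f (wd r) 1) w := by
  have hlen : (wd w).length = w.length := by simp [wd]
  have ht (i : ℕ) : (wd w).take i = wd (w.take i) := by simp [wd]
  have hdr (i : ℕ) : (wd w).drop i = wd (w.drop i) := by simp [wd]
  have h1 := hf.apply 1
  rw [rotN_eq_sum, rotWord, hlen]
  refine Finset.sum_congr rfl fun i _ => ?_
  rw [ht, hdr, wd_append, ksgn_comm]
  generalize w.take i = v
  generalize w.drop i = u
  have e1 := (h1.append_right (wd v)).wpar_wd u
  have e2 := (h1.append_left (wd u)).wpar_wd v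
  have e3 := (h1.append_left (MCRep.wpar 𝒜 (wd u))).wpar_wd v
  refine koszul_of_eigen e1 e2 ?_
  rw [mul_comm, mul_smul, ← e1]
  exact e3

theorem connes_wd {f : List A → A → k} (hf : Multilin k f) {ε : k}
    (hε : hat 𝒜 (dualPar 𝒜) f = ε • f) (a : Letter 𝒜) (l : List (Letter 𝒜)) :
    connes 𝒜 f (wd l) a.val =
      -(ksgn (-a.sgn) (wsgn l) * (ε * rotN (fun r => f (wd r) 1) (a :: l))) := by
  have hm : Multilin k (ε • f) := hf.smul ε
  have hw := multilin_rotWord (𝒜 := 𝒜) hm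
  have e0 : rotWord (𝒜 := 𝒜) (ε • f) (wd (a :: l)) =
      ε * rotN (fun r => f (wd r) 1) (a :: l) := by
    rw [rotWord_wd hm, ← rotN_smul]; rfl
  have e1 : rotWord (𝒜 := 𝒜) (ε • f) (par 𝒜 a.val :: wd l) =
      (-a.sgn) • rotWord (𝒜 := 𝒜) (ε • f) (a.val :: wd l) := by
    rw [a.par_val, (hw.head _).map_smul]
  change -koszul k (par 𝒜) (wpar 𝒜)
      (fun x m => rotWord (𝒜 := 𝒜) (hat 𝒜 (dualPar 𝒜) f) (x :: m)) a.val (wd l) = _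
  rw [hε, koszul_of_eigen (c := -a.sgn) (e := wsgn l) e1 ((hw.cons a.val).wpar_wd l)
    (by rw [(hw.cons (par 𝒜 a.val)).wpar_wd l, e1, smul_smul, mul_comm])]
  rw [← wd_cons, e0, smul_eq_mul]

theorem bD_ksgn (hd : IsDGA 𝒜 d) {c : k} (hc : IsSign c) (F : List (Letter 𝒜) → k)
    (l : List (Letter 𝒜)) :
    bD hd (fun r => ksgn c (wsgn r) * F r) l = c * ksgn c (wsgn l) * bD hd F l := by
  rcases hc with rfl | rfl
  · simp
  · have := bD_wsgn hd F l
    simp only [smul_eq_mul] at this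
    simp [this]

theorem coD_wd (hd : IsDGA 𝒜 d) {f : List A → A → k} (hf : Multilin k f)
    (hl : ∀ l, IsLinearMap k (f l)) {ε : k} (hε : hat 𝒜 (dualPar 𝒜) f = ε • f)
    (l : List (Letter 𝒜)) :
    coD 𝒜 d f (wd l) = dualD 𝒜 d (f (wd l)) - ε • bD hd (fun r => f (wd r)) l +
      (actL (dualLeft 𝒜) ε (fun r => f (wd r)) l -
        ε • actR dualRight (fun r => f (wd r)) l) :=
  hochD_wd hd hf hε (fun l => isLinearMap_dualLeft (hl l)) l

/-- A nonzero scalar `f(l)(a)` forces `|f| + ‖l‖ + |a|` to be even. Stating this as an identity of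
multiples of the value avoids distinguishing whether it is zero. -/
theorem sign_mul_apply {f : List A → A → k} (hf : Multilin k f) (hl : ∀ l, IsLinearMap k (f l))
    {ε : k} (hε : hat 𝒜 (dualPar 𝒜) f = ε • f) (a : Letter 𝒜) (l : List (Letter 𝒜)) :
    ε * f (wd l) a.val = -(a.sgn * wsgn l) * f (wd l) a.val := by
  have h := congrFun (congrFun hε (wd l)) a.val
  change f (wpar 𝒜 (wd l)) (par 𝒜 a.val) = ε * f (wd l) a.val at h
  rw [← h, a.par_val, (hl _).map_smul, hf.wpar_wd]
  simp only [Pi.smul_apply, smul_eq_mul]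
  ring

/-- The cyclic sum over the values of `δ f` at `1` only involves the bar differential. -/
theorem rotN_coD (hd : IsDGA 𝒜 d) {f : List A → A → k} (hf : Multilin k f)
    (hl : ∀ l, IsLinearMap k (f l)) {ε : k} (hs : IsSign ε)
    (hε : hat 𝒜 (dualPar 𝒜) f = ε • f) (w : List (Letter 𝒜)) :
    rotN (fun r => coD 𝒜 d f (wd r) 1) w = -(ε * rotN (bD hd fun r => f (wd r) 1) w) := by
  let P (r : List (Letter 𝒜)) : k := actL (dualLeft 𝒜) ε (fun r => f (wd r)) r 1
  let Q (r : List (Letter 𝒜)) : k := ε * actR dualRight (fun r => f (wd r)) r 1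
  -- At `a₀ = 1` a left action term is the rotation of a right action term, so the two families
  -- cancel in the cyclic sum.
  have hPQ : P = rotL Q := by
    funext r
    cases r with
    | nil => simp [P, Q, rotL, actL, actR]
    | cons b l =>
      simp only [P, Q, rotL, actL, actR_concat, Pi.smul_apply, smul_eq_mul]
      change ksgn b.sgn ε * f (wd l) (1 * par 𝒜 b.val) =
        ksgn b.sgn (wsgn l) * (ε * (wsgn l * f (wd l) (b.val * 1)))
      rw [one_mul, mul_one, b.par_val, (hl _).map_smul, smul_eq_mul]
      have h := sign_mul_apply hf hl hε b l
      rcases hs with rfl | rfl <;> rcases b.isSign with h1 | h1 <;>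
      rcases isSign_wsgn l with h2 | h2 <;> rw [h1, h2] at h <;> simp [h1, h2] <;> grind
  have h0 (r : List (Letter 𝒜)) : coD 𝒜 d f (wd r) 1 =
      (-ε) * bD hd (fun r => f (wd r) 1) r + (P r + (-1) * Q r) := by
    rw [coD_wd hd hf hl hε]
    have : dualD 𝒜 d (f (wd r)) 1 = 0 := by
      change f (wd r) (d (par 𝒜 1)) = 0
      rw [par_one, hd.d_one, (hl _).map_zero]
    simp only [Pi.add_apply, Pi.sub_apply, Pi.smul_apply, this, bD_apply, smul_eq_mul, P, Q]
    ring
  simp only [h0]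
  rw [rotN_add, rotN_smul, rotN_add, rotN_smul, hPQ, rotN_rotL]
  ring

-- The sign bookkeeping of `coD_connes_of_sign` for a nonempty word `l = b :: l' = q ++ [c]`. Here
-- `v` is the sign of `l'`; `x`, `y`, `z` are values of the cyclic sum on words that begin with
-- `ab`, `ca`, `da`; and `t` is the bar differential of the tail. The hypotheses `hx`, `hy`, `hz`
-- say that these values vanish when parities do not match.
set_option maxHeartbeats 1000000 in
theorem boundary_signs {ε a b c v x y z t : k} (hs : IsSign ε) (ha : IsSign a) (hb : IsSign b)
    (hc : IsSign c) (hv : IsSign v) (hx : ε * x = -(a * b) * v * x)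
    (hy : ε * y = -(c * a) * (b * v * c) * y) (hz : ε * z = -a * (b * v) * z) :
    -a * (ksgn a (b * v) * (-ε * z)) - -ε * (-a * ksgn (-a) (b * v) * (-ε * t)) +
      (ksgn b (-ε) * (-b * (ksgn (a * b) v * (-ε * x))) -
        -ε * (b * v * c * (ksgn (c * a) (b * v * c) * (-ε * y)))) =
    - -(ksgn (-a) (b * v) * (-ε * -(ε * (-z - a * x + a * t +
      -(ksgn (a * (b * v * c)) c * c) * y)))) := by
  rcases hs with rfl | rfl <;> rcases ha with rfl | rfl <;> rcases hb with rfl | rfl <;>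
  rcases hc with rfl | rfl <;> rcases hv with rfl | rfl <;> simp <;> grind

/-- Up to sign, `B^* f` is the cyclic sum `G` of `f(·)(1)`. The differential of `A^*`, the bar terms
and the left action together give the bar differential of `G`, while the right action multiplies the
last letter by `a₀` and gives `wrap`. By `rotN_headD` and `rotN_headD_rotN` the total is the cyclic
sum of the bar differential of `f(·)(1)`, which is `B^* δ f` by `rotN_coD`. -/
theorem coD_connes_of_sign (hd : IsDGA 𝒜 d) {f : List A → A → k} (hf : Multilin k f)
    (hl : ∀ l, IsLinearMap k (f l)) {ε : k} (hs : IsSign ε)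
    (hε : hat 𝒜 (dualPar 𝒜) f = ε • f) :
    coD 𝒜 d (connes 𝒜 f) = -connes 𝒜 (coD 𝒜 d f) := by
  have hε' : hat 𝒜 (dualPar 𝒜) (connes 𝒜 f) = (-ε) • connes 𝒜 f := by
    rw [hat_connes hf, hε, map_smul, neg_smul]
  have hε'' : hat 𝒜 (dualPar 𝒜) (coD 𝒜 d f) = (-ε) • coD 𝒜 d f := by
    rw [hat_coD hd hf hl, hε, map_smul, neg_smul]
  have hc := isLinearMap_connes (𝒜 := 𝒜) hf
  have hcD := isLinearMap_coD (𝒜 := 𝒜) (d := d) hl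
  refine (hf.connes.coD hc).ext_letters (𝒜 := 𝒜) (hf.coD hl).connes.neg fun l => ?_
  have hext {φ ψ : A → k} (hφ : IsLinearMap k φ) (hψ : IsLinearMap k ψ)
      (h : ∀ a : Letter 𝒜, φ a.val = ψ a.val) : φ = ψ := by
    have := LinearMap.ext_on_range (v := (Letter.val : Letter 𝒜 → A)) (f := hφ.mk' φ)
      (g := hψ.mk' ψ) span_letters h
    exact funext fun a => LinearMap.congr_fun this a
  refine hext (isLinearMap_coD hc _) (isLinearMap_neg (isLinearMap_connes (hf.coD hl) _))
    fun a => ?_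
  change coD 𝒜 d (connes 𝒜 f) (wd l) a.val = -connes 𝒜 (coD 𝒜 d f) (wd l) a.val
  rw [connes_wd (hf.coD hl) hε'', rotN_coD hd hf hl hs hε, coD_wd hd hf.connes hc hε',
    ← rotN_headD_rotN]
  set G := rotN (fun r : List (Letter 𝒜) => f (wd r) 1) with hG
  have hGrot : rotL G = G := rotL_rotN _
  -- The cyclic sum inherits the parity constraint of a scalar-valued function: it vanishes unless
  -- the sign of the word is `ε`.
  have hGs (w : List (Letter 𝒜)) : ε * G w = wsgn w * G w := by
    rw [hG, ← rotN_smul, ← rotN_wsgn]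
    refine rotN_congr w fun w' _ => ?_
    have h := congrFun (congrFun hε (wd w')) 1
    change f (wpar 𝒜 (wd w')) (par 𝒜 1) = ε * f (wd w') 1 at h
    rw [← h, par_one, hf.wpar_wd]; rfl
  have hcw (b : Letter 𝒜) (r : List (Letter 𝒜)) : connes 𝒜 f (wd r) b.val =
      ksgn (-b.sgn) (wsgn r) * ((-ε) * G (b :: r)) := by
    rw [connes_wd hf hε]; ring
  have hT1 : dualD 𝒜 d (connes 𝒜 f (wd l)) a.val =
      -a.sgn * (ksgn a.sgn (wsgn l) * ((-ε) * G (a.diff hd :: l))) := by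
    change connes 𝒜 f (wd l) (d (par 𝒜 a.val)) = _
    rw [a.par_val, map_smul, (hc _).map_smul, ← Letter.diff_val hd, hcw, Letter.diff_sgn, neg_neg]
    rfl
  have hT2 : bD hd (fun r => connes 𝒜 f (wd r)) l a.val =
      -a.sgn * ksgn (-a.sgn) (wsgn l) * ((-ε) * bD hd (fun r => G (a :: r)) l) := by
    rw [bD_apply]
    simp only [hcw]
    rw [bD_ksgn hd a.isSign.neg, ← smul_eq_mul (-ε), ← bD_smul]
    rfl
  simp only [Pi.add_apply, Pi.sub_apply, Pi.smul_apply, smul_eq_mul, hT1, hT2]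
  -- For the empty word `a₀` has no neighbours, so no products occur. Otherwise `l` is decomposed at
  -- both ends, since `a₀` is multiplied with its first and with its last letter.
  rcases List.eq_nil_or_concat' l with rfl | ⟨q, c, hq⟩
  · have h := rotN_headD hd hGrot [] a
    simp only [List.nil_append, wrap] at h
    have h' := hGs [a.diff hd]
    simp only [wsgn_cons, wsgn_nil, Letter.diff_sgn] at h'
    rw [h]
    simp only [bD, headD, actL, actR, wsgn_nil, ksgn_one_right, Pi.zero_apply]
    rcases hs with rfl | rfl <;> rcases a.isSign with h1 | h1 <;> rw [h1] at h' <;>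
      simp [h1] <;> grind
  · have h := rotN_headD hd hGrot (a :: q) c
    rw [List.cons_append, ← hq] at h
    rw [h]
    have hR : actR dualRight (fun r => connes 𝒜 f (wd r)) l a.val =
        wsgn q * (ksgn (c.sgn * a.sgn) (wsgn q) * ((-ε) * G (c.mul a :: q))) := by
      rw [hq, actR_concat]
      change wsgn q * connes 𝒜 f (wd q) (c.val * a.val) = _
      rw [← Letter.mul_val, hcw, Letter.mul_sgn, neg_neg]
    have hGc := hGs (c.mul a :: q)
    have hGd := hGs (a.diff hd :: l)
    have hlq : wsgn l = wsgn q * c.sgn := by rw [hq]; simp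
    obtain ⟨b, l', hl'⟩ := List.exists_cons_of_ne_nil (l := l) (by rw [hq]; simp)
    have hL : actL (dualLeft 𝒜) (-ε) (fun r => connes 𝒜 f (wd r)) l a.val =
        ksgn b.sgn (-ε) * (-b.sgn * (ksgn (a.sgn * b.sgn) (wsgn l') *
          ((-ε) * G (a.mul b :: l')))) := by
      rw [hl', actL]
      change ksgn b.sgn (-ε) * connes 𝒜 f (wd l') (a.val * par 𝒜 b.val) = _
      rw [b.par_val, mul_smul_comm, (hc _).map_smul, ← Letter.mul_val, hcw, Letter.mul_sgn, neg_neg,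
        smul_eq_mul]
    have hGm := hGs (a.mul b :: l')
    have hlb : wsgn l = b.sgn * wsgn l' := by rw [hl']; simp
    have hbD : bD hd G (a :: l) = -G (a.diff hd :: l) - a.sgn * G (a.mul b :: l') +
        a.sgn * bD hd (fun r => G (a :: r)) l := by
      rw [bD, hl']; rfl
    rw [hR, hL, hbD, wrap]
    have hwl' := isSign_wsgn l'
    simp only [wsgn_cons, Letter.diff_sgn, Letter.mul_sgn] at hGc hGd hGm
    rw [hlb] at hlq
    rw [hlb] at hGd ⊢
    have hc' := c.isSign
    have hu : wsgn q = b.sgn * wsgn l' * c.sgn := by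
      rw [hlq, mul_assoc, hc'.mul_self, mul_one]
    rw [hu] at hGc ⊢
    exact boundary_signs hs a.isSign b.isSign hc' hwl' hGm hGc hGd

theorem coD_connes (hd : IsDGA 𝒜 d) {f : List A → A → k} (hf : Multilin k f)
    (hl : ∀ l, IsLinearMap k (f l)) : coD 𝒜 d (connes 𝒜 f) = -connes 𝒜 (coD 𝒜 d f) := by
  obtain ⟨e, h1, h2⟩ := exists_add_of_hat (𝒜 := 𝒜) (σM := dualPar 𝒜) dualPar_dualPar f
  have hm1 : Multilin k ((2⁻¹ : k) • (f + hat 𝒜 (dualPar 𝒜) f)) := (hf.add hf.hat).smul _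
  have hm2 : Multilin k ((2⁻¹ : k) • (f - hat 𝒜 (dualPar 𝒜) f)) := (hf.sub hf.hat).smul _
  have hl1 : ∀ l, IsLinearMap k (((2⁻¹ : k) • (f + hat 𝒜 (dualPar 𝒜) f)) l) := fun l =>
    isLinearMap_smul _ (isLinearMap_add (hl l) (isLinearMap_hat hl l))
  have hl2 : ∀ l, IsLinearMap k (((2⁻¹ : k) • (f - hat 𝒜 (dualPar 𝒜) f)) l) := fun l =>
    isLinearMap_smul _ (isLinearMap_sub (hl l) (isLinearMap_hat hl l))
  rw [e, map_add, map_add, map_add, map_add, neg_add,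
    coD_connes_of_sign hd hm1 hl1 isSign_one h1, coD_connes_of_sign hd hm2 hl2 isSign_neg_one h2]

theorem coD_connes_of_mem (hd : IsDGA 𝒜 d) {f : List A → A → k}
    (hf : f ∈ cochains 𝒜 (dualGrading 𝒜)) : coD 𝒜 d (connes 𝒜 f) = -connes 𝒜 (coD 𝒜 d f) :=
  coD_connes hd (multilin_of_mem_cochains hf) (isLinearMap_of_mem_cochains hf)

theorem induces_connes (hd : IsDGA 𝒜 d) :
    Induces (coZ 𝒜 d) (coB 𝒜 d) (coZ 𝒜 d) (coB 𝒜 d) (connes 𝒜) := by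
  refine ⟨fun f hf => ⟨connes_mem_cochains hf.1, ?_⟩, fun f _ g _ h => ?_⟩
  · change coD 𝒜 d (connes 𝒜 f) = 0
    rw [coD_connes_of_mem hd hf.1, LinearMap.mem_ker.1 hf.2, map_zero, neg_zero]
  · obtain ⟨w, hw, hw'⟩ := h
    exact ⟨-connes 𝒜 w, neg_mem (connes_mem_cochains hw), by
      rw [map_neg, coD_connes_of_mem hd hw, neg_neg, hw', map_sub]⟩

theorem cycD_single (f : List A → A → k) :
    cycD 𝒜 d (Pi.single 0 f) = Pi.single 0 (coD 𝒜 d f) := by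
  funext i
  change coD 𝒜 d ((Pi.single 0 f : ℕ → List A → A → k) i) +
    connes 𝒜 ((Pi.single 0 f : ℕ → List A → A → k) (i + 1)) = _
  cases i <;> simp

theorem single_mem_cyc {f : List A → A → k} (hf : f ∈ cochains 𝒜 (dualGrading 𝒜)) :
    Pi.single 0 f ∈ cyc 𝒜 := by
  refine ⟨fun i => ?_, 0, fun i hi => ?_⟩
  · cases i
    · simpa using hf
    · simp
  · simp [Pi.single_eq_of_ne hi.ne']

theorem induces_single :
    Induces (coZ 𝒜 d) (coB 𝒜 d) (cycZ 𝒜 d) (cycB 𝒜 d) (fun f => Pi.single 0 f) := by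
  refine ⟨fun f hf => ⟨single_mem_cyc hf.1, ?_⟩, fun f _ g _ h => ?_⟩
  · change cycD 𝒜 d (Pi.single 0 f) = 0
    rw [cycD_single, LinearMap.mem_ker.1 hf.2, Pi.single_zero]
  · obtain ⟨w, hw, hw'⟩ := h
    exact ⟨Pi.single 0 w, single_mem_cyc hw, by rw [cycD_single, hw', Pi.single_sub]⟩

/-- The lowest coefficient of the cocycle condition is `δ α₀ = -B^* α₁`. Hence `δ B^* α₀ = -B^* δ α₀
= B^* B^* α₁ = 0`, and similarly `B^*` of the lowest coefficient of a boundary is `-δ B^* w₀`. -/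
theorem induces_connes_zero (hd : IsDGA 𝒜 d) :
    Induces (cycZ 𝒜 d) (cycB 𝒜 d) (coZ 𝒜 d) (coB 𝒜 d) (fun α => connes 𝒜 (α 0)) := by
  refine ⟨fun α hα => ⟨connes_mem_cochains (hα.1.1 0), ?_⟩, fun α _ β _ h => ?_⟩
  · have h : coD 𝒜 d (α 0) + connes 𝒜 (α 1) = 0 := congrFun (LinearMap.mem_ker.1 hα.2) 0
    change coD 𝒜 d (connes 𝒜 (α 0)) = 0
    rw [coD_connes_of_mem hd (hα.1.1 0), eq_neg_of_add_eq_zero_left h, map_neg,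
      connes_connes (hα.1.1 1), neg_zero, neg_zero]
  · obtain ⟨w, hw, hw'⟩ := h
    have h : coD 𝒜 d (w 0) + connes 𝒜 (w 1) = α 0 - β 0 := congrFun hw' 0
    refine ⟨-connes 𝒜 (w 0), neg_mem (connes_mem_cochains (hw.1 0)), ?_⟩
    rw [← map_sub, ← h, map_add, connes_connes (hw.1 1), add_zero, map_neg,
      coD_connes_of_mem hd (hw.1 0), neg_neg]

end

theorem structureMapsWellDefined {k : Type*} [RCLike k] {A : Type*} [Ring A] [Algebra k A]
    {𝒜 : ℤ → Submodule k A} [GradedAlgebra 𝒜] {d : A →ₗ[k] A} (hd : IsDGA 𝒜 d)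
    {Tr : A →ₗ[k] k} (hTr : IsSymmetricTrace 𝒜 d Tr) : StructureMapsWellDefined 𝒜 d Tr :=
  ⟨induces₂_cup hd, induces_omegaSharp hd hTr, induces_connes hd, induces_single,
    induces_connes_zero hd⟩

/-! ## The Lie bracket on negative cyclic cohomology -/

section

variable {k : Type*} [Field k] [CharZero k] {A : Type*} [Ring A] [Algebra k A]
  {𝒜 : ℤ → Submodule k A} [GradedAlgebra 𝒜] {d : A →ₗ[k] A} {Tr : A →ₗ[k] k}

theorem isLinearMap_mapB (hd : IsDGA 𝒜 d) : IsLinearMap k (mapB 𝒜 d) :=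
  (induces_connes_zero hd).isLinearMap (fun x _ y _ => map_add (connes 𝒜) (x 0) (y 0))
    fun c x _ => map_smul (connes 𝒜) c (x 0)

theorem isLinearMap_mapI : IsLinearMap k (mapI 𝒜 d) :=
  induces_single.isLinearMap (fun x _ y _ => by funext i; cases i <;> simp)
    fun c x _ => by funext i; cases i <;> simp

theorem isLinearMap_omegaHH (hd : IsDGA 𝒜 d) (hTr : IsSymmetricTrace 𝒜 d Tr) :
    IsLinearMap k (omegaHH 𝒜 d Tr) :=
  (induces_omegaSharp hd hTr).isLinearMap
    (fun x _ y _ => by funext l b; simp [omegaSharp, omega, add_mul])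
    fun c x _ => by funext l b; simp [omegaSharp, omega]

theorem isLinearMap_omegaHH_symm (hd : IsDGA 𝒜 d) (hTr : IsSymmetricTrace 𝒜 d Tr)
    (hω : Function.Bijective (omegaHH 𝒜 d Tr)) :
    IsLinearMap k (Equiv.ofBijective _ hω).symm :=
  ⟨fun x y => by
    rw [Equiv.symm_apply_eq, Equiv.ofBijective_apply, (isLinearMap_omegaHH hd hTr).map_add,
      Equiv.ofBijective_apply_symm_apply (omegaHH 𝒜 d Tr) hω, Equiv.ofBijective_apply_symm_apply (omegaHH 𝒜 d Tr) hω], fun c x => by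
    rw [Equiv.symm_apply_eq, Equiv.ofBijective_apply, (isLinearMap_omegaHH hd hTr).map_smul,
      Equiv.ofBijective_apply_symm_apply (omegaHH 𝒜 d Tr) hω]⟩

theorem isLinearMap_sqcup_left (hd : IsDGA 𝒜 d) (hTr : IsSymmetricTrace 𝒜 d Tr)
    (hω : Function.Bijective (omegaHH 𝒜 d Tr)) (y : HHdual 𝒜 d) :
    IsLinearMap k fun x => sqcup 𝒜 d Tr hω x y := by
  have h := (induces₂_cup hd).isLinearMap_left (fun x _ y _ w _ => cup_add_left x y w)
    (fun c x _ w _ => cup_smul_left c x w) ((Equiv.ofBijective _ hω).symm y)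
  exact (isLinearMap_comp (isLinearMap_omegaHH hd hTr)
    (isLinearMap_comp h (isLinearMap_omegaHH_symm hd hTr hω)) :)

theorem isLinearMap_sqcup_right (hd : IsDGA 𝒜 d) (hTr : IsSymmetricTrace 𝒜 d Tr)
    (hω : Function.Bijective (omegaHH 𝒜 d Tr)) (x : HHdual 𝒜 d) :
    IsLinearMap k fun y => sqcup 𝒜 d Tr hω x y := by
  have h := (induces₂_cup hd).isLinearMap_right (fun x _ y _ w _ => cup_add_right x y w)
    (fun c x _ w _ => cup_smul_right c x w) ((Equiv.ofBijective _ hω).symm x)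
  exact (isLinearMap_comp (isLinearMap_omegaHH hd hTr)
    (isLinearMap_comp h (isLinearMap_omegaHH_symm hd hTr hω)) :)

theorem mapB_mapI (hd : IsDGA 𝒜 d) (x : HHdual 𝒜 d) : mapB 𝒜 d (mapI 𝒜 d x) = Delta 𝒜 d x := by
  obtain ⟨z, rfl⟩ := cls_surjective x
  rw [mapB, mapI, Delta, induces_single.induced_cls, (induces_connes_zero hd).induced_cls,
    (induces_connes hd).induced_cls]
  simp

/-- For a cocycle `z` the total differential of `z v⁻¹` is `B^* z` in the `v⁰` part; thus `B^* z`
becomes exact in the cyclic complex. -/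
theorem mapI_Delta (hd : IsDGA 𝒜 d) (x : HHdual 𝒜 d) : mapI 𝒜 d (Delta 𝒜 d x) = 0 := by
  obtain ⟨z, rfl⟩ := cls_surjective x
  rw [mapI, Delta, (induces_connes hd).induced_cls, induces_single.induced_cls]
  refine (cls_eq_cls (w := 0)).2 ⟨Pi.single 1 z, ⟨fun i => ?_, 1, fun i hi => ?_⟩, ?_⟩
  · rcases eq_or_ne i 1 with rfl | h
    · simpa using z.2.1
    · simp [h]
  · simp [hi.ne']
  · have hz : coD 𝒜 d z = 0 := z.2.2
    funext i
    change coD 𝒜 d ((Pi.single 1 (z : List A → A → k) : ℕ → List A → A → k) i) +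
      connes 𝒜 ((Pi.single 1 (z : List A → A → k) : ℕ → List A → A → k) (i + 1)) = _
    rcases i with _ | _ | i <;> simp [hz]

theorem Delta_mapB (hd : IsDGA 𝒜 d) (x : HC 𝒜 d) : Delta 𝒜 d (mapB 𝒜 d x) = 0 := by
  obtain ⟨z, rfl⟩ := cls_surjective x
  rw [mapB, Delta, (induces_connes_zero hd).induced_cls, (induces_connes hd).induced_cls]
  refine (cls_eq_cls (w := 0)).2 ?_
  simp [connes_connes (z.2.1.1 0)]

theorem connes_mem_odd {f : List A → A → k} (hf : f ∈ parityCochains 𝒜 (dualGrading 𝒜) 0) :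
    connes 𝒜 f ∈ parityCochains 𝒜 (dualGrading 𝒜) 1 := by
  have hc := parityCochains_le_cochains _ hf
  refine mem_odd_of_hat (connes_mem_cochains hc) (σM := dualPar 𝒜) (fun i m hm => dualPar_of_mem hm) ?_
  rw [hat_connes (multilin_of_mem_cochains hc), hat_of_even hf fun i m hm => dualPar_of_mem hm]

theorem mem_HCeven {x : HC 𝒜 d} : x ∈ HCeven 𝒜 d ↔
    ∃ z : cycZ 𝒜 d, (z : ℕ → List A → A → k) ∈ cycZeven 𝒜 d ∧ cls (cycB 𝒜 d) z = x := Iff.rfl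

theorem hasParity_mapB (hd : IsDGA 𝒜 d) {x : HC 𝒜 d} (hx : x ∈ HCeven 𝒜 d) :
    HasParity 𝒜 d 1 (mapB 𝒜 d x) := by
  obtain ⟨z, hz, rfl⟩ := mem_HCeven.1 hx
  refine ⟨⟨connes 𝒜 ((z : ℕ → List A → A → k) 0), (induces_connes_zero hd).1 z z.2⟩, ?_, ?_⟩
  · simpa using connes_mem_odd (hz.2 0 trivial)
  · rw [mapB, (induces_connes_zero hd).induced_cls]

/-- An odd cocycle `z` of `C(A, A^*)` is cohomologous to `ω ∘ f` for an odd cocycle `f`. -/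
theorem exists_odd_cocycle (hd : IsDGA 𝒜 d) (hTr : IsSymmetricTrace 𝒜 d Tr)
    (hω : Function.Surjective (omegaHH 𝒜 d Tr)) (z : coZ 𝒜 d)
    (hz : (z : List A → A → k) ∈ parityCochains 𝒜 (dualGrading 𝒜) 1) :
    ∃ f : selfZ 𝒜 d, (f : List A → A) ∈ parityCochains 𝒜 𝒜 1 ∧
      omegaSharp Tr f - z ∈ coB 𝒜 d := by
  obtain ⟨x, hx⟩ := hω (cls (coB 𝒜 d) z)
  obtain ⟨f, rfl⟩ := cls_surjective x
  rw [omegaHH, (induces_omegaSharp hd hTr).induced_cls] at hx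
  obtain ⟨w, hw, hw'⟩ := cls_eq_cls.1 hx
  change coD 𝒜 d w = omegaSharp Tr f - z at hw'
  obtain ⟨f₀, h0, f₁, h1, hf⟩ := exists_parity_decomposition f.2.1
  have hc0 := parityCochains_le_cochains _ h0
  have hc1 := parityCochains_le_cochains _ h1
  have hσ : ∀ i, ∀ m ∈ 𝒜 i, par 𝒜 m = ((i.negOnePow : ℤˣ) : ℤ) • m := fun i m => par_of_mem 𝒜
  have hσ' : ∀ i, ∀ m ∈ dualGrading 𝒜 i, dualPar 𝒜 m = ((i.negOnePow : ℤˣ) : ℤ) • m :=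
    fun i m => dualPar_of_mem
  have e0 := hat_of_even h0 hσ
  have e1 := hat_of_odd h1 hσ
  have hfD : selfD 𝒜 d f₀ + selfD 𝒜 d f₁ = 0 := by rw [← map_add, ← hf]; exact f.2.2
  -- The sign involution changes the relative sign of the differentials of the even and the odd
  -- part, so each of them vanishes.
  have hfD' : -selfD 𝒜 d f₀ + selfD 𝒜 d f₁ = 0 := by
    have h := congrArg (hat 𝒜 (par 𝒜)) hfD
    rw [hat_add, hat_selfD hd (multilin_of_mem_cochains hc0),
      hat_selfD hd (multilin_of_mem_cochains hc1), e0, e1, map_neg, neg_neg] at h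
    rw [h]; funext l; simp [hat]
  have hD1 : selfD 𝒜 d f₁ = 0 := by
    have : (2 : k) • selfD 𝒜 d f₁ = 0 := by
      have := congrArg₂ (· + ·) hfD hfD'
      simp only [add_zero] at this
      rw [← this]; module
    exact (smul_eq_zero.1 this).resolve_left two_ne_zero
  have hadd (f g : List A → A) : omegaSharp Tr (f + g) = omegaSharp Tr f + omegaSharp Tr g := by
    funext l b; simp [omegaSharp, omega, add_mul]
  have hneg (f : List A → A) : omegaSharp Tr (-f) = -omegaSharp Tr f := by
    funext l b; simp [omegaSharp, omega]
  rw [hf, hadd] at hw'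
  have hw2 := congrArg (hat 𝒜 (dualPar 𝒜)) hw'
  rw [hat_coD hd (multilin_of_mem_cochains hw) (isLinearMap_of_mem_cochains hw), hat_sub, hat_add,
    hat_omegaSharp hTr, hat_omegaSharp hTr, e0, e1, hneg, hat_of_odd hz hσ'] at hw2
  -- Averaging `w` with its image under the involution removes the even part `f₀` from the boundary
  -- equation.
  refine ⟨⟨f₁, hc1, hD1⟩, h1, (2⁻¹ : k) • (w + hat 𝒜 (dualPar 𝒜) w),
    Submodule.smul_mem _ _ (add_mem hw (hat_mem_cochains hw fun i m hm => dualPar_mem hm)), ?_⟩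
  have hw3 : coD 𝒜 d (hat 𝒜 (dualPar 𝒜) w) =
      -(omegaSharp Tr f₀ + -omegaSharp Tr f₁ - -(z : List A → A → k)) := by rw [← hw2, neg_neg]
  rw [map_smul, map_add, hw', hw3]
  module

theorem sqcup_cls (hd : IsDGA 𝒜 d) (hTr : IsSymmetricTrace 𝒜 d Tr)
    (hω : Function.Bijective (omegaHH 𝒜 d Tr)) {z w : coZ 𝒜 d} {f g : selfZ 𝒜 d}
    (hf : omegaSharp Tr f - z ∈ coB 𝒜 d) (hg : omegaSharp Tr g - w ∈ coB 𝒜 d) :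
    sqcup 𝒜 d Tr hω (cls (coB 𝒜 d) z) (cls (coB 𝒜 d) w) =
      cls (coB 𝒜 d) ⟨omegaSharp Tr (cup 𝒜 f g),
        (induces_omegaSharp hd hTr).1 _ ((induces₂_cup hd).1 f f.2 g g.2)⟩ := by
  have e1 : (Equiv.ofBijective _ hω).symm (cls (coB 𝒜 d) z) = cls (selfB 𝒜 d) f := by
    rw [Equiv.symm_apply_eq, Equiv.ofBijective_apply, omegaHH,
      (induces_omegaSharp hd hTr).induced_cls]
    exact (cls_eq_cls.2 hf).symm
  have e2 : (Equiv.ofBijective _ hω).symm (cls (coB 𝒜 d) w) = cls (selfB 𝒜 d) g := by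
    rw [Equiv.symm_apply_eq, Equiv.ofBijective_apply, omegaHH,
      (induces_omegaSharp hd hTr).induced_cls]
    exact (cls_eq_cls.2 hg).symm
  rw [sqcup, e1, e2, cupHH, (induces₂_cup hd).induced₂_cls, omegaHH,
    (induces_omegaSharp hd hTr).induced_cls]

theorem hasParity_sqcup (hd : IsDGA 𝒜 d) (hTr : IsSymmetricTrace 𝒜 d Tr)
    (hω : Function.Bijective (omegaHH 𝒜 d Tr)) {x y : HHdual 𝒜 d} (hx : HasParity 𝒜 d 1 x)
    (hy : HasParity 𝒜 d 1 y) : HasParity 𝒜 d 0 (sqcup 𝒜 d Tr hω x y) := by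
  obtain ⟨z, hz, rfl⟩ := hx
  obtain ⟨w, hw, rfl⟩ := hy
  obtain ⟨f, hf, hfz⟩ := exists_odd_cocycle hd hTr hω.2 z (by simpa using hz)
  obtain ⟨g, hg, hgw⟩ := exists_odd_cocycle hd hTr hω.2 w (by simpa using hw)
  have hσ : ∀ i, ∀ m ∈ 𝒜 i, par 𝒜 m = ((i.negOnePow : ℤˣ) : ℤ) • m := fun i m => par_of_mem 𝒜
  have hc := (induces₂_cup hd).1 f f.2 g g.2
  refine ⟨_, ?_, (sqcup_cls hd hTr hω hfz hgw).symm⟩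
  refine mem_even_of_hat (omegaSharp_mem_cochains hTr hc.1) (σM := dualPar 𝒜)
    (fun i m hm => dualPar_of_mem hm) ?_
  change hat 𝒜 (dualPar 𝒜) (omegaSharp Tr (cup 𝒜 f g)) = omegaSharp Tr (cup 𝒜 f g)
  rw [hat_omegaSharp hTr, hat_cup, hat_of_odd hf hσ, hat_of_odd hg hσ,
    ← neg_one_smul k (f : List A → A), ← neg_one_smul k (g : List A → A), cup_smul_left,
    cup_smul_right, smul_smul]
  simp

theorem mapI_mem_HCeven {x : HHdual 𝒜 d} (hx : HasParity 𝒜 d 0 x) : mapI 𝒜 d x ∈ HCeven 𝒜 d := by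
  obtain ⟨z, hz, rfl⟩ := hx
  rw [mapI, induces_single.induced_cls]
  refine mem_HCeven.2 ⟨_, ⟨Subtype.property _, fun i _ => ?_⟩, rfl⟩
  cases i
  · simpa using hz
  · simp

theorem cycBracket_mem_HCeven (hd : IsDGA 𝒜 d) (hTr : IsSymmetricTrace 𝒜 d Tr)
    (hω : Function.Bijective (omegaHH 𝒜 d Tr)) (x y : HCeven 𝒜 d) :
    cycBracket 𝒜 d Tr hω x y ∈ HCeven 𝒜 d :=
  mapI_mem_HCeven (hasParity_sqcup hd hTr hω (hasParity_mapB hd x.2) (hasParity_mapB hd y.2))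

/-- The bracket `I(𝓑 x ⊔ 𝓑 y)` on `HC_-^{2•}(A)`. -/
def evenBracket (hd : IsDGA 𝒜 d) (hTr : IsSymmetricTrace 𝒜 d Tr)
    (hω : Function.Bijective (omegaHH 𝒜 d Tr)) : HCeven 𝒜 d →ₗ[k] HCeven 𝒜 d →ₗ[k] HCeven 𝒜 d :=
  LinearMap.mk₂ k (fun x y => ⟨cycBracket 𝒜 d Tr hω x y, cycBracket_mem_HCeven hd hTr hω x y⟩)
    (fun x x' y => Subtype.ext (by
      simp only [cycBracket, Submodule.coe_add, (isLinearMap_mapB hd).map_add,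
        (isLinearMap_sqcup_left hd hTr hω _).map_add, isLinearMap_mapI.map_add]))
    (fun c x y => Subtype.ext (by
      simp only [cycBracket, Submodule.coe_smul, (isLinearMap_mapB hd).map_smul,
        (isLinearMap_sqcup_left hd hTr hω _).map_smul, isLinearMap_mapI.map_smul]))
    (fun x y y' => Subtype.ext (by
      simp only [cycBracket, Submodule.coe_add, (isLinearMap_mapB hd).map_add,
        (isLinearMap_sqcup_right hd hTr hω _).map_add, isLinearMap_mapI.map_add]))
    (fun c x y => Subtype.ext (by
      simp only [cycBracket, Submodule.coe_smul, (isLinearMap_mapB hd).map_smul,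
        (isLinearMap_sqcup_right hd hTr hω _).map_smul, isLinearMap_mapI.map_smul]))

/-- Classes `𝓑 x` of even `x` are odd, so graded commutativity makes their product antisymmetric.
They are also killed by `Δ`, so the BV bracket of two of them is `-Δ(𝓑 x ⊔ 𝓑 y)`, and nested
brackets are expressed through `𝓑 I = Δ`. -/
theorem isLieBracket_evenBracket (hd : IsDGA 𝒜 d) (hTr : IsSymmetricTrace 𝒜 d Tr)
    (hω : Function.Bijective (omegaHH 𝒜 d Tr)) (hBV : IsBVAlgebra 𝒜 d Tr hω) :
    IsLieBracket (evenBracket hd hTr hω) := by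
  refine ⟨fun x => Subtype.ext ?_, fun x y z => Subtype.ext ?_⟩
  · change mapI 𝒜 d (sqcup 𝒜 d Tr hω (mapB 𝒜 d x) (mapB 𝒜 d x)) = 0
    have hx := hasParity_mapB hd x.2
    have h := hBV.comm 1 1 _ _ hx hx
    have h2 : (2 : k) • sqcup 𝒜 d Tr hω (mapB 𝒜 d x) (mapB 𝒜 d x) = 0 := by
      rw [two_smul]
      nth_rewrite 2 [h]
      simp
    rw [(smul_eq_zero.1 h2).resolve_left two_ne_zero, isLinearMap_mapI.map_zero]
  · change cycBracket 𝒜 d Tr hω x (cycBracket 𝒜 d Tr hω y z) =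
      cycBracket 𝒜 d Tr hω (cycBracket 𝒜 d Tr hω x y) z +
        cycBracket 𝒜 d Tr hω y (cycBracket 𝒜 d Tr hω x z)
    simp only [cycBracket, mapB_mapI hd]
    have h := hBV.deriv_right 1 1 1 _ _ _ (hasParity_mapB hd x.2) (hasParity_mapB hd y.2)
      (hasParity_mapB hd z.2)
    simp only [bvBracket, Delta_mapB hd, (isLinearMap_sqcup_left hd hTr hω _).map_zero,
      (isLinearMap_sqcup_right hd hTr hω _).map_zero] at h
    rw [show (-1 : k) ^ ((1 + 1) * 1) = 1 by norm_num] at h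
    simp only [pow_one, neg_one_smul, one_smul, neg_zero, sub_zero,
      (isLinearMap_sqcup_left hd hTr hω _).map_neg,
      (isLinearMap_sqcup_right hd hTr hω _).map_neg] at h
    -- Applying `I` to the derivation rule kills `Δ` of the triple product, and the three remaining
    -- terms form the Jacobi identity.
    let J := isLinearMap_mapI.mk' (mapI 𝒜 d)
    have hJ (x : HHdual 𝒜 d) : J (Delta 𝒜 d x) = 0 := mapI_Delta hd x
    have h' := congrArg J h
    rw [map_sub, map_add, map_neg, map_neg, map_neg, hJ, neg_zero, zero_sub, ← neg_add,
      neg_inj] at h'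
    exact h'

end

/-! ## Calculus of polynomial maps -/

section Pol

universe u v w w' w''

variable {k : Type u} [RCLike k] {V : Type v} [AddCommGroup V] [Module k V]
  {U : Type w} [AddCommGroup U] [Module k U] {U' : Type w'} [AddCommGroup U'] [Module k U']
  {U'' : Type w''} [AddCommGroup U''] [Module k U'']

theorem Pol.of_multilinear {n : ℕ} (f : MultilinearMap k (fun _ : Fin n => V) U) :
    (fun a => f fun _ => a) ∈ Pol k V U := Submodule.subset_span ⟨n, f, rfl⟩

theorem Pol.induction {P : (V → U) → Prop}
    (h : ∀ (n : ℕ) (f : MultilinearMap k (fun _ : Fin n => V) U), P fun a => f fun _ => a)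
    (zero : P 0) (add : ∀ p q, P p → P q → P (p + q)) (smul : ∀ (c : k) p, P p → P (c • p))
    {p : V → U} (hp : p ∈ Pol k V U) : P p := by
  refine Submodule.span_induction (p := fun p _ => P p) ?_ zero (fun p q _ _ => add p q)
    (fun c p _ => smul c p) hp
  rintro _ ⟨n, f, rfl⟩
  exact h n f

theorem Pol.const (c : U) : (fun _ => c) ∈ Pol k V U :=
  Pol.of_multilinear (MultilinearMap.constOfIsEmpty k (fun _ : Fin 0 => V) c)

theorem Pol.linear (T : V →ₗ[k] U) : (fun a => T a) ∈ Pol k V U :=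
  Pol.of_multilinear (MultilinearMap.ofSubsingleton k V U (0 : Fin 1) T)

theorem Pol.id : (fun a => a) ∈ Pol k V V := Pol.linear LinearMap.id

theorem Pol.comp {p : V → U} (T : U →ₗ[k] U') (hp : p ∈ Pol k V U) :
    (fun a => T (p a)) ∈ Pol k V U' := by
  refine Pol.induction (P := fun p => (fun a => T (p a)) ∈ Pol k V U') (fun n f => ?_) ?_
    (fun p q h1 h2 => ?_) (fun c p h => ?_) hp
  · exact Pol.of_multilinear (T.compMultilinearMap f)
  · simpa using Pol.const (0 : U')
  · simpa [← Pi.add_def] using add_mem h1 h2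
  · simpa [← Pi.smul_def] using Submodule.smul_mem _ c h

theorem Pol.bilin {p : V → U} {q : V → U'} (B : U →ₗ[k] U' →ₗ[k] U'') (hp : p ∈ Pol k V U)
    (hq : q ∈ Pol k V U') : (fun a => B (p a) (q a)) ∈ Pol k V U'' := by
  refine Pol.induction (P := fun p => (fun a => B (p a) (q a)) ∈ Pol k V U'') (fun n f => ?_) ?_
    (fun p q h1 h2 => ?_) (fun c p h => ?_) hp
  · refine Pol.induction (P := fun q => (fun a => B (f fun _ => a) (q a)) ∈ Pol k V U'')
      (fun m g => ?_) ?_ (fun p q h1 h2 => ?_) (fun c p h => ?_) hq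
    · exact Pol.of_multilinear
        ((TensorProduct.lift B).compMultilinearMap ((f.domCoprod g).domDomCongr finSumFinEquiv))
    · simpa using Pol.const (0 : U'')
    · simpa [← Pi.add_def] using add_mem h1 h2
    · simpa [← Pi.smul_def] using Submodule.smul_mem _ c h
  · simpa using Pol.const (0 : U'')
  · simpa [← Pi.add_def] using add_mem h1 h2
  · simpa [← Pi.smul_def] using Submodule.smul_mem _ c h

theorem Pol.eval {g : V → U →ₗ[k] U'} {p : V → U} (hg : g ∈ Pol k V (U →ₗ[k] U'))
    (hp : p ∈ Pol k V U) : (fun a => g a (p a)) ∈ Pol k V U' :=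
  Pol.bilin LinearMap.id hg hp

theorem Pol.add {p q : V → U} (hp : p ∈ Pol k V U) (hq : q ∈ Pol k V U) :
    (fun a => p a + q a) ∈ Pol k V U := add_mem hp hq

theorem Pol.smul {c : V → k} {p : V → U} (hc : c ∈ Pol k V k) (hp : p ∈ Pol k V U) :
    (fun a => c a • p a) ∈ Pol k V U := Pol.bilin (LinearMap.lsmul k U) hc hp

/-- Only needed for the remainder in `IsPD`, a function of one scalar variable; `V` itself carries
no topology. On the line a diagonal multilinear map is a monomial. -/
theorem Pol.continuous {p : k → k} (hp : p ∈ Pol k k k) : Continuous p := by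
  refine Pol.induction (P := fun p : k → k => Continuous p) (fun n f => ?_) continuous_const
    (fun p q h1 h2 => h1.add h2) (fun c p h => h.const_smul c) hp
  have h (t : k) : (f fun _ => t) = t ^ n * f fun _ => 1 := by
    have := f.map_smul_univ (fun _ => t) (fun _ => 1)
    simpa using this
  exact (funext h : (fun t : k => f fun _ => t) = _) ▸ (by fun_prop : Continuous fun t : k => t ^ n * f fun _ => 1)

/-- `p'` is the derivative of the polynomial map `p`: `p (a + tZ) = p(a) + t p'(a)(Z) + O(t²)`. -/
def IsPD (p : V → U) (p' : V → V →ₗ[k] U) : Prop :=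
  ∀ a Z, ∃ r ∈ Pol k k U, ∀ t : k, p (a + t • Z) = p a + t • p' a Z + (t * t) • r t

theorem IsPD.const (c : U) : IsPD (fun _ : V => c) (0 : V → V →ₗ[k] U) := fun a Z =>
  ⟨0, zero_mem _, fun t => by simp⟩

theorem IsPD.linear (T : V →ₗ[k] U) : IsPD (fun a => T a) (fun _ => T) := fun a Z =>
  ⟨0, zero_mem _, fun t => by simp⟩

theorem IsPD.add {p q : V → U} {p' q' : V → V →ₗ[k] U} (hp : IsPD p p') (hq : IsPD q q') :
    IsPD (fun a => p a + q a) (fun a => p' a + q' a) := fun a Z => by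
  obtain ⟨r, hr, h⟩ := hp a Z
  obtain ⟨s, hs, h'⟩ := hq a Z
  refine ⟨r + s, add_mem hr hs, fun t => ?_⟩
  simp only [h, h', Pi.add_apply, LinearMap.add_apply]
  module

theorem IsPD.comp {p : V → U} {p' : V → V →ₗ[k] U} (T : U →ₗ[k] U') (hp : IsPD p p') :
    IsPD (fun a => T (p a)) (fun a => T ∘ₗ p' a) := fun a Z => by
  obtain ⟨r, hr, h⟩ := hp a Z
  refine ⟨fun t => T (r t), Pol.comp T hr, fun t => ?_⟩
  simp [h]

theorem IsPD.bilin {p : V → U} {q : V → U'} {p' : V → V →ₗ[k] U} {q' : V → V →ₗ[k] U'}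
    (B : U →ₗ[k] U' →ₗ[k] U'') (hp : IsPD p p') (hq : IsPD q q') :
    IsPD (fun a => B (p a) (q a)) (fun a => B.flip (q a) ∘ₗ p' a + B (p a) ∘ₗ q' a) := fun a Z => by
  obtain ⟨r, hr, h⟩ := hp a Z
  obtain ⟨s, hs, h'⟩ := hq a Z
  refine ⟨fun t => B (p' a Z) (q' a Z) + B (p a) (s t) + B (r t) (q a) +
    t • (B (p' a Z) (s t) + B (r t) (q' a Z) + t • B (r t) (s t)), ?_, fun t => ?_⟩
  · have c1 := Pol.const (k := k) (V := k) (p' a Z)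
    have c2 := Pol.const (k := k) (V := k) (q' a Z)
    exact Pol.add (Pol.add (Pol.add (Pol.const _) (Pol.bilin B (Pol.const _) hs))
      (Pol.bilin B hr (Pol.const _))) (Pol.smul Pol.id (Pol.add (Pol.add (Pol.bilin B c1 hs)
      (Pol.bilin B hr c2)) (Pol.smul Pol.id (Pol.bilin B hr hs))))
  · simp only [h, h', map_add, map_smul, LinearMap.add_apply, LinearMap.smul_apply,
      LinearMap.comp_apply, LinearMap.flip_apply]
    module

theorem IsPD.eval {g : V → U →ₗ[k] U'} {p : V → U} {g' : V → V →ₗ[k] U →ₗ[k] U'}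
    {p' : V → V →ₗ[k] U} (hg : IsPD g g') (hp : IsPD p p') :
    IsPD (fun a => g a (p a)) (fun a => (g' a).flip (p a) + g a ∘ₗ p' a) :=
  hg.bilin LinearMap.id hp

theorem IsPD.hasDerivAt {p : V → k} {p' : V → V →ₗ[k] k} (hp : IsPD p p') (a Z : V) :
    HasDerivAt (fun t : k => p (a + t • Z)) (p' a Z) 0 := by
  obtain ⟨r, hr, h⟩ := hp a Z
  have hr' := (Pol.continuous hr).continuousAt (x := 0)
  rw [hasDerivAt_iff_tendsto_slope_zero]
  have h2 : Filter.Tendsto (fun t : k => p' a Z + t * r t) (nhdsWithin 0 {0}ᶜ) (nhds (p' a Z)) := by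
    have h3 : ContinuousAt (fun t : k => p' a Z + t * r t) 0 :=
      continuousAt_const.add (continuousAt_id.mul hr')
    have h4 := h3.tendsto
    rw [zero_mul, add_zero] at h4
    exact h4.mono_left nhdsWithin_le_nhds
  refine h2.congr' ?_
  filter_upwards [self_mem_nhdsWithin] with t ht
  have ht' : t ≠ 0 := ht
  simp only [zero_add, h, zero_smul, add_zero, smul_eq_mul]
  field_simp
  ring

theorem IsPD.eq_of_hasDerivAt {p : V → k} {p' : V → V →ₗ[k] k} (hp : IsPD p p') {a Z : V} {c : k}
    (h : HasDerivAt (fun t : k => p (a + t • Z)) c 0) : p' a Z = c := (hp.hasDerivAt a Z).unique h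

/-- `U` has no topology, so the two derivatives are compared after composing with linear
functionals, where uniqueness of a scalar derivative applies. -/
theorem IsPD.unique {p : V → U} {p' q' : V → V →ₗ[k] U} (hp : IsPD p p') (hq : IsPD p q') :
    p' = q' := by
  funext a
  ext Z
  rw [← sub_eq_zero, ← Module.forall_dual_apply_eq_zero_iff k]
  intro φ
  rw [map_sub, sub_eq_zero]
  exact ((hp.comp φ).hasDerivAt a Z).unique ((hq.comp φ).hasDerivAt a Z)

/-- `p` has polynomial first and second derivatives, and the second derivative is symmetric. -/
def IsTwicePD (p : V → U) : Prop :=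
  ∃ p' ∈ Pol k V (V →ₗ[k] U), ∃ p'' ∈ Pol k V (V →ₗ[k] V →ₗ[k] U), IsPD p p' ∧ IsPD p' p'' ∧
    ∀ a Z W, p'' a Z W = p'' a W Z

theorem IsTwicePD.comp {p : V → U} (T : U →ₗ[k] U') (hp : IsTwicePD (k := k) p) :
    IsTwicePD (k := k) fun a => T (p a) := by
  obtain ⟨p', h1, p'', h2, h3, h4, h5⟩ := hp
  exact ⟨_, Pol.comp (LinearMap.compRight k T) h1, _,
    Pol.comp (LinearMap.compRight k (LinearMap.compRight k T)) h2, h3.comp T,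
    h4.comp (LinearMap.compRight k T), fun a Z W => congrArg T (h5 a Z W)⟩

theorem IsTwicePD.add {p q : V → U} (hp : IsTwicePD (k := k) p) (hq : IsTwicePD (k := k) q) :
    IsTwicePD (k := k) fun a => p a + q a := by
  obtain ⟨p', h1, p'', h2, h3, h4, h5⟩ := hp
  obtain ⟨q', i1, q'', i2, i3, i4, i5⟩ := hq
  exact ⟨_, Pol.add h1 i1, _, Pol.add h2 i2, h3.add i3, h4.add i4, fun a Z W => by
    simp only [LinearMap.add_apply, h5 a Z W, i5 a Z W]⟩

theorem isTwicePD_const (c : U) : IsTwicePD (k := k) fun _ : V => c :=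
  ⟨0, zero_mem _, 0, zero_mem _, IsPD.const _, IsPD.const _, fun _ _ _ => rfl⟩

/-- Induction on the degree through `f(a, …, a) = g(a)(a)`, where `g` has lower degree and values in
`V →ₗ U`. The second derivative is `g''(Z)(W)(a) + g'(W)(Z) + g'(Z)(W)`, symmetric if `g''` is. The
target changes in the induction, so it must range over a universe that contains that of `V`. -/
theorem isTwicePD_of_multilinear_of_max {n : ℕ} :
    ∀ {U : Type (max v w)} [AddCommGroup U] [Module k U]
      (f : MultilinearMap k (fun _ : Fin n => V) U), IsTwicePD (k := k) fun a => f fun _ => a := by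
  induction n with
  | zero =>
    intro U _ _ f
    have e (a : V) : (f fun _ => a) = f 0 := congrArg f (Subsingleton.elim _ _)
    simp only [e]
    exact isTwicePD_const _
  | succ n ih =>
    intro U _ _ f
    obtain ⟨g', h1, g'', h2, h3, h4, h5⟩ := ih f.curryRight
    set g : V → V →ₗ[k] U := fun a => f.curryRight fun _ => a with hg
    have hgP : g ∈ Pol k V (V →ₗ[k] U) := Pol.of_multilinear f.curryRight
    have e : (fun a => f fun _ => a) = fun a => g a a := by
      funext a
      simp only [hg, MultilinearMap.curryRight_apply]
      congr 1
      funext i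
      refine Fin.lastCases ?_ (fun i => ?_) i <;> simp
    rw [e]
    let F : (V →ₗ[k] V →ₗ[k] U) →ₗ[k] V →ₗ[k] V →ₗ[k] U := (LinearMap.lflip (R₀ := k)).toLinearMap
    let F' : (V →ₗ[k] V →ₗ[k] V →ₗ[k] U) →ₗ[k] V →ₗ[k] V →ₗ[k] V →ₗ[k] U :=
      (LinearMap.lflip (R₀ := k)).toLinearMap
    have e1 := h3.eval (IsPD.linear (LinearMap.id (R := k) (M := V)))
    have e2 := ((h4.comp F).eval (IsPD.linear (LinearMap.id (R := k) (M := V)))).add h3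
    refine ⟨fun a => F (g' a) a + g a, Pol.add (Pol.eval (Pol.comp F h1) Pol.id) hgP, _, ?_, e1, e2,
      fun a Z W => ?_⟩
    · let F'' : (V →ₗ[k] V →ₗ[k] V →ₗ[k] U) →ₗ[k] V →ₗ[k] V →ₗ[k] V →ₗ[k] U :=
        LinearMap.compRight k F
      have h6 := Pol.comp (U' := V →ₗ[k] V →ₗ[k] V →ₗ[k] U) F'
        (Pol.comp (U' := V →ₗ[k] V →ₗ[k] V →ₗ[k] U) F'' h2)
      exact Pol.add (Pol.add (Pol.eval h6 Pol.id)
        (Pol.comp F h1)) h1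
    · change g'' a Z W a + g' a W Z + g' a Z W = g'' a W Z a + g' a Z W + g' a W Z
      rw [h5 a Z W]
      abel

theorem isTwicePD_of_mem {p : V → U} (hp : p ∈ Pol k V U) : IsTwicePD (k := k) p := by
  refine Pol.induction (P := fun p => IsTwicePD (k := k) p) (fun n f => ?_) (isTwicePD_const 0)
    (fun p q h1 h2 => h1.add h2) (fun c p h => h.comp (LinearMap.lsmul k U c)) hp
  -- The lift puts an arbitrary target into the universe required by the induction, and composing
  -- with its inverse returns to `U`.
  let e : ULift.{v} U ≃ₗ[k] U := ULift.moduleEquiv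
  exact (isTwicePD_of_multilinear_of_max (e.symm.toLinearMap.compMultilinearMap f)).comp
    e.toLinearMap

theorem exists_isPD {p : V → U} (hp : p ∈ Pol k V U) : ∃ p' ∈ Pol k V (V →ₗ[k] U), IsPD p p' := by
  obtain ⟨p', h1, _, _, h3, _⟩ := isTwicePD_of_mem hp
  exact ⟨p', h1, h3⟩

/-- The derivative of the derivative of a polynomial map is symmetric. -/
theorem IsPD.symm {p : V → U} {p' : V → V →ₗ[k] U} {p'' : V → V →ₗ[k] V →ₗ[k] U}
    (hp : p ∈ Pol k V U) (h : IsPD p p') (h' : IsPD p' p'') (a Z W : V) :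
    p'' a Z W = p'' a W Z := by
  obtain ⟨q', _, q'', _, h3, h4, h5⟩ := isTwicePD_of_mem hp
  obtain rfl := h.unique h3
  obtain rfl := h'.unique h4
  exact h5 a Z W

end Pol

section Flip

variable {k : Type*} [RCLike k] {V U U' U'' : Type*} [AddCommGroup V] [Module k V]
  [AddCommGroup U] [Module k U] [AddCommGroup U'] [Module k U'] [AddCommGroup U''] [Module k U'']

theorem Pol.flip {g : V → U →ₗ[k] U' →ₗ[k] U''} (hg : g ∈ Pol k V (U →ₗ[k] U' →ₗ[k] U'')) :
    (fun a => (g a).flip) ∈ Pol k V (U' →ₗ[k] U →ₗ[k] U'') := by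
  let F : (U →ₗ[k] U' →ₗ[k] U'') →ₗ[k] U' →ₗ[k] U →ₗ[k] U'' :=
    (LinearMap.lflip (R₀ := k)).toLinearMap
  exact Pol.comp (U' := U' →ₗ[k] U →ₗ[k] U'') F hg

theorem IsPD.congr {p : V → U} {p' q' : V → V →ₗ[k] U} (h : IsPD p p')
    (e : ∀ a Z, p' a Z = q' a Z) : IsPD p q' := by
  obtain rfl : p' = q' := funext fun a => LinearMap.ext (e a)
  exact h

theorem IsPD.sub {p q : V → U} {p' q' : V → V →ₗ[k] U} (hp : IsPD p p') (hq : IsPD q q') :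
    IsPD (fun a => p a - q a) (fun a => p' a - q' a) := by
  have h := (hp.add (hq.comp (-LinearMap.id))).congr (q' := fun a => p' a - q' a)
    fun a Z => by simp [sub_eq_add_neg]
  simpa only [LinearMap.neg_apply, LinearMap.id_apply, ← sub_eq_add_neg] using h

end Flip

/-! ## Poisson geometry of the Maurer-Cartan scheme -/

section Poisson

variable {k : Type*} [RCLike k] {A : Type*} [Ring A] [Algebra k A]
  {𝒜 : ℤ → Submodule k A} {d : A →ₗ[k] A} {Tr : A →ₗ[k] k}
  {U U' : Type*} [AddCommGroup U] [Module k U] [AddCommGroup U'] [Module k U']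

variable (𝒜) in
/-- The product of two odd elements. -/
def oddMul : OddPart 𝒜 →ₗ[k] OddPart 𝒜 →ₗ[k] A :=
  (LinearMap.mul k A).compl₁₂ (OddPart 𝒜).subtype (OddPart 𝒜).subtype

variable (𝒜 d) in
/-- The twisted differential as a linear map on odd elements. -/
def twLin (a : OddPart 𝒜) : OddPart 𝒜 →ₗ[k] A :=
  d ∘ₗ (OddPart 𝒜).subtype + (oddMul 𝒜 a + (oddMul 𝒜).flip a)

theorem twLin_apply (a y : OddPart 𝒜) : twLin 𝒜 d a y = twD 𝒜 d a y := rfl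

variable (𝒜 Tr) in
/-- The symplectic form `Tr(xy)` on odd elements. -/
def trForm : OddPart 𝒜 →ₗ[k] OddPart 𝒜 →ₗ[k] k := (oddMul 𝒜).compr₂ Tr

theorem trForm_apply (x y : OddPart 𝒜) : trForm 𝒜 Tr x y = Tr ((x : A) * y) := rfl

theorem isPD_curv : IsPD (curv 𝒜 d) (twLin 𝒜 d) := by
  have h := (IsPD.linear (d ∘ₗ (OddPart 𝒜).subtype)).add
    (IsPD.bilin (oddMul 𝒜) (IsPD.linear LinearMap.id) (IsPD.linear LinearMap.id))
  exact h.congr fun a y => by simp [twLin, add_comm]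

theorem isPD_twLin : IsPD (twLin 𝒜 d) (fun _ => oddMul 𝒜 + (oddMul 𝒜).flip) := by
  have h := (IsPD.const (V := OddPart 𝒜) (d ∘ₗ (OddPart 𝒜).subtype)).add
    ((IsPD.linear (oddMul 𝒜)).add (IsPD.linear (oddMul 𝒜).flip))
  exact h.congr fun a y => by simp

theorem mem_vanish {f : OddPart 𝒜 → U} : f ∈ vanish 𝒜 d U ↔
    ∃ G ∈ Pol k (OddPart 𝒜) (A →ₗ[k] U), (fun a => G a (curv 𝒜 d a)) = f := Iff.rfl

theorem vanish.comp {f : OddPart 𝒜 → U} (T : U →ₗ[k] U') (hf : f ∈ vanish 𝒜 d U) :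
    (fun a => T (f a)) ∈ vanish 𝒜 d U' := by
  obtain ⟨G, hG, rfl⟩ := mem_vanish.1 hf
  exact ⟨_, Pol.comp (LinearMap.compRight k T) hG, rfl⟩

theorem vanish.eval_right {g : OddPart 𝒜 → U →ₗ[k] U'} {f : OddPart 𝒜 → U}
    (hg : g ∈ Pol k (OddPart 𝒜) (U →ₗ[k] U')) (hf : f ∈ vanish 𝒜 d U) :
    (fun a => g a (f a)) ∈ vanish 𝒜 d U' := by
  obtain ⟨G, hG, rfl⟩ := mem_vanish.1 hf
  exact ⟨_, Pol.bilin (LinearMap.llcomp k A U U') hg hG, rfl⟩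

theorem vanish.eval_left {g : OddPart 𝒜 → U →ₗ[k] U'} {p : OddPart 𝒜 → U}
    (hg : g ∈ vanish 𝒜 d (U →ₗ[k] U')) (hp : p ∈ Pol k (OddPart 𝒜) U) :
    (fun a => g a (p a)) ∈ vanish 𝒜 d U' := by
  obtain ⟨G, hG, rfl⟩ := mem_vanish.1 hg
  exact ⟨_, Pol.eval (Pol.flip hG) hp, rfl⟩

theorem vanish.flip {U'' : Type*} [AddCommGroup U''] [Module k U'']
    {g : OddPart 𝒜 → U →ₗ[k] U' →ₗ[k] U''} (hg : g ∈ vanish 𝒜 d (U →ₗ[k] U' →ₗ[k] U'')) :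
    (fun a => (g a).flip) ∈ vanish 𝒜 d (U' →ₗ[k] U →ₗ[k] U'') := by
  let F : (U →ₗ[k] U' →ₗ[k] U'') →ₗ[k] U' →ₗ[k] U →ₗ[k] U'' :=
    (LinearMap.lflip (R₀ := k)).toLinearMap
  exact vanish.comp (U' := U' →ₗ[k] U →ₗ[k] U'') F hg

variable (𝒜 d) in
/-- The one-forms on `A^{odd}` whose restriction to the Maurer-Cartan scheme vanishes. -/
def conormal : Submodule k (OddPart 𝒜 → OddPart 𝒜 →ₗ[k] k) :=
  (Pol k (OddPart 𝒜) (A →ₗ[k] k)).map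
    ({ toFun := fun H a => H a ∘ₗ twLin 𝒜 d a
       map_add' := fun _ _ => rfl
       map_smul' := fun _ _ => rfl } :
      (OddPart 𝒜 → A →ₗ[k] k) →ₗ[k] (OddPart 𝒜 → OddPart 𝒜 →ₗ[k] k)) ⊔
    vanish 𝒜 d (OddPart 𝒜 →ₗ[k] k)

theorem mem_conormal {F : OddPart 𝒜 → OddPart 𝒜 →ₗ[k] k} : F ∈ conormal 𝒜 d ↔
    ∃ H ∈ Pol k (OddPart 𝒜) (A →ₗ[k] k), ∃ K ∈ vanish 𝒜 d (OddPart 𝒜 →ₗ[k] k),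
      ∀ a, F a = H a ∘ₗ twLin 𝒜 d a + K a := by
  rw [conormal, Submodule.mem_sup]
  constructor
  · rintro ⟨_, ⟨H, hH, rfl⟩, K, hK, rfl⟩
    exact ⟨H, hH, K, hK, fun a => rfl⟩
  · rintro ⟨H, hH, K, hK, h⟩
    exact ⟨_, ⟨H, hH, rfl⟩, K, hK, funext fun a => (h a).symm⟩

variable (𝒜 d) in
/-- A polynomial vector field tangent to the Maurer-Cartan scheme. -/
def IsTangent (Y : OddPart 𝒜 → OddPart 𝒜) : Prop :=
  Y ∈ Pol k (OddPart 𝒜) (OddPart 𝒜) ∧ (fun a => twD 𝒜 d a (Y a)) ∈ vanish 𝒜 d A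

theorem conormal_apply {F : OddPart 𝒜 → OddPart 𝒜 →ₗ[k] k} (hF : F ∈ conormal 𝒜 d)
    {Y : OddPart 𝒜 → OddPart 𝒜} (hY : IsTangent 𝒜 d Y) :
    (fun a => F a (Y a)) ∈ vanish 𝒜 d k := by
  obtain ⟨H, hH, K, hK, h⟩ := mem_conormal.1 hF
  simp only [h]
  have h1 := vanish.eval_right hH hY.2
  exact add_mem h1 (vanish.eval_left hK hY.1)

/-- The differential of a function that vanishes on the scheme vanishes on tangent vectors. -/
theorem conormal_of_vanish {p : OddPart 𝒜 → k} {p' : OddPart 𝒜 → OddPart 𝒜 →ₗ[k] k}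
    (hp : p ∈ vanish 𝒜 d k) (h : IsPD p p') : p' ∈ conormal 𝒜 d := by
  obtain ⟨G, hG, rfl⟩ := mem_vanish.1 hp
  obtain ⟨G', hG', hGG'⟩ := exists_isPD hG
  obtain rfl := h.unique (hGG'.eval isPD_curv)
  -- The product rule for `G(a)(da + a · a)`: the term with `G` contains `d_a`, and the term with
  -- the derivative of `G` vanishes with the curvature.
  exact mem_conormal.2 ⟨G, hG, _, ⟨_, Pol.flip hG', rfl⟩, fun a => add_comm _ _⟩

/-- The exterior derivative of a one-form that vanishes on the scheme vanishes on pairs of tangent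
vectors. -/
theorem conormal_exterior {F : OddPart 𝒜 → OddPart 𝒜 →ₗ[k] k}
    {F' : OddPart 𝒜 → OddPart 𝒜 →ₗ[k] OddPart 𝒜 →ₗ[k] k} (hF : F ∈ conormal 𝒜 d)
    (hFF' : IsPD F F') {Y : OddPart 𝒜 → OddPart 𝒜} (hY : IsTangent 𝒜 d Y) :
    (fun a => (F' a).flip (Y a) - F' a (Y a)) ∈ conormal 𝒜 d := by
  obtain ⟨H, hH, K, hK, h⟩ := mem_conormal.1 hF
  obtain ⟨L, hL, rfl⟩ := mem_vanish.1 hK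
  obtain ⟨H', hH', hHH'⟩ := exists_isPD hH
  obtain ⟨L', hL', hLL'⟩ := exists_isPD hL
  obtain rfl : F = fun a => H a ∘ₗ twLin 𝒜 d a + L a (curv 𝒜 d a) := funext h
  obtain rfl := hFF'.unique ((IsPD.bilin (LinearMap.llcomp k (OddPart 𝒜) A k) hHH' isPD_twLin).add
    (hLL'.eval isPD_curv))
  have hc : curv 𝒜 d ∈ vanish 𝒜 d A := ⟨_, Pol.const LinearMap.id, rfl⟩
  -- In the antisymmetrized derivative of `H ∘ d_a + L(curv)` the second derivative of the curvature
  -- cancels, being symmetric. The terms containing `d_a W` form the first component; the others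
  -- contain the curvature or `d_a Y` and vanish on the scheme.
  refine mem_conormal.2 ⟨fun a => (L a).flip (Y a) - H' a (Y a),
    sub_mem (Pol.eval (Pol.flip hL) hY.1) (Pol.eval hH' hY.1),
    fun a => (H' a).flip (twD 𝒜 d a (Y a)) + ((L' a).flip (curv 𝒜 d a)).flip (Y a) -
      L' a (Y a) (curv 𝒜 d a) - L a (twD 𝒜 d a (Y a)), ?_, fun a => ?_⟩
  · have h1 := vanish.eval_right (Pol.flip hH') hY.2
    have h2 := vanish.eval_left (vanish.flip (vanish.eval_right (Pol.flip hL') hc)) hY.1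
    have h3 := vanish.eval_right (Pol.eval hL' hY.1) hc
    have h4 := vanish.eval_right hL hY.2
    exact sub_mem (sub_mem (add_mem h1 h2) h3) h4
  · refine LinearMap.ext fun W => ?_
    simp [← twLin_apply]
    abel

variable [GradedAlgebra 𝒜]

theorem trForm_antisymm (hTr : IsSymmetricTrace 𝒜 d Tr) (x y : OddPart 𝒜) :
    trForm 𝒜 Tr x y = -trForm 𝒜 Tr y x := by
  rw [trForm_apply, trForm_apply, hTr.mul_comm, par_of_odd 𝒜 x.2, mul_neg, map_neg]

/-- Replaces the analytic derivative by an algebraic one, so that the Hamilton equation becomes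
membership in the subspace `conormal`, which can be differentiated and contracted. -/
theorem isHamiltonianField_iff {ψ : OddPart 𝒜 → k} {ψ' : OddPart 𝒜 → OddPart 𝒜 →ₗ[k] k}
    (h : IsPD ψ ψ') {X : OddPart 𝒜 → OddPart 𝒜} : IsHamiltonianField 𝒜 d Tr ψ X ↔
      IsTangent 𝒜 d X ∧ (fun a => ψ' a - trForm 𝒜 Tr (X a)) ∈ conormal 𝒜 d := by
  constructor
  · rintro ⟨h1, h2, H, hH, K, hK, h3⟩
    refine ⟨⟨h1, h2⟩, mem_conormal.2 ⟨H, hH, K, hK, fun a => LinearMap.ext fun Y => ?_⟩⟩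
    rw [LinearMap.sub_apply, h.eq_of_hasDerivAt (h3 a Y), trForm_apply, LinearMap.add_apply,
      LinearMap.comp_apply, twLin_apply]
    ring
  · rintro ⟨⟨h1, h2⟩, h3⟩
    obtain ⟨H, hH, K, hK, h4⟩ := mem_conormal.1 h3
    refine ⟨h1, h2, H, hH, K, hK, fun a Y => ?_⟩
    convert h.hasDerivAt a Y using 1
    have h5 := LinearMap.congr_fun (h4 a) Y
    rw [LinearMap.sub_apply, trForm_apply, LinearMap.add_apply, LinearMap.comp_apply,
      twLin_apply] at h5
    linear_combination -h5

/-- The curvature is covariant: `d_a ξ_x = [x, da + a · a]`, a multiple of the curvature. -/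
theorem isTangent_gauge (hd : IsDGA 𝒜 d) (x : parityPart 𝒜 0) :
    IsTangent 𝒜 d (gauge 𝒜 hd x) := by
  constructor
  · let L : OddPart 𝒜 →ₗ[k] OddPart 𝒜 :=
      { toFun := fun a => gauge 𝒜 hd x a - gauge 𝒜 hd x 0
        map_add' := fun a b => Subtype.ext (by simp [gauge, mul_add, add_mul]; abel)
        map_smul' := fun c a => Subtype.ext (by simp [gauge, smul_sub]) }
    have h := Pol.add (Pol.linear L) (Pol.const (gauge 𝒜 hd x 0))
    simpa [L] using h
  · refine ⟨_, Pol.const (LinearMap.mulLeft k (x : A) - LinearMap.mulRight k (x : A)),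
      funext fun a => ?_⟩
    have h1 := hd.d_mul (x : A) a
    have h2 := hd.d_mul (a : A) x
    rw [par_of_even 𝒜 x.2] at h1
    rw [par_of_odd 𝒜 a.2] at h2
    simp only [LinearMap.coe_mk, AddHom.coe_mk, LinearMap.sub_apply, LinearMap.mulLeft_apply,
      LinearMap.mulRight_apply, curv, twD, gauge, map_sub, h1, h2, hd.square]
    noncomm_ring

/-- Polynomial functions with a Hamiltonian vector field are gauge invariant. -/
theorem IsHamiltonianField.mem_invariants (hd : IsDGA 𝒜 d) (hTr : IsSymmetricTrace 𝒜 d Tr)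
    {ψ : OddPart 𝒜 → k} {X : OddPart 𝒜 → OddPart 𝒜} (hψ : ψ ∈ Pol k (OddPart 𝒜) k)
    (hX : IsHamiltonianField 𝒜 d Tr ψ X) : ψ ∈ invariants 𝒜 hd := by
  refine ⟨hψ, fun x => ?_⟩
  obtain ⟨ψ', _, h⟩ := exists_isPD hψ
  obtain ⟨h1, h2⟩ := (isHamiltonianField_iff h).1 hX
  refine ⟨fun a => ψ' a (gauge 𝒜 hd x a), ?_, fun a => h.hasDerivAt a _⟩
  have h3 := conormal_apply h2 (isTangent_gauge hd x)
  -- Integration by parts and cyclicity give `Tr(X ξ_x) = -Tr(d_a X · x)`, which vanishes on the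
  -- scheme because `X` is tangent.
  have h4 := vanish.comp (Tr ∘ₗ LinearMap.mulRight k (x : A)) h1.2
  convert sub_mem h3 h4 using 1
  funext a
  have e1 : Tr (d ((X a : A) * x)) = 0 := hTr.closed _
  rw [hd.d_mul, par_of_odd 𝒜 (X a).2] at e1
  have e2 : Tr ((a : A) * ((X a : A) * x)) = Tr ((X a : A) * x * -(a : A)) := by
    rw [hTr.mul_comm, par_of_odd 𝒜 a.2]
  simp only [Pi.sub_apply, LinearMap.sub_apply, trForm_apply, LinearMap.comp_apply,
    LinearMap.mulRight_apply, twD, gauge, mul_sub, map_add, map_sub] at e1 e2 ⊢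
  simp only [mul_assoc, mul_neg, neg_mul, map_neg] at e1 e2 ⊢
  linear_combination e1 + e2

theorem IsHamiltonianField.isTangent {ψ : OddPart 𝒜 → k} {X : OddPart 𝒜 → OddPart 𝒜}
    (hX : IsHamiltonianField 𝒜 d Tr ψ X) : IsTangent 𝒜 d X := ⟨hX.poly, hX.tangent⟩

/-- The derivative of a Hamiltonian vector field is symmetric for the symplectic form. -/
theorem IsHamiltonianField.symm {ψ : OddPart 𝒜 → k} {X : OddPart 𝒜 → OddPart 𝒜}
    (hψ : ψ ∈ Pol k (OddPart 𝒜) k) (hX : IsHamiltonianField 𝒜 d Tr ψ X)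
    {X' : OddPart 𝒜 → OddPart 𝒜 →ₗ[k] OddPart 𝒜} (hXX' : IsPD X X')
    {Y : OddPart 𝒜 → OddPart 𝒜} (hY : IsTangent 𝒜 d Y) :
    (fun a => (trForm 𝒜 Tr).flip (Y a) ∘ₗ X' a - trForm 𝒜 Tr (X' a (Y a))) ∈ conormal 𝒜 d := by
  obtain ⟨ψ', hψ', h⟩ := exists_isPD hψ
  obtain ⟨ψ'', _, h'⟩ := exists_isPD hψ'
  obtain ⟨h1, h2⟩ := (isHamiltonianField_iff h).1 hX
  have h3 : IsPD (fun a => ψ' a - trForm 𝒜 Tr (X a)) (fun a => ψ'' a - trForm 𝒜 Tr ∘ₗ X' a) :=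
    h'.sub (hXX'.comp (trForm 𝒜 Tr))
  -- The exterior derivative of the conormal form `dψ - Tr(X ·)`. The second derivative of `ψ` is
  -- symmetric and drops out, leaving only the derivative of `X`.
  have h5 := neg_mem (conormal_exterior h2 h3 hY)
  convert h5 using 1
  funext a
  refine LinearMap.ext fun W => ?_
  have := h.symm hψ h' a W (Y a)
  simp [this]

theorem IsHamiltonianField.symm_apply {ψ : OddPart 𝒜 → k} {X : OddPart 𝒜 → OddPart 𝒜}
    (hψ : ψ ∈ Pol k (OddPart 𝒜) k) (hX : IsHamiltonianField 𝒜 d Tr ψ X)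
    {X' : OddPart 𝒜 → OddPart 𝒜 →ₗ[k] OddPart 𝒜} (hXX' : IsPD X X')
    {Y Z : OddPart 𝒜 → OddPart 𝒜} (hY : IsTangent 𝒜 d Y) (hZ : IsTangent 𝒜 d Z) :
    (fun a => trForm 𝒜 Tr (X' a (Z a)) (Y a) - trForm 𝒜 Tr (X' a (Y a)) (Z a)) ∈
      vanish 𝒜 d k := conormal_apply (hX.symm hψ hXX' hY) hZ

/-- Differentiating along `Y` the relation that expresses `d_a X` as a multiple of the curvature
gives `d_a(X' Y) + XY + YX = 0` modulo the curvature. The quadratic term is symmetric in `X` and `Y`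
and cancels in the Lie bracket. -/
theorem IsTangent.lie {X Y : OddPart 𝒜 → OddPart 𝒜}
    {X' Y' : OddPart 𝒜 → OddPart 𝒜 →ₗ[k] OddPart 𝒜} (hX : IsTangent 𝒜 d X)
    (hY : IsTangent 𝒜 d Y) (hXX' : IsPD X X') (hYY' : IsPD Y Y')
    (hX' : X' ∈ Pol k (OddPart 𝒜) (OddPart 𝒜 →ₗ[k] OddPart 𝒜))
    (hY' : Y' ∈ Pol k (OddPart 𝒜) (OddPart 𝒜 →ₗ[k] OddPart 𝒜)) :
    IsTangent 𝒜 d fun a => X' a (Y a) - Y' a (X a) := by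
  refine ⟨sub_mem (Pol.eval hX' hY.1) (Pol.eval hY' hX.1), ?_⟩
  have key {X Y : OddPart 𝒜 → OddPart 𝒜} {X' : OddPart 𝒜 → OddPart 𝒜 →ₗ[k] OddPart 𝒜}
      (hX : IsTangent 𝒜 d X) (hY : IsTangent 𝒜 d Y) (hXX' : IsPD X X') :
      (fun a => twLin 𝒜 d a (X' a (Y a)) + (oddMul 𝒜 (Y a) (X a) + oddMul 𝒜 (X a) (Y a))) ∈
        vanish 𝒜 d A := by
    obtain ⟨G, hG, hG'⟩ := mem_vanish.1 hX.2
    obtain ⟨G', hGP, hGG'⟩ := exists_isPD hG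
    have h1 := hGG'.eval (isPD_curv (d := d))
    have h2 := (isPD_twLin (d := d)).eval hXX'
    change (fun a => G a (curv 𝒜 d a)) = fun a => twLin 𝒜 d a (X a) at hG'
    rw [hG'] at h1
    have h3 := h1.unique h2
    have h4 := vanish.eval_right hG hY.2
    have hc : curv 𝒜 d ∈ vanish 𝒜 d A := ⟨_, Pol.const LinearMap.id, rfl⟩
    have h5 := vanish.eval_right (Pol.eval hGP hY.1) hc
    convert add_mem h4 h5 using 1
    funext a
    have h6 := LinearMap.congr_fun (congrFun h3 a) (Y a)
    simp only [LinearMap.add_apply, LinearMap.flip_apply, LinearMap.comp_apply, Pi.add_apply,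
      twLin_apply] at h6 ⊢
    rw [add_comm (G a _), h6]
    abel
  convert sub_mem (key hX hY hXX') (key hY hX hYY') using 1
  funext a
  simp only [← twLin_apply, map_sub, Pi.sub_apply]
  abel

/-- The Poisson bracket of two Hamiltonian functions is Hamiltonian, with the Lie bracket of the
vector fields as its vector field. -/
theorem IsHamiltonianField.bracket (hTr : IsSymmetricTrace 𝒜 d Tr)
    {ψ χ : OddPart 𝒜 → k} {X Y : OddPart 𝒜 → OddPart 𝒜}
    {X' Y' : OddPart 𝒜 → OddPart 𝒜 →ₗ[k] OddPart 𝒜}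
    (hψ : ψ ∈ Pol k (OddPart 𝒜) k) (hX : IsHamiltonianField 𝒜 d Tr ψ X)
    (hχ : χ ∈ Pol k (OddPart 𝒜) k) (hY : IsHamiltonianField 𝒜 d Tr χ Y)
    (hXX' : IsPD X X') (hYY' : IsPD Y Y')
    (hX' : X' ∈ Pol k (OddPart 𝒜) (OddPart 𝒜 →ₗ[k] OddPart 𝒜))
    (hY' : Y' ∈ Pol k (OddPart 𝒜) (OddPart 𝒜 →ₗ[k] OddPart 𝒜)) :
    IsHamiltonianField 𝒜 d Tr (fun a => Tr ((X a : A) * Y a))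
      (fun a => X' a (Y a) - Y' a (X a)) := by
  have h := hXX'.bilin (trForm 𝒜 Tr) hYY'
  refine (isHamiltonianField_iff h).2 ⟨hX.isTangent.lie hY.isTangent hXX' hYY' hX' hY', ?_⟩
  -- By antisymmetry `d Tr(XY)(W) = Tr(X'(W) Y) - Tr(Y'(W) X)`; the symmetry of `X'` and `Y'` moves
  -- `W` out of both derivatives.
  convert sub_mem (hX.symm hψ hXX' hY.isTangent) (hY.symm hχ hYY' hX.isTangent) using 1
  funext a
  refine LinearMap.ext fun W => ?_
  have := trForm_antisymm hTr (X a) (Y' a W)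
  simp [this]
  ring

theorem IsHamiltonianField.pol_bracket {ψ χ : OddPart 𝒜 → k} {X Y : OddPart 𝒜 → OddPart 𝒜}
    (hX : IsHamiltonianField 𝒜 d Tr ψ X) (hY : IsHamiltonianField 𝒜 d Tr χ Y) :
    (fun a => Tr ((X a : A) * Y a)) ∈ Pol k (OddPart 𝒜) k :=
  Pol.bilin (trForm 𝒜 Tr) hX.poly hY.poly

theorem IsHamiltonianField.exists_bracket (hTr : IsSymmetricTrace 𝒜 d Tr)
    {ψ χ : OddPart 𝒜 → k} {X Y : OddPart 𝒜 → OddPart 𝒜}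
    (hψ : ψ ∈ Pol k (OddPart 𝒜) k) (hX : IsHamiltonianField 𝒜 d Tr ψ X)
    (hχ : χ ∈ Pol k (OddPart 𝒜) k) (hY : IsHamiltonianField 𝒜 d Tr χ Y) :
    ∃ Z, IsHamiltonianField 𝒜 d Tr (fun a => Tr ((X a : A) * Y a)) Z := by
  obtain ⟨X', h1, h2⟩ := exists_isPD hX.poly
  obtain ⟨Y', h3, h4⟩ := exists_isPD hY.poly
  exact ⟨_, hX.bracket hTr hψ hχ hY h2 h4 h1 h3⟩

/-- The bracket does not depend on the Hamiltonian vector field of the first function, nor on the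
values of that function away from the Maurer-Cartan scheme. -/
theorem IsHamiltonianField.congr_left {ψ ψ₁ : OddPart 𝒜 → k} {X X₁ Y : OddPart 𝒜 → OddPart 𝒜}
    (hψ : ψ ∈ Pol k (OddPart 𝒜) k) (hX : IsHamiltonianField 𝒜 d Tr ψ X)
    (hψ₁ : ψ₁ ∈ Pol k (OddPart 𝒜) k) (hX₁ : IsHamiltonianField 𝒜 d Tr ψ₁ X₁)
    (h : ψ - ψ₁ ∈ vanish 𝒜 d k) (hY : IsTangent 𝒜 d Y) :
    (fun a => trForm 𝒜 Tr (X a) (Y a) - trForm 𝒜 Tr (X₁ a) (Y a)) ∈ vanish 𝒜 d k := by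
  obtain ⟨ψ', _, h1⟩ := exists_isPD hψ
  obtain ⟨ψ₁', _, h2⟩ := exists_isPD hψ₁
  have h4 : (fun a => ψ' a - ψ₁' a) ∈ conormal 𝒜 d := conormal_of_vanish h (h1.sub h2)
  have h5 := sub_mem h4 (sub_mem ((isHamiltonianField_iff h1).1 hX).2
    ((isHamiltonianField_iff h2).1 hX₁).2)
  convert conormal_apply h5 hY using 1
  funext a
  simp only [Pi.sub_apply, LinearMap.sub_apply]
  ring

end Poisson

/-! ### The Poisson bracket on Hamiltonian functions and its Jacobi identity. -/

section Bracket

variable {k : Type*} [RCLike k] {A : Type*} [Ring A] [Algebra k A]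
  {𝒜 : ℤ → Submodule k A} [GradedAlgebra 𝒜] {d : A →ₗ[k] A} {Tr : A →ₗ[k] k}

theorem IsHamiltonianField.add {ψ χ : OddPart 𝒜 → k} {X Y : OddPart 𝒜 → OddPart 𝒜}
    (hψ : ψ ∈ Pol k (OddPart 𝒜) k) (hχ : χ ∈ Pol k (OddPart 𝒜) k)
    (hX : IsHamiltonianField 𝒜 d Tr ψ X) (hY : IsHamiltonianField 𝒜 d Tr χ Y) :
    IsHamiltonianField 𝒜 d Tr (ψ + χ) (X + Y) := by
  obtain ⟨ψ', _, h1⟩ := exists_isPD hψ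
  obtain ⟨χ', _, h2⟩ := exists_isPD hχ
  refine (isHamiltonianField_iff (h1.add h2)).2 ⟨⟨add_mem hX.poly hY.poly, ?_⟩, ?_⟩
  · convert add_mem hX.tangent hY.tangent using 1
    funext a
    simp only [← twLin_apply, Pi.add_apply, map_add]
  · convert add_mem ((isHamiltonianField_iff h1).1 hX).2 ((isHamiltonianField_iff h2).1 hY).2
      using 1
    funext a
    simp only [Pi.add_apply, map_add]
    abel

theorem IsHamiltonianField.smul {ψ : OddPart 𝒜 → k} {X : OddPart 𝒜 → OddPart 𝒜}
    (hψ : ψ ∈ Pol k (OddPart 𝒜) k) (c : k) (hX : IsHamiltonianField 𝒜 d Tr ψ X) :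
    IsHamiltonianField 𝒜 d Tr (c • ψ) (c • X) := by
  obtain ⟨ψ', _, h1⟩ := exists_isPD hψ
  refine (isHamiltonianField_iff (h1.comp (LinearMap.lsmul k k c))).2
    ⟨⟨Submodule.smul_mem _ c hX.poly, ?_⟩, ?_⟩
  · convert Submodule.smul_mem _ c hX.tangent using 1
    funext a
    simp only [← twLin_apply, Pi.smul_apply, map_smul]
  · convert Submodule.smul_mem _ c ((isHamiltonianField_iff h1).1 hX).2 using 1
    funext a
    refine LinearMap.ext fun Z => ?_
    simp [mul_sub]

/-- The bracket only depends on the restrictions of the two functions to the Maurer-Cartan scheme,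
and not on the choice of Hamiltonian vector fields. -/
theorem IsHamiltonianField.congr (hTr : IsSymmetricTrace 𝒜 d Tr)
    {ψ ψ₁ χ χ₁ : OddPart 𝒜 → k} {X X₁ Y Y₁ : OddPart 𝒜 → OddPart 𝒜}
    (hψ : ψ ∈ Pol k (OddPart 𝒜) k) (hX : IsHamiltonianField 𝒜 d Tr ψ X)
    (hψ₁ : ψ₁ ∈ Pol k (OddPart 𝒜) k) (hX₁ : IsHamiltonianField 𝒜 d Tr ψ₁ X₁)
    (hχ : χ ∈ Pol k (OddPart 𝒜) k) (hY : IsHamiltonianField 𝒜 d Tr χ Y)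
    (hχ₁ : χ₁ ∈ Pol k (OddPart 𝒜) k) (hY₁ : IsHamiltonianField 𝒜 d Tr χ₁ Y₁)
    (h : ψ - ψ₁ ∈ vanish 𝒜 d k) (h' : χ - χ₁ ∈ vanish 𝒜 d k) :
    (fun a => Tr ((X a : A) * Y a) - Tr ((X₁ a : A) * Y₁ a)) ∈ vanish 𝒜 d k := by
  have h1 := hX.congr_left hψ hψ₁ hX₁ h hY.isTangent
  have h2 := hY.congr_left hχ hχ₁ hY₁ h' hX₁.isTangent
  convert sub_mem h1 h2 using 1
  funext a
  simp only [Pi.sub_apply, trForm_antisymm hTr (Y a), trForm_antisymm hTr (Y₁ a), ← trForm_apply]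
  ring

/-- The function `Tr(XY)` for Hamiltonian vector fields `X` and `Y`. -/
def hamBracket (hd : IsDGA 𝒜 d) (hTr : IsSymmetricTrace 𝒜 d Tr) {p q : invariants 𝒜 hd}
    {X Y : OddPart 𝒜 → OddPart 𝒜} (hX : IsHamiltonianField 𝒜 d Tr p X)
    (hY : IsHamiltonianField 𝒜 d Tr q Y) : invariants 𝒜 hd :=
  ⟨fun a => Tr ((X a : A) * Y a), by
    obtain ⟨Z, hZ⟩ := hX.exists_bracket hTr p.2.1 q.2.1 hY
    exact hZ.mem_invariants hd hTr (hX.pol_bracket hY)⟩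

theorem mem_hamFun {hd : IsDGA 𝒜 d} {ψ : Fun 𝒜 hd} : ψ ∈ hamFun 𝒜 hd Tr ↔
    ∃ (p : invariants 𝒜 hd) (X : OddPart 𝒜 → OddPart 𝒜),
      cls (vanish 𝒜 d k) p = ψ ∧ IsHamiltonianField 𝒜 d Tr p X := Iff.rfl

theorem hamBracket_mem_hamFun (hd : IsDGA 𝒜 d) (hTr : IsSymmetricTrace 𝒜 d Tr)
    {p q : invariants 𝒜 hd} {X Y : OddPart 𝒜 → OddPart 𝒜}
    (hX : IsHamiltonianField 𝒜 d Tr p X) (hY : IsHamiltonianField 𝒜 d Tr q Y) :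
    cls (vanish 𝒜 d k) (hamBracket hd hTr hX hY) ∈ hamFun 𝒜 hd Tr := by
  obtain ⟨Z, hZ⟩ := hX.exists_bracket hTr p.2.1 q.2.1 hY
  exact ⟨_, Z, rfl, hZ⟩

/-- A Hamiltonian vector field of a Hamiltonian function, with a polynomial representing the
function. -/
theorem exists_hamiltonianField {hd : IsDGA 𝒜 d} (ψ : hamFun 𝒜 hd Tr) :
    ∃ P : invariants 𝒜 hd × (OddPart 𝒜 → OddPart 𝒜),
      cls (vanish 𝒜 d k) P.1 = ψ ∧ IsHamiltonianField 𝒜 d Tr P.1 P.2 := by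
  obtain ⟨p, X, h⟩ := mem_hamFun.1 ψ.2
  exact ⟨(p, X), h⟩

variable (hd : IsDGA 𝒜 d) (hTr : IsSymmetricTrace 𝒜 d Tr)

/-- The Poisson bracket of Hamiltonian functions. -/
def poissonFun (ψ χ : hamFun 𝒜 hd Tr) : hamFun 𝒜 hd Tr :=
  ⟨_, hamBracket_mem_hamFun hd hTr (exists_hamiltonianField ψ).choose_spec.2
    (exists_hamiltonianField χ).choose_spec.2⟩

theorem poissonFun_eq {ψ χ : hamFun 𝒜 hd Tr} {p q : invariants 𝒜 hd}
    {X Y : OddPart 𝒜 → OddPart 𝒜} (hp : cls (vanish 𝒜 d k) p = ψ) (hq : cls (vanish 𝒜 d k) q = χ)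
    (hX : IsHamiltonianField 𝒜 d Tr p X) (hY : IsHamiltonianField 𝒜 d Tr q Y) :
    (poissonFun hd hTr ψ χ : Fun 𝒜 hd) = cls (vanish 𝒜 d k) (hamBracket hd hTr hX hY) := by
  obtain ⟨h1, h2⟩ := (exists_hamiltonianField ψ).choose_spec
  obtain ⟨h3, h4⟩ := (exists_hamiltonianField χ).choose_spec
  refine cls_eq_cls.2 ?_
  exact h2.congr hTr (Subtype.prop (exists_hamiltonianField ψ).choose.1).1 p.2.1 hX
    (Subtype.prop (exists_hamiltonianField χ).choose.1).1 h4 q.2.1 hY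
    (cls_eq_cls.1 (h1.trans hp.symm)) (cls_eq_cls.1 (h3.trans hq.symm))

/-- Existence and independence of all choices at once: the relation allows arbitrary representatives
and Hamiltonian fields, and `poissonFun` is built from chosen ones. -/
theorem isPoissonBracket_iff (ψ χ : hamFun 𝒜 hd Tr) (θ : Fun 𝒜 hd) :
    IsPoissonBracket 𝒜 hd Tr ψ χ θ ↔ θ = poissonFun hd hTr ψ χ := by
  constructor
  · rintro ⟨p, q, r, X, Y, hp, hq, rfl, hX, hY, h⟩
    rw [poissonFun_eq hd hTr hp hq hX hY]
    exact congrArg _ (Subtype.ext (funext h))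
  · rintro rfl
    obtain ⟨⟨p, X⟩, hp, hX⟩ := exists_hamiltonianField ψ
    obtain ⟨⟨q, Y⟩, hq, hY⟩ := exists_hamiltonianField χ
    exact ⟨p, q, hamBracket hd hTr hX hY, X, Y, hp, hq, (poissonFun_eq hd hTr hp hq hX hY).symm,
      hX, hY, fun a => rfl⟩

/-- The Poisson bracket as a bilinear map. -/
def poisson : hamFun 𝒜 hd Tr →ₗ[k] hamFun 𝒜 hd Tr →ₗ[k] hamFun 𝒜 hd Tr :=
  LinearMap.mk₂ k (poissonFun hd hTr)
    (fun ψ ψ₁ χ => by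
      obtain ⟨⟨p, X⟩, hp, hX⟩ := exists_hamiltonianField ψ
      obtain ⟨⟨p₁, X₁⟩, hp₁, hX₁⟩ := exists_hamiltonianField ψ₁
      obtain ⟨⟨q, Y⟩, hq, hY⟩ := exists_hamiltonianField χ
      refine Subtype.ext ?_
      rw [Submodule.coe_add, poissonFun_eq hd hTr hp hq hX hY,
        poissonFun_eq hd hTr hp₁ hq hX₁ hY, poissonFun_eq hd hTr (p := p + p₁)
          (by rw [Submodule.coe_add, ← hp, ← hp₁]; rfl) hq (hX.add p.2.1 p₁.2.1 hX₁) hY]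
      exact congrArg (cls (vanish 𝒜 d k)) (Subtype.ext (funext fun a => by
        simp [hamBracket, add_mul])))
    (fun c ψ χ => by
      obtain ⟨⟨p, X⟩, hp, hX⟩ := exists_hamiltonianField ψ
      obtain ⟨⟨q, Y⟩, hq, hY⟩ := exists_hamiltonianField χ
      refine Subtype.ext ?_
      rw [Submodule.coe_smul, poissonFun_eq hd hTr hp hq hX hY, poissonFun_eq hd hTr (p := c • p)
          (by rw [Submodule.coe_smul, ← hp]; rfl) hq (hX.smul p.2.1 c) hY]
      exact congrArg (cls (vanish 𝒜 d k)) (Subtype.ext (funext fun a => by simp [hamBracket])))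
    (fun ψ χ χ₁ => by
      obtain ⟨⟨p, X⟩, hp, hX⟩ := exists_hamiltonianField ψ
      obtain ⟨⟨q₁, Y₁⟩, hq₁, hY₁⟩ := exists_hamiltonianField χ₁
      obtain ⟨⟨q, Y⟩, hq, hY⟩ := exists_hamiltonianField χ
      refine Subtype.ext ?_
      rw [Submodule.coe_add, poissonFun_eq hd hTr hp hq hX hY,
        poissonFun_eq hd hTr hp hq₁ hX hY₁, poissonFun_eq hd hTr (q := q + q₁) hp
          (by rw [Submodule.coe_add, ← hq, ← hq₁]; rfl) hX (hY.add q.2.1 q₁.2.1 hY₁)]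
      exact congrArg (cls (vanish 𝒜 d k)) (Subtype.ext (funext fun a => by
        simp [hamBracket, mul_add])))
    (fun c ψ χ => by
      obtain ⟨⟨p, X⟩, hp, hX⟩ := exists_hamiltonianField ψ
      obtain ⟨⟨q, Y⟩, hq, hY⟩ := exists_hamiltonianField χ
      refine Subtype.ext ?_
      rw [Submodule.coe_smul, poissonFun_eq hd hTr hp hq hX hY, poissonFun_eq hd hTr (q := c • q) hp
          (by rw [Submodule.coe_smul, ← hq]; rfl) hX (hY.smul q.2.1 c)]
      exact congrArg (cls (vanish 𝒜 d k)) (Subtype.ext (funext fun a => by simp [hamBracket])))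

theorem poissonFun_self (ψ : hamFun 𝒜 hd Tr) : poissonFun hd hTr ψ ψ = 0 := by
  obtain ⟨⟨p, X⟩, hp, hX⟩ := exists_hamiltonianField ψ
  have h0 : hamBracket hd hTr hX hX = 0 := Subtype.ext (funext fun a => by
    have := trForm_antisymm hTr (X a) (X a)
    exact self_eq_neg.1 this)
  refine Subtype.ext ?_
  rw [poissonFun_eq hd hTr hp hp hX hX, h0]
  rfl

/-- With the fields from `IsHamiltonianField.bracket`, the derivative of each of the three fields
occurs in two terms in which the other two fields are exchanged. The symmetry `symm_apply` makes
each such pair cancel modulo the curvature. -/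
theorem poissonFun_jacobi (ψ χ φ : hamFun 𝒜 hd Tr) :
    (poissonFun hd hTr ψ (poissonFun hd hTr χ φ) : Fun 𝒜 hd) =
      poissonFun hd hTr (poissonFun hd hTr ψ χ) φ + poissonFun hd hTr χ (poissonFun hd hTr ψ φ) := by
  obtain ⟨⟨p, X⟩, hp, hX⟩ := exists_hamiltonianField ψ
  obtain ⟨⟨q, Y⟩, hq, hY⟩ := exists_hamiltonianField χ
  obtain ⟨⟨r, Z⟩, hr, hZ⟩ := exists_hamiltonianField φ
  obtain ⟨X', hX', hXX'⟩ := exists_isPD hX.poly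
  obtain ⟨Y', hY', hYY'⟩ := exists_isPD hY.poly
  obtain ⟨Z', hZ', hZZ'⟩ := exists_isPD hZ.poly
  have hXY := hX.bracket hTr p.2.1 q.2.1 hY hXX' hYY' hX' hY'
  have hXZ := hX.bracket hTr p.2.1 r.2.1 hZ hXX' hZZ' hX' hZ'
  have hYZ := hY.bracket hTr q.2.1 r.2.1 hZ hYY' hZZ' hY' hZ'
  rw [poissonFun_eq hd hTr hp (poissonFun_eq hd hTr hq hr hY hZ).symm hX hYZ,
    poissonFun_eq hd hTr (poissonFun_eq hd hTr hp hq hX hY).symm hr hXY hZ,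
    poissonFun_eq hd hTr hq (poissonFun_eq hd hTr hp hr hX hZ).symm hY hXZ]
  have key (u v w : invariants 𝒜 hd)
      (h : (u : OddPart 𝒜 → k) - ((v : OddPart 𝒜 → k) + w) ∈ vanish 𝒜 d k) :
      cls (vanish 𝒜 d k) u = cls (vanish 𝒜 d k) v + cls (vanish 𝒜 d k) w :=
    (cls_eq_cls (z := u) (w := v + w)).2 h
  refine key _ _ _ ?_
  have h1 := hX.symm_apply p.2.1 hXX' hY.isTangent hZ.isTangent
  have h2 := hY.symm_apply q.2.1 hYY' hX.isTangent hZ.isTangent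
  have h3 := hZ.symm_apply r.2.1 hZZ' hX.isTangent hY.isTangent
  convert add_mem (sub_mem h1 h2) h3 using 1
  funext a
  change trForm 𝒜 Tr (X a) (Y' a (Z a) - Z' a (Y a)) -
    (trForm 𝒜 Tr (X' a (Y a) - Y' a (X a)) (Z a) + trForm 𝒜 Tr (Y a) (X' a (Z a) - Z' a (X a))) =
    _
  have e1 := trForm_antisymm hTr (X a) (Y' a (Z a))
  have e2 := trForm_antisymm hTr (X a) (Z' a (Y a))
  have e3 := trForm_antisymm hTr (Y a) (X' a (Z a))
  have e4 := trForm_antisymm hTr (Y a) (Z' a (X a))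
  simp only [map_sub, LinearMap.sub_apply, Pi.sub_apply, Pi.add_apply]
  linear_combination e1 - e2 - e3 + e4

theorem isLieBracket_poisson : IsLieBracket (poisson hd hTr) :=
  ⟨poissonFun_self hd hTr, fun ψ χ φ => Subtype.ext (poissonFun_jacobi hd hTr ψ χ φ)⟩

end Bracket

/-! ## Functions of words with equal letters -/

section Words

variable {k : Type*} [RCLike k] {A : Type*} [AddCommGroup A] [Module k A]
  {M : Type*} [AddCommGroup M] [Module k M]

theorem Multilin.exists_multilinearMap {F : List A → M} (hF : Multilin k F) (n : ℕ) :
    ∃ f : MultilinearMap k (fun _ : Fin n => A) M, ∀ v, f v = F (List.ofFn v) := by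
  induction n generalizing F with
  | zero => exact ⟨MultilinearMap.constOfIsEmpty k _ (F []), fun v => by simp⟩
  | succ n ih =>
    choose f hf using fun x : A => ih (hF.cons x)
    let L : A →ₗ[k] MultilinearMap k (fun _ : Fin n => A) M :=
      { toFun := f
        map_add' := fun x y => MultilinearMap.ext fun v => by
          rw [add_apply, hf, hf, hf, (hF.head _).map_add]
        map_smul' := fun c x => MultilinearMap.ext fun v => by
          rw [RingHom.id_apply, smul_apply, hf, hf, (hF.head _).map_smul] }
    refine ⟨LinearMap.uncurryLeft (M := fun _ : Fin (n + 1) => A) L, fun v => ?_⟩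
    rw [LinearMap.uncurryLeft_apply, List.ofFn_succ]
    exact hf _ _

theorem Multilin.pol_replicate {F : List A → M} (hF : Multilin k F) (n : ℕ) :
    (fun a => F (List.replicate n a)) ∈ Pol k A M := by
  obtain ⟨f, hf⟩ := hF.exists_multilinearMap n
  have h := Pol.of_multilinear f
  simp only [hf, List.ofFn_const] at h
  exact h

/-- The sum of `F` over the words obtained by replacing one letter of `a … a` by `c`. -/
def insertSum (F : List A → M) (a c : A) : ℕ → M
  | 0 => 0
  | n + 1 => F (c :: List.replicate n a) + insertSum (fun l => F (a :: l)) a c n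

theorem insertSum_eq_sum (F : List A → M) (a c : A) (n : ℕ) : insertSum F a c n =
    ∑ i ∈ Finset.range n, F (List.replicate i a ++ c :: List.replicate (n - 1 - i) a) := by
  induction n generalizing F with
  | zero => rfl
  | succ n ih =>
    rw [insertSum, ih, Finset.sum_range_succ', add_comm]
    refine congrArg₂ _ (Finset.sum_congr rfl fun i hi => ?_) (by simp)
    rw [List.replicate_succ, List.cons_append, show n + 1 - 1 - (i + 1) = n - 1 - i by omega]

theorem insertSum_eq_zero {F : List A → M} {n : ℕ} (h : ∀ l, l.length = n → F l = 0) (a c : A) :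
    insertSum F a c n = 0 := by
  rw [insertSum_eq_sum]
  refine Finset.sum_eq_zero fun i hi => h _ ?_
  have := Finset.mem_range.1 hi
  simp only [List.length_append, List.length_cons, List.length_replicate]
  omega

theorem Multilin.isLinearMap_insertSum {F : List A → M} (hF : Multilin k F) (a : A) (n : ℕ) :
    IsLinearMap k fun c => insertSum F a c n := by
  induction n generalizing F with
  | zero => exact (0 : A →ₗ[k] M).isLinear
  | succ n ih => exact isLinearMap_add (hF.head (List.replicate n a)) (ih (hF.cons a))

/-- `insertSum` as a linear map. -/
def Multilin.insertLin {F : List A → M} (hF : Multilin k F) (n : ℕ) (a : A) : A →ₗ[k] M :=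
  (hF.isLinearMap_insertSum a n).mk' _

/-- The product rule: to first order in `t` exactly one of the letters is replaced by the direction
`Z`. -/
theorem Multilin.isPD_replicate {F : List A → M} (hF : Multilin k F) (n : ℕ) :
    IsPD (fun a => F (List.replicate n a)) (hF.insertLin n) := by
  intro a Z
  change ∃ r ∈ Pol k k M, ∀ t : k, F (List.replicate n (a + t • Z)) =
    F (List.replicate n a) + t • insertSum F a Z n + (t * t) • r t
  induction n generalizing F with
  | zero => exact ⟨0, zero_mem _, fun t => by simp [insertSum]⟩
  | succ n ih =>
    obtain ⟨r, hr, h⟩ := ih (hF.cons a)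
    obtain ⟨s, hs, h'⟩ := ih (hF.cons Z)
    refine ⟨fun t => r t + (insertSum (fun l => F (Z :: l)) a Z n + t • s t),
      Pol.add hr (Pol.add (Pol.const _) (Pol.smul Pol.id hs)), fun t => ?_⟩
    rw [List.replicate_succ, (hF.head _).map_add, (hF.head _).map_smul, h, h', insertSum,
      List.replicate_succ]
    module

/-- No expansion is needed: the derivative of a polynomial map is unique and some polynomial
derivative exists. -/
theorem Multilin.pol_insertLin {F : List A → M} (hF : Multilin k F) (n : ℕ) :
    hF.insertLin n ∈ Pol k A (A →ₗ[k] M) := by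
  obtain ⟨p', h, h'⟩ := exists_isPD (hF.pol_replicate n)
  rwa [(hF.isPD_replicate n).unique h']

theorem Pol.precomp {V U : Type*} [AddCommGroup V] [Module k V] [AddCommGroup U] [Module k U]
    {p : A → U} (S : V →ₗ[k] A) (hp : p ∈ Pol k A U) : (fun a => p (S a)) ∈ Pol k V U :=
  Pol.induction (P := fun p => (fun a => p (S a)) ∈ Pol k V U)
    (fun _ f => Pol.of_multilinear (f.compLinearMap fun _ => S)) (zero_mem _)
    (fun _ _ h1 h2 => add_mem h1 h2) (fun c _ h => Submodule.smul_mem _ c h) hp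

theorem IsPD.precomp {V U : Type*} [AddCommGroup V] [Module k V] [AddCommGroup U] [Module k U]
    {p : A → U} {p' : A → A →ₗ[k] U} (S : V →ₗ[k] A) (hp : IsPD p p') :
    IsPD (fun a => p (S a)) (fun a => p' (S a) ∘ₗ S) := fun a Z => by
  obtain ⟨r, hr, h⟩ := hp (S a) (S Z)
  exact ⟨r, hr, fun t => by
    change p (S (a + t • Z)) = _
    rw [map_add, map_smul, h]
    rfl⟩

theorem IsPD.sum {V U : Type*} [AddCommGroup V] [Module k V] [AddCommGroup U] [Module k U]
    {ι : Type*} (s : Finset ι) {p : ι → V → U} {p' : ι → V → V →ₗ[k] U}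
    (hp : ∀ i, IsPD (p i) (p' i)) :
    IsPD (fun a => ∑ i ∈ s, p i a) (fun a => ∑ i ∈ s, p' i a) := by
  classical
  induction s using Finset.induction_on with
  | empty => exact (IsPD.const 0)
  | insert i s hi ih => simp only [Finset.sum_insert hi]; exact (hp i).add ih

theorem Pol.sum {V U : Type*} [AddCommGroup V] [Module k V] [AddCommGroup U] [Module k U]
    {ι : Type*} (s : Finset ι) {p : ι → V → U} (hp : ∀ i, p i ∈ Pol k V U) :
    (fun a => ∑ i ∈ s, p i a) ∈ Pol k V U := by
  classical
  induction s using Finset.induction_on with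
  | empty => exact Pol.const 0
  | insert i s hi ih => simp only [Finset.sum_insert hi]; exact Pol.add (hp i) ih

/-- The sum of `F` over the words `a … a`. -/
def wordSum (F : List A → M) (a : A) : M := ∑ᶠ n : ℕ, F (List.replicate n a)

theorem wordSum_eq_sum {F : List A → M} {N : ℕ} (h : ∀ l, N ≤ l.length → F l = 0) (a : A) :
    wordSum F a = ∑ n ∈ Finset.range N, F (List.replicate n a) := by
  refine finsum_eq_sum_of_support_subset _ fun n hn => ?_
  by_contra h'
  simp only [Finset.coe_range, Set.mem_Iio, not_lt] at h'
  exact hn (h _ (by simpa using h'))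

end Words

/-! ### Differentials of cochains on words `a … a` with `a` odd. -/

section OddWords

variable {k : Type*} [RCLike k] {A : Type*} [Ring A] [Algebra k A]
  {𝒜 : ℤ → Submodule k A} [GradedAlgebra 𝒜] {d : A →ₗ[k] A}
  {M : Type*} [AddCommGroup M] [Module k M]

theorem wpar_replicate (a : OddPart 𝒜) (n : ℕ) :
    wpar 𝒜 (List.replicate n (a : A)) = List.replicate n (a : A) := by
  rw [wpar, List.map_replicate, spar_of_odd 𝒜 a.2]

/-- An odd letter has even shifted degree, so passing it costs no sign; the product terms contain
`par a * a = -a²`. -/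
theorem barD_replicate {G : List A → M} (hG : Multilin k G) (a : OddPart 𝒜) (n : ℕ) :
    barD 𝒜 d G (List.replicate (n + 1) (a : A)) =
      -insertSum G (a : A) (d a) (n + 1) - insertSum G (a : A) (a * a) n := by
  induction n generalizing G with
  | zero => simp [barD, insertSum]
  | succ n ih =>
    have h := ih (hG.cons (a : A))
    rw [List.replicate_succ] at h
    rw [List.replicate_succ, List.replicate_succ, barD, spar_of_odd 𝒜 a.2, h,
      par_of_odd 𝒜 a.2, neg_mul, (hG.head _).map_neg,
      show insertSum G (a : A) (d a) (n + 1 + 1) = G (d a :: a :: List.replicate n (a : A)) +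
        insertSum (fun l => G (a :: l)) (a : A) (d a) (n + 1) from rfl,
      show insertSum G (a : A) (a * a) (n + 1) = G (a * a :: List.replicate n (a : A)) +
        insertSum (fun l => G (a :: l)) (a : A) (a * a) n from rfl]
    abel

/-- A word of length `n + 1` contributes insertions of `da` in length `n + 1` and of `a²` in length
`n`. After a shift of the index they combine to insertions of the curvature; the boundary terms
vanish, at length `N` by the bound on `G`. -/
theorem sum_barD_replicate {G : List A → M} (hG : Multilin k G) {N : ℕ}
    (h : ∀ l, N ≤ l.length → G l = 0) (a : OddPart 𝒜) :
    ∑ n ∈ Finset.range (N + 1), barD 𝒜 d G (List.replicate n (a : A)) =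
      -∑ n ∈ Finset.range N, insertSum G (a : A) (curv 𝒜 d a) n := by
  have h0 (c : A) : insertSum G (a : A) c N = 0 := insertSum_eq_zero (fun l hl => h l hl.ge) _ _
  have h1 : ∑ n ∈ Finset.range N, insertSum G (a : A) (d a) (n + 1) =
      ∑ n ∈ Finset.range N, insertSum G (a : A) (d a) n := by
    have e1 := Finset.sum_range_succ (fun n => insertSum G (a : A) (d a) n) N
    have e2 := Finset.sum_range_succ' (fun n => insertSum G (a : A) (d a) n) N
    rw [h0, add_zero] at e1
    rw [e1, insertSum, add_zero] at e2
    exact e2.symm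
  rw [Finset.sum_range_succ', List.replicate_zero, barD, add_zero]
  simp only [barD_replicate hG, Finset.sum_sub_distrib, Finset.sum_neg_distrib, h1, curv,
    (hG.isLinearMap_insertSum _ _).map_add, Finset.sum_add_distrib]
  abel

theorem actionTerms_replicate {σM : M →ₗ[k] M} {lft rgt : A → M →ₗ[k] M} (g : List A → M)
    (a : OddPart 𝒜) (n : ℕ) :
    actionTerms 𝒜 σM lft rgt g (List.replicate (n + 1) (a : A)) =
      lft a (g (List.replicate n (a : A))) - rgt a (hat 𝒜 σM g (List.replicate n (a : A))) := by
  have hk : koszul k (spar 𝒜) (hat 𝒜 σM) (fun b h => lft b (h (List.replicate n (a : A)))) (a : A)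
      g = lft a (g (List.replicate n (a : A))) := by
    rw [koszul, spar_of_odd 𝒜 a.2]
    module
  have e : (a : A) :: List.replicate n (a : A) = List.replicate (n + 1) (a : A) := rfl
  rw [List.replicate_succ, actionTerms, hk]
  simp only [e, List.getLast_replicate, List.dropLast_replicate, wpar_replicate,
    Nat.add_sub_cancel]

/-- The sum of the values of a Hochschild differential on the words `a … a`. -/
theorem wordSum_hochD {σM dM : M →ₗ[k] M} {lft rgt : A → M →ₗ[k] M} {g : List A → M}
    (hg : Multilin k g) {N : ℕ} (h : ∀ l, N ≤ l.length → g l = 0) (a : OddPart 𝒜) :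
    ∑ n ∈ Finset.range (N + 1), hochD 𝒜 d σM dM lft rgt g (List.replicate n (a : A)) =
      dM (wordSum g (a : A)) + lft a (wordSum g (a : A)) - rgt a (σM (wordSum g (a : A))) +
        ∑ n ∈ Finset.range N, insertSum (hat 𝒜 σM g) (a : A) (curv 𝒜 d a) n := by
  have hh (n : ℕ) : hat 𝒜 σM g (List.replicate n (a : A)) = σM (g (List.replicate n (a : A))) := by
    rw [hat, wpar_replicate]
  have h' : ∀ l, N ≤ l.length → hat 𝒜 σM g l = 0 := fun l hl => by
    rw [hat, h _ (by simpa [wpar] using hl), map_zero]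
  change ∑ n ∈ Finset.range (N + 1), (dM (g (List.replicate n (a : A))) -
    barD 𝒜 d (hat 𝒜 σM g) (List.replicate n (a : A)) +
    actionTerms 𝒜 σM lft rgt g (List.replicate n (a : A))) = _
  rw [Finset.sum_add_distrib, Finset.sum_sub_distrib, sum_barD_replicate hg.hat h',
    Finset.sum_range_succ, h _ (by simp), Finset.sum_range_succ' (fun n => actionTerms 𝒜 σM lft rgt g
      (List.replicate n (a : A))), wordSum_eq_sum h]
  have h0 : actionTerms 𝒜 σM lft rgt g (List.replicate 0 (a : A)) = 0 := rfl
  simp only [h0, actionTerms_replicate, hh, map_sum, Finset.sum_sub_distrib, map_zero]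
  abel

end OddWords

/-! ### Sums over the words `a … a` of functions of bounded length. -/

section FiniteLength

variable {k : Type*} [RCLike k] {A : Type*} [AddCommGroup A] [Module k A]
  {M M' : Type*} [AddCommGroup M] [Module k M] [AddCommGroup M'] [Module k M']

/-- `F` vanishes on all long words. -/
def FiniteLength (F : List A → M) : Prop := ∃ N : ℕ, ∀ l, N ≤ l.length → F l = 0

theorem FiniteLength.common {F : List A → M} {G : List A → M'} (hF : FiniteLength F)
    (hG : FiniteLength G) :
    ∃ N : ℕ, (∀ l, N ≤ l.length → F l = 0) ∧ ∀ l, N ≤ l.length → G l = 0 := by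
  obtain ⟨N, h⟩ := hF
  obtain ⟨N', h'⟩ := hG
  exact ⟨max N N', fun l hl => h l ((le_max_left _ _).trans hl),
    fun l hl => h' l ((le_max_right _ _).trans hl)⟩

theorem wordSum_add {F G : List A → M} (hF : FiniteLength F) (hG : FiniteLength G) (a : A) :
    wordSum (F + G) a = wordSum F a + wordSum G a := by
  obtain ⟨N, h, h'⟩ := hF.common hG
  rw [wordSum_eq_sum h, wordSum_eq_sum h', ← Finset.sum_add_distrib,
    wordSum_eq_sum fun l hl => by rw [Pi.add_apply, h l hl, h' l hl, add_zero]]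
  rfl

theorem map_wordSum {F : List A → M} (hF : FiniteLength F) (T : M →ₗ[k] M') (a : A) :
    T (wordSum F a) = wordSum (fun l => T (F l)) a := by
  obtain ⟨N, h⟩ := hF
  rw [wordSum_eq_sum h, map_sum, wordSum_eq_sum fun l hl => by rw [h l hl, map_zero]]

theorem wordSum_smul {F : List A → M} (hF : FiniteLength F) (c : k) (a : A) :
    wordSum (c • F) a = c • wordSum F a := (map_wordSum hF (LinearMap.lsmul k M c) a).symm

theorem wordSum_sub {F G : List A → M} (hF : FiniteLength F) (hG : FiniteLength G) (a : A) :
    wordSum (F - G) a = wordSum F a - wordSum G a := by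
  obtain ⟨N, h, h'⟩ := hF.common hG
  rw [wordSum_eq_sum h, wordSum_eq_sum h', ← Finset.sum_sub_distrib,
    wordSum_eq_sum fun l hl => by rw [Pi.sub_apply, h l hl, h' l hl, sub_zero]]
  rfl

theorem Multilin.pol_wordSum {F : List A → M} (hF : Multilin k F) (h : FiniteLength F) :
    wordSum F ∈ Pol k A M := by
  obtain ⟨N, h⟩ := h
  rw [funext (wordSum_eq_sum h)]
  exact Pol.sum _ fun n => hF.pol_replicate n

theorem map_insertSum {F : List A → M} (T : M →ₗ[k] M') (a c : A) (n : ℕ) :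
    T (insertSum F a c n) = insertSum (fun l => T (F l)) a c n := by
  simp only [insertSum_eq_sum, map_sum]

/-- Linear functionals as values of a function on words. -/
def linVal {g : List A → A → k} (hg : ∀ l, IsLinearMap k (g l)) (l : List A) : A →ₗ[k] k :=
  (hg l).mk' (g l)

theorem multilin_linVal {g : List A → A → k} (hg : Multilin k g) (hl : ∀ l, IsLinearMap k (g l)) :
    Multilin k (linVal hl) := fun l r =>
  ⟨fun x y => LinearMap.ext fun z => congrFun ((hg l r).map_add x y) z,
    fun c x => LinearMap.ext fun z => congrFun ((hg l r).map_smul c x) z⟩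

theorem FiniteLength.linVal {g : List A → A → k} (h : FiniteLength g)
    (hl : ∀ l, IsLinearMap k (g l)) : FiniteLength (linVal hl) := by
  obtain ⟨N, h⟩ := h
  exact ⟨N, fun l hl => LinearMap.ext fun z => congrFun (h l hl) z⟩

theorem wordSum_linVal {g : List A → A → k} (h : FiniteLength g) (hl : ∀ l, IsLinearMap k (g l))
    (a z : A) : wordSum (linVal hl) a z = wordSum g a z :=
  (map_wordSum (h.linVal hl) (LinearMap.applyₗ z) a).trans
    (map_wordSum h (LinearMap.proj (R := k) (φ := fun _ : A => k) z) a).symm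

end FiniteLength

/-! ### The function `⟨α, R(a)⟩`: derivative, gauge invariance, dependence on the class. -/

section Signs

variable {k : Type*} [RCLike k] {A : Type*} [Ring A] [Algebra k A]
  {𝒜 : ℤ → Submodule k A} [GradedAlgebra 𝒜] {d : A →ₗ[k] A}
  {M : Type*} [AddCommGroup M] [Module k M] {ℳ : ℤ → Submodule k M}

theorem finiteLength_of_mem_cochains {f : List A → M} (hf : f ∈ cochains 𝒜 ℳ) :
    FiniteLength f := by
  obtain ⟨N, h⟩ := exists_length_bound hf
  exact ⟨N + 1, fun l hl => h l hl⟩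

theorem wpar_of_odd {l : List A} (h : ∀ a ∈ l, a ∈ OddPart 𝒜) : wpar 𝒜 l = l :=
  (List.map_congr_left fun a ha => spar_of_odd 𝒜 (h a ha)).trans (List.map_id l)

/-- All letters are odd, so no signs occur, and the rotations of `y a … a` place `y` once in every
position. -/
theorem connes_replicate (f : List A → A → k) (a y : OddPart 𝒜) (n : ℕ) :
    connes 𝒜 f (List.replicate n (a : A)) y =
      -insertSum (fun l => f l 1) (a : A) y (n + 1) := by
  have hodd : ∀ x ∈ (y : A) :: List.replicate n (a : A), x ∈ OddPart 𝒜 := by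
    intro x hx
    rcases List.mem_cons.1 hx with rfl | hx
    · exact y.2
    · rw [List.eq_of_mem_replicate hx]; exact a.2
  have h1 : koszul k (par 𝒜) (wpar 𝒜) (fun x m => rotSum 𝒜 (hat 𝒜 (dualPar 𝒜) f) x m) (y : A)
      (List.replicate n (a : A)) = rotSum 𝒜 (hat 𝒜 (dualPar 𝒜) f) y (List.replicate n (a : A)) := by
    rw [koszul, wpar_replicate]
    module
  have h2 : rotSum 𝒜 (hat 𝒜 (dualPar 𝒜) f) y (List.replicate n (a : A)) =
      ∑ i ∈ Finset.range (n + 1), f (((y : A) :: List.replicate n (a : A)).drop i ++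
        ((y : A) :: List.replicate n (a : A)).take i) 1 := by
    rw [rotSum, List.length_replicate]
    refine Finset.sum_congr rfl fun i _ => ?_
    have hd : ∀ x ∈ ((y : A) :: List.replicate n (a : A)).drop i, x ∈ OddPart 𝒜 :=
      fun x hx => hodd x (List.mem_of_mem_drop hx)
    have ht : ∀ x ∈ ((y : A) :: List.replicate n (a : A)).take i, x ∈ OddPart 𝒜 :=
      fun x hx => hodd x (List.mem_of_mem_take hx)
    have hdt := wpar_of_odd (𝒜 := 𝒜) (l := ((y : A) :: List.replicate n (a : A)).drop i ++
      ((y : A) :: List.replicate n (a : A)).take i) fun x hx =>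
        (List.mem_append.1 hx).elim (hd x) (ht x)
    rw [koszul, wpar_of_odd hd, wpar_of_odd ht, hat, hdt]
    change (2⁻¹ : k) • (f _ (par 𝒜 1) + f _ (par 𝒜 1) + f _ (par 𝒜 1) - f _ (par 𝒜 1)) = _
    rw [par_one]
    module
  change -koszul k (par 𝒜) (wpar 𝒜) (fun x m => rotSum 𝒜 (hat 𝒜 (dualPar 𝒜) f) x m) (y : A)
      (List.replicate n (a : A)) = _
  -- The trivial rotation matches the insertion at the front. The others move `y` towards the front
  -- as the index grows, hence the reflection of the summation range.
  rw [h1, h2, insertSum_eq_sum, Finset.sum_range_succ', Finset.sum_range_succ',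
    ← Finset.sum_range_reflect]
  refine congrArg Neg.neg (congrArg₂ _ (Finset.sum_congr rfl fun i hi => ?_) (by simp))
  have := Finset.mem_range.1 hi
  rw [List.drop_succ_cons, List.take_succ_cons, List.drop_replicate, List.take_replicate,
    show n - (n - 1 - i) = i + 1 by omega, show min (n - 1 - i) n = n + 1 - 1 - (i + 1) by omega]

/-- The Cauchy product: without signs, the cuts of words `a … a` run over all pairs of lengths. `N +
N` bounds the sum, since a cut of a longer word has a part of length at least `N`. -/
theorem wordSum_cup {f g : List A → A} (hf : FiniteLength f) (hg : FiniteLength g)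
    (a : OddPart 𝒜) :
    wordSum (cup 𝒜 f g) (a : A) = wordSum f (a : A) * wordSum g (a : A) := by
  obtain ⟨N, h, h'⟩ := hf.common hg
  have e (n : ℕ) : cup 𝒜 f g (List.replicate n (a : A)) = ∑ i ∈ Finset.range (n + 1),
      f (List.replicate i (a : A)) * g (List.replicate (n - i) (a : A)) := by
    rw [cup, List.length_replicate]
    refine Finset.sum_congr rfl fun i hi => ?_
    rw [List.take_replicate, List.drop_replicate, koszul, wpar_replicate,
      min_eq_left (Nat.lt_succ_iff.1 (Finset.mem_range.1 hi))]
    module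
  have hc (n : ℕ) (hn : n ∉ Finset.range (N + N)) :
      cup 𝒜 f g (List.replicate n (a : A)) = 0 := by
    rw [e]
    refine Finset.sum_eq_zero fun i _ => ?_
    rw [Finset.mem_range, not_lt] at hn
    by_cases hi : N ≤ i
    · rw [h _ (by simpa using hi), zero_mul]
    · rw [h' _ (by rw [List.length_replicate]; omega), mul_zero]
  rw [wordSum, finsum_eq_sum_of_support_subset _ (s := Finset.range (N + N)) fun n hn => by
    by_contra h0; exact hn (hc n h0)]
  simp only [e]
  rw [Finset.sum_range_diag_flip (N + N) fun i j =>
      f (List.replicate i (a : A)) * g (List.replicate j (a : A)), wordSum_eq_sum h,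
    Finset.sum_mul, Finset.sum_range_add]
  refine (congrArg₂ _ (Finset.sum_congr rfl fun i hi => ?_) (Finset.sum_eq_zero fun i _ => ?_)).trans
    (add_zero _)
  · rw [← Finset.mul_sum, ← wordSum_eq_sum]
    intro l hl
    have := Finset.mem_range.1 hi
    exact h' l (by omega)
  · refine Finset.sum_eq_zero fun j _ => ?_
    rw [h _ (by simp), zero_mul]

theorem sum_insertSum_curv_mem_vanish {F : List A → M} (hF : Multilin k F) (N : ℕ) :
    (fun a : OddPart 𝒜 => ∑ n ∈ Finset.range N, insertSum F (a : A) (curv 𝒜 d a) n) ∈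
      vanish 𝒜 d M := by
  refine mem_vanish.2 ⟨fun a => ∑ n ∈ Finset.range N, hF.insertLin n ((OddPart 𝒜).subtype a),
    Pol.sum _ fun n => Pol.precomp _ (hF.pol_insertLin n), funext fun a => ?_⟩
  simp only [LinearMap.sum_apply]
  rfl

/-- The values of a coboundary of `C(A, A^*)` on the words `a … a`. -/
theorem exists_wordSum_coD {g : List A → A → k} (hg : g ∈ cochains 𝒜 (dualGrading 𝒜))
    (hg' : coD 𝒜 d g ∈ cochains 𝒜 (dualGrading 𝒜)) :
    ∃ K ∈ vanish 𝒜 d (A →ₗ[k] k), ∀ (a : OddPart 𝒜) (y : A),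
      wordSum (coD 𝒜 d g) (a : A) y =
        wordSum g (a : A) (d (par 𝒜 y) - y * a + a * par 𝒜 y) + K a y := by
  obtain ⟨N, h, h'⟩ := (finiteLength_of_mem_cochains hg).common (finiteLength_of_mem_cochains hg')
  have hm := multilin_of_mem_cochains hg
  have hl := isLinearMap_hat (𝒜 := 𝒜) (isLinearMap_of_mem_cochains hg)
  have hS (a : A) : IsLinearMap k (wordSum g a) := by
    have := (wordSum (linVal (isLinearMap_of_mem_cochains hg)) a).isLinear
    rwa [funext (wordSum_linVal ⟨N, h⟩ (isLinearMap_of_mem_cochains hg) a)] at this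
  refine ⟨_, sum_insertSum_curv_mem_vanish (multilin_linVal hm.hat hl) N, fun a y => ?_⟩
  have key := congrFun (wordSum_hochD (d := d) (σM := dualPar 𝒜) (dM := dualD 𝒜 d)
    (lft := dualLeft 𝒜) (rgt := dualRight) hm h a) y
  change (∑ n ∈ Finset.range (N + 1), coD 𝒜 d g (List.replicate n (a : A))) y = _ at key
  rw [← wordSum_eq_sum fun l hl => h' l (by omega : N ≤ l.length)] at key
  have hK : (∑ n ∈ Finset.range N, insertSum (hat 𝒜 (dualPar 𝒜) g) (a : A) (curv 𝒜 d a) n) y =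
      (∑ n ∈ Finset.range N, insertSum (linVal hl) (a : A) (curv 𝒜 d a) n) y := by
    rw [Finset.sum_apply, LinearMap.sum_apply]
    refine Finset.sum_congr rfl fun n _ => ?_
    exact (map_insertSum (LinearMap.proj (R := k) (φ := fun _ : A => k) y) (a : A) _ n).trans
      (map_insertSum (F := linVal hl) (LinearMap.applyₗ y) (a : A) (curv 𝒜 d a) n).symm
  rw [key, Pi.add_apply, hK]
  refine congrArg (· + _) ?_
  -- The vector inserted into `wordSum g` is `-ξ_y(a)` for even `y`, `-d_a y` for odd `y`, and zero
  -- for `y = 1`; these are the three uses of the identity.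
  change wordSum g (a : A) (d (par 𝒜 y)) + wordSum g (a : A) (y * par 𝒜 a) -
    wordSum g (a : A) (par 𝒜 (a * y)) = _
  rw [par_mul, par_of_odd 𝒜 a.2, (hS a).map_add, (hS a).map_sub, mul_neg, neg_mul, (hS a).map_neg,
    (hS a).map_neg]
  ring

theorem finiteLength_linVal {g : List A → A → k} (hg : g ∈ cochains 𝒜 (dualGrading 𝒜)) :
    FiniteLength (linVal (isLinearMap_of_mem_cochains hg)) :=
  (finiteLength_of_mem_cochains hg).linVal _

/-- The one-form `y ↦ ∑ₙ g(a, …, a)(y)`. -/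
def wordForm {g : List A → A → k} (hg : g ∈ cochains 𝒜 (dualGrading 𝒜)) (a : OddPart 𝒜) :
    A →ₗ[k] k := wordSum (linVal (isLinearMap_of_mem_cochains hg)) a

theorem wordForm_apply {g : List A → A → k} (hg : g ∈ cochains 𝒜 (dualGrading 𝒜))
    (a : OddPart 𝒜) (y : A) : wordForm hg a y = wordSum g (a : A) y :=
  wordSum_linVal (finiteLength_of_mem_cochains hg) _ _ _

theorem pol_wordForm {g : List A → A → k} (hg : g ∈ cochains 𝒜 (dualGrading 𝒜)) :
    wordForm hg ∈ Pol k (OddPart 𝒜) (A →ₗ[k] k) :=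
  Pol.precomp (OddPart 𝒜).subtype ((multilin_linVal (multilin_of_mem_cochains hg)
    (isLinearMap_of_mem_cochains hg)).pol_wordSum (finiteLength_linVal hg))

theorem pairR_eq {α : ℕ → List A → A → k} (hα : α 0 ∈ cochains 𝒜 (dualGrading 𝒜))
    (a : OddPart 𝒜) : pairR 𝒜 α a = wordSum (α 0) (a : A) 1 :=
  (map_wordSum (finiteLength_of_mem_cochains hα)
    (LinearMap.proj (R := k) (φ := fun _ : A => k) 1) (a : A)).symm

theorem pol_pairR {α : ℕ → List A → A → k} (hα : α 0 ∈ cochains 𝒜 (dualGrading 𝒜)) :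
    pairR 𝒜 α ∈ Pol k (OddPart 𝒜) k := by
  have h := Pol.comp (LinearMap.applyₗ (1 : A)) (pol_wordForm hα)
  convert h using 1
  funext a
  rw [pairR_eq hα]
  exact (wordForm_apply hα a 1).symm

/-- Differentiating inserts the direction in every position, which `connes_replicate` identifies
with Connes' operator. -/
theorem isPD_pairR {α : ℕ → List A → A → k} (hα : α 0 ∈ cochains 𝒜 (dualGrading 𝒜)) :
    IsPD (pairR 𝒜 α)
      (fun a => -(wordForm (connes_mem_cochains hα) a ∘ₗ (OddPart 𝒜).subtype)) := by
  obtain ⟨N, h, h'⟩ := (finiteLength_of_mem_cochains hα).common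
    (finiteLength_of_mem_cochains (connes_mem_cochains hα))
  have hm := (multilin_of_mem_cochains hα).apply (1 : A)
  have h1 : ∀ l : List A, N ≤ l.length → α 0 l 1 = 0 := fun l hl => congrFun (h l hl) 1
  -- The bound `N + 1` accounts for the constant term `n = 0`, which has no derivative: words of
  -- length `n + 1` in `α₀` correspond to words of length `n` in `B^* α₀`.
  have e : pairR 𝒜 α = fun a : OddPart 𝒜 => ∑ n ∈ Finset.range (N + 1),
      α 0 (List.replicate n ((OddPart 𝒜).subtype a)) 1 :=
    funext fun a => wordSum_eq_sum (F := fun l => α 0 l 1) (fun l hl => h1 l (by omega)) (a : A)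
  rw [e]
  refine (IsPD.sum _ fun n => (hm.isPD_replicate n).precomp (OddPart 𝒜).subtype).congr
    fun a y => ?_
  rw [LinearMap.neg_apply, LinearMap.comp_apply, wordForm_apply, wordSum_eq_sum h',
    Finset.sum_apply, LinearMap.sum_apply, Finset.sum_range_succ', ← Finset.sum_neg_distrib]
  change ∑ n ∈ Finset.range N, insertSum (fun l => α 0 l 1) (a : A) y (n + 1) + 0 = _
  rw [add_zero]
  refine Finset.sum_congr rfl fun n _ => ?_
  rw [Submodule.subtype_apply, connes_replicate, neg_neg]

theorem pairR_add {α β : ℕ → List A → A → k} (hα : α 0 ∈ cochains 𝒜 (dualGrading 𝒜))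
    (hβ : β 0 ∈ cochains 𝒜 (dualGrading 𝒜)) :
    pairR 𝒜 (α + β) = pairR 𝒜 α + pairR 𝒜 β := by
  funext a
  rw [Pi.add_apply, pairR_eq hα, pairR_eq hβ, pairR_eq (add_mem hα hβ), Pi.add_apply,
    wordSum_add (finiteLength_of_mem_cochains hα) (finiteLength_of_mem_cochains hβ)]
  rfl

theorem pairR_smul {α : ℕ → List A → A → k} (hα : α 0 ∈ cochains 𝒜 (dualGrading 𝒜)) (c : k) :
    pairR 𝒜 (c • α) = c • pairR 𝒜 α := by
  funext a
  rw [Pi.smul_apply, pairR_eq hα, pairR_eq (Submodule.smul_mem _ c hα), Pi.smul_apply,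
    wordSum_smul (finiteLength_of_mem_cochains hα)]
  rfl

/-- The derivative along `ξ_x` is `-S_g(ξ_x)` for the `δ`-cocycle `g = B^* α₀`. By
`exists_wordSum_coD` at the even element `x`, `S_g(ξ_x)` vanishes modulo the curvature. -/
theorem pairR_mem_invariants (hd : IsDGA 𝒜 d) {α : ℕ → List A → A → k} (hα : α ∈ cycZ 𝒜 d) :
    pairR 𝒜 α ∈ invariants 𝒜 hd := by
  have hα0 := hα.1.1 0
  have hc := (induces_connes_zero hd).1 α hα
  refine ⟨pol_pairR hα0, fun x => ?_⟩
  have h0 : coD 𝒜 d (connes 𝒜 (α 0)) = 0 := hc.2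
  obtain ⟨K, hK, h⟩ := exists_wordSum_coD (d := d) hc.1 (by rw [h0]; exact zero_mem _)
  refine ⟨fun a => -K a x, vanish.comp (-LinearMap.applyₗ (x : A)) hK, fun a => ?_⟩
  refine ((isPD_pairR hα0).hasDerivAt a (gauge 𝒜 hd x a)).congr_deriv ?_
  have h1 := h a x
  have hz : wordSum (coD 𝒜 d (connes 𝒜 (α 0))) (a : A) x = 0 := by
    rw [h0]
    simp [wordSum]
  rw [hz, par_of_even 𝒜 x.2, ← wordForm_apply hc.1] at h1
  rw [LinearMap.neg_apply, LinearMap.comp_apply]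
  have e : (OddPart 𝒜).subtype (gauge 𝒜 hd x a) = -(d x - x * a + a * x) := by
    change (x : A) * a - a * x - d x = _
    abel
  rw [e, map_neg, eq_neg_of_add_eq_zero_left h1.symm, neg_neg]

/-- `exists_wordSum_coD` at `y = 1`, where the inserted vector is zero; the summand `B^* w₁`
vanishes at `1` by normalization. -/
theorem pairR_cycD_mem_vanish (hd : IsDGA 𝒜 d) {w : ℕ → List A → A → k} (hw : w ∈ cyc 𝒜)
    (h : cycD 𝒜 d w ∈ cyc 𝒜) : pairR 𝒜 (cycD 𝒜 d w) ∈ vanish 𝒜 d k := by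
  have h0 : coD 𝒜 d (w 0) + connes 𝒜 (w 1) ∈ cochains 𝒜 (dualGrading 𝒜) := h.1 0
  have hc := connes_mem_cochains (hw.1 1)
  have hδ : coD 𝒜 d (w 0) ∈ cochains 𝒜 (dualGrading 𝒜) := (Submodule.add_mem_iff_left _ hc).1 h0
  obtain ⟨K, hK, hw0⟩ := exists_wordSum_coD (hw.1 0) hδ
  convert vanish.comp (LinearMap.applyₗ (1 : A)) hK using 1
  funext a
  have h1 : wordSum (connes 𝒜 (w 1)) (a : A) 1 = 0 := by
    have := map_wordSum (finiteLength_of_mem_cochains hc)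
      (LinearMap.proj (R := k) (φ := fun _ : A => k) 1) (a : A)
    refine this.trans ?_
    simp [wordSum, connes_apply_of_one_mem (hw.1 1)]
  rw [pairR_eq (h.1 0)]
  change wordSum (coD 𝒜 d (w 0) + connes 𝒜 (w 1)) (a : A) 1 = K a 1
  rw [wordSum_add (finiteLength_of_mem_cochains hδ) (finiteLength_of_mem_cochains hc),
    Pi.add_apply, h1, hw0, par_one, hd.d_one, ← wordForm_apply (hw.1 0)]
  simp

theorem rhoWellDefined (hd : IsDGA 𝒜 d) : RhoWellDefined 𝒜 hd := by
  refine ⟨fun α hα => pairR_mem_invariants hd hα, fun α hα β hβ h => ?_⟩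
  obtain ⟨w, hw, hw'⟩ := h
  have e : pairR 𝒜 α - pairR 𝒜 β = pairR 𝒜 (cycD 𝒜 d w) := by
    rw [hw', sub_eq_iff_eq_add, ← pairR_add ((sub_mem hα hβ).1.1 0) (hβ.1.1 0), sub_add_cancel]
  rw [e]
  exact pairR_cycD_mem_vanish hd hw (hw' ▸ (sub_mem hα hβ).1)

end Signs

/-! ## Hamiltonian vector fields from negative cyclic cocycles -/

section

variable {k : Type*} [RCLike k] {A : Type*} [Ring A] [Algebra k A]
  {𝒜 : ℤ → Submodule k A} [GradedAlgebra 𝒜] {d : A →ₗ[k] A} {Tr : A →ₗ[k] k}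

theorem sub_par_mem_oddPart (a : A) : a - par 𝒜 a ∈ OddPart 𝒜 := by
  induction a using DirectSum.Decomposition.inductionOn 𝒜 with
  | zero => simp
  | homogeneous a =>
    rename_i i
    rcases Int.even_or_odd i with hi | hi
    · rw [par_of_even 𝒜 (mem_parityPart 𝒜 ((ZMod.intCast_eq_zero_iff_even).2 hi) a.2), sub_self]
      exact zero_mem _
    · have h := mem_parityPart 𝒜 ((ZMod.intCast_eq_one_iff_odd).2 hi) a.2
      exact sub_mem h (by rw [par_of_odd 𝒜 h]; exact neg_mem h)
  | add a b ha hb =>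
    rw [map_add, add_sub_add_comm]
    exact add_mem ha hb

variable (𝒜) in
/-- The projection of `A` to `A^{odd}`. -/
def oddProj : A →ₗ[k] OddPart 𝒜 :=
  ((2⁻¹ : k) • (LinearMap.id - par 𝒜)).codRestrict (OddPart 𝒜)
    fun a => Submodule.smul_mem _ _ (sub_par_mem_oddPart a)

theorem coe_oddProj {a : A} (ha : par 𝒜 a = -a) : (oddProj 𝒜 a : A) = a := by
  change (2⁻¹ : k) • (a - par 𝒜 a) = a
  rw [ha]
  module

variable (𝒜) in
/-- The vector field `a ↦ -∑ₙ f(a, …, a)` on `A^{odd}` of an odd cochain `f`. -/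
def wordField (f : List A → A) (a : OddPart 𝒜) : OddPart 𝒜 := oddProj 𝒜 (-wordSum f (a : A))

theorem par_wordSum {f : List A → A} (hf : f ∈ parityCochains 𝒜 𝒜 1) (a : OddPart 𝒜) :
    par 𝒜 (wordSum f (a : A)) = -wordSum f (a : A) := by
  have hc := finiteLength_of_mem_cochains (parityCochains_le_cochains _ hf)
  have h := hat_of_odd hf (σM := par 𝒜) fun i m => par_of_mem 𝒜
  rw [map_wordSum hc]
  refine Eq.trans ?_ (map_wordSum hc (-LinearMap.id : A →ₗ[k] A) (a : A)).symm
  refine finsum_congr fun n => ?_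
  have := congrFun h (List.replicate n (a : A))
  rwa [hat, wpar_replicate] at this

theorem coe_wordField {f : List A → A} (hf : f ∈ parityCochains 𝒜 𝒜 1) (a : OddPart 𝒜) :
    (wordField 𝒜 f a : A) = -wordSum f (a : A) :=
  coe_oddProj (by rw [map_neg, par_wordSum hf])

theorem pol_wordField {f : List A → A} (hf : f ∈ cochains 𝒜 𝒜) :
    wordField 𝒜 f ∈ Pol k (OddPart 𝒜) (OddPart 𝒜) := by
  have h := Pol.comp (-oddProj 𝒜) (Pol.precomp (OddPart 𝒜).subtype
    ((multilin_of_mem_cochains hf).pol_wordSum (finiteLength_of_mem_cochains hf)))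
  convert h using 1
  funext a
  exact map_neg (oddProj 𝒜) _

/-- Summing `δ f = 0` over the words `a … a` gives `d S + a S + S a = 0` modulo the curvature for `S
= S_f(a)`; the last sign comes from `S` being odd. -/
theorem isTangent_wordField {f : List A → A} (hf : f ∈ parityCochains 𝒜 𝒜 1)
    (hfD : selfD 𝒜 d f = 0) : IsTangent 𝒜 d (wordField 𝒜 f) := by
  have hc := parityCochains_le_cochains _ hf
  refine ⟨pol_wordField hc, ?_⟩
  obtain ⟨N, h⟩ := finiteLength_of_mem_cochains hc
  have hm := multilin_of_mem_cochains hc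
  have hv := sum_insertSum_curv_mem_vanish (𝒜 := 𝒜) (d := d) (hm.hat (𝒜 := 𝒜) (σM := par 𝒜)) N
  refine (congrArg (· ∈ vanish 𝒜 d A) (funext fun a => ?_)).mpr hv
  have key := wordSum_hochD (d := d) (σM := par 𝒜) (dM := d)
    (lft := fun a => LinearMap.mulLeft k a) (rgt := fun a => LinearMap.mulRight k a) hm h a
  rw [show hochD 𝒜 d (par 𝒜) d (fun a => LinearMap.mulLeft k a)
    (fun a => LinearMap.mulRight k a) f = 0 from hfD, par_wordSum hf] at key
  simp only [Pi.zero_apply, Finset.sum_const_zero, LinearMap.mulLeft_apply,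
    LinearMap.mulRight_apply] at key
  rw [eq_neg_of_add_eq_zero_right key.symm, twD, coe_wordField hf, map_neg, mul_neg, neg_mul]
  abel

/-- The Hamiltonian vector field of the function `⟨α, R(a)⟩` of an even cocycle `α`. -/
theorem isHamiltonianField_wordField (hTr : IsSymmetricTrace 𝒜 d Tr) {α : ℕ → List A → A → k}
    (hα : α 0 ∈ cochains 𝒜 (dualGrading 𝒜)) {f : selfZ 𝒜 d}
    (hf : (f : List A → A) ∈ parityCochains 𝒜 𝒜 1)
    (h : omegaSharp Tr f - connes 𝒜 (α 0) ∈ coB 𝒜 d) :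
    IsHamiltonianField 𝒜 d Tr (pairR 𝒜 α) (wordField 𝒜 f) := by
  refine (isHamiltonianField_iff (isPD_pairR hα)).2 ⟨isTangent_wordField hf f.2.2, ?_⟩
  obtain ⟨w, hw, hw'⟩ := h
  have hωf := omegaSharp_mem_cochains hTr f.2.1
  have hcα := connes_mem_cochains hα
  obtain ⟨K, hK, hwK⟩ := exists_wordSum_coD hw (hw' ▸ sub_mem hωf hcα)
  -- The primitive `w` of `ω ∘ f - B^* α₀` measures the failure of the Hamilton equation. By
  -- `exists_wordSum_coD` at odd `Y` this failure is `-S_w(d_a Y)` plus a term that vanishes with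
  -- the curvature.
  refine mem_conormal.2 ⟨fun a => -wordForm hw a, neg_mem (pol_wordForm hw),
    fun a => K a ∘ₗ (OddPart 𝒜).subtype,
    vanish.comp (LinearMap.lcomp k k (OddPart 𝒜).subtype) hK, fun a => LinearMap.ext fun Y => ?_⟩
  have h1 := hwK a Y
  have h2 : wordSum (omegaSharp Tr f) (a : A) Y = Tr (wordSum (f : List A → A) (a : A) * Y) :=
    (map_wordSum (finiteLength_of_mem_cochains hωf)
      (LinearMap.proj (R := k) (φ := fun _ : A => k) (Y : A)) (a : A)).trans
      (map_wordSum (finiteLength_of_mem_cochains f.2.1) (Tr ∘ₗ LinearMap.mulRight k (Y : A))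
        (a : A)).symm
  rw [hw', wordSum_sub (finiteLength_of_mem_cochains hωf) (finiteLength_of_mem_cochains hcα),
    Pi.sub_apply, h2, par_of_odd 𝒜 Y.2, ← wordForm_apply hw, ← wordForm_apply hcα] at h1
  have e : d (-(Y : A)) - Y * a + a * -(Y : A) = -twD 𝒜 d a Y := by
    rw [twD, map_neg, mul_neg]
    abel
  rw [e, map_neg] at h1
  rw [LinearMap.sub_apply, trForm_apply, coe_wordField hf, neg_mul, map_neg, LinearMap.add_apply,
    LinearMap.comp_apply, LinearMap.comp_apply, twLin_apply, LinearMap.neg_apply,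
    LinearMap.neg_apply, LinearMap.comp_apply, Submodule.subtype_apply]
  linear_combination h1

theorem isLinearMap_rho (hd : IsDGA 𝒜 d) : IsLinearMap k (rho 𝒜 hd) :=
  (rhoWellDefined hd).isLinearMap (fun _ hα _ hβ => pairR_add (hα.1.1 0) (hβ.1.1 0))
    fun c _ hα => pairR_smul (hα.1.1 0) c

theorem rho_cls (hd : IsDGA 𝒜 d) (α : cycZ 𝒜 d) : rho 𝒜 hd (cls (cycB 𝒜 d) α) =
    cls (vanish 𝒜 d k) ⟨pairR 𝒜 α, pairR_mem_invariants hd α.2⟩ :=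
  (rhoWellDefined hd).induced_cls α

/-- An even cocycle has a Hamiltonian vector field given by an odd cocycle of `C(A, A)`. -/
theorem exists_wordField (hd : IsDGA 𝒜 d) (hTr : IsSymmetricTrace 𝒜 d Tr)
    (hω : Function.Bijective (omegaHH 𝒜 d Tr)) {α : cycZ 𝒜 d}
    (hα : (α : ℕ → List A → A → k) ∈ cycZeven 𝒜 d) :
    ∃ f : selfZ 𝒜 d, (f : List A → A) ∈ parityCochains 𝒜 𝒜 1 ∧
      omegaSharp Tr f - connes 𝒜 ((α : ℕ → List A → A → k) 0) ∈ coB 𝒜 d ∧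
      IsHamiltonianField 𝒜 d Tr (pairR 𝒜 α) (wordField 𝒜 f) := by
  obtain ⟨f, hf, h⟩ := exists_odd_cocycle hd hTr hω.2
    ⟨connes 𝒜 ((α : ℕ → List A → A → k) 0), (induces_connes_zero hd).1 α α.2⟩
    (connes_mem_odd (hα.2 0 trivial))
  exact ⟨f, hf, h, isHamiltonianField_wordField hTr (α.2.1.1 0) hf h⟩

theorem rho_mem_hamFun (hd : IsDGA 𝒜 d) (hTr : IsSymmetricTrace 𝒜 d Tr)
    (hω : Function.Bijective (omegaHH 𝒜 d Tr)) (x : HCeven 𝒜 d) :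
    rho 𝒜 hd x ∈ hamFun 𝒜 hd Tr := by
  obtain ⟨α, hα, h⟩ := mem_HCeven.1 x.2
  obtain ⟨f, -, -, hX⟩ := exists_wordField hd hTr hω hα
  rw [← h, rho_cls]
  exact ⟨_, _, rfl, hX⟩

/-- The representation of `HC_-^{2•}(A)` by Hamiltonian functions. -/
def rhoEven (hd : IsDGA 𝒜 d) (hTr : IsSymmetricTrace 𝒜 d Tr)
    (hω : Function.Bijective (omegaHH 𝒜 d Tr)) : HCeven 𝒜 d →ₗ[k] hamFun 𝒜 hd Tr :=
  (((isLinearMap_rho hd).mk' _).domRestrict (HCeven 𝒜 d)).codRestrict (hamFun 𝒜 hd Tr)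
    (rho_mem_hamFun hd hTr hω)

/-- The bracket of even classes is represented by `Tr(X Y)` for the Hamiltonian vector fields. -/
theorem rho_cycBracket (hd : IsDGA 𝒜 d) (hTr : IsSymmetricTrace 𝒜 d Tr)
    (hω : Function.Bijective (omegaHH 𝒜 d Tr)) {α β : cycZ 𝒜 d} {f g : selfZ 𝒜 d}
    (hf : (f : List A → A) ∈ parityCochains 𝒜 𝒜 1) (hg : (g : List A → A) ∈ parityCochains 𝒜 𝒜 1)
    (hfα : omegaSharp Tr f - connes 𝒜 ((α : ℕ → List A → A → k) 0) ∈ coB 𝒜 d)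
    (hgβ : omegaSharp Tr g - connes 𝒜 ((β : ℕ → List A → A → k) 0) ∈ coB 𝒜 d)
    (hX : IsHamiltonianField 𝒜 d Tr (pairR 𝒜 α) (wordField 𝒜 f))
    (hY : IsHamiltonianField 𝒜 d Tr (pairR 𝒜 β) (wordField 𝒜 g)) :
    rho 𝒜 hd (cycBracket 𝒜 d Tr hω (cls (cycB 𝒜 d) α) (cls (cycB 𝒜 d) β)) =
      cls (vanish 𝒜 d k) (hamBracket hd hTr (p := ⟨_, pairR_mem_invariants hd α.2⟩)
        (q := ⟨_, pairR_mem_invariants hd β.2⟩) hX hY) := by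
  have hc := (induces₂_cup hd).1 f f.2 g g.2
  rw [cycBracket, mapB, (induces_connes_zero hd).induced_cls, (induces_connes_zero hd).induced_cls,
    sqcup_cls hd hTr hω hfα hgβ, mapI, induces_single.induced_cls, rho_cls]
  refine congrArg _ (Subtype.ext (funext fun a => ?_))
  change pairR 𝒜 (Pi.single 0 (omegaSharp Tr (cup 𝒜 f g))) a =
    Tr ((wordField 𝒜 f a : A) * wordField 𝒜 g a)
  -- The minus signs of the two fields cancel, and the product of the two sums is the sum of the cup
  -- product.
  rw [coe_wordField hf, coe_wordField hg, neg_mul_neg,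
    ← wordSum_cup (finiteLength_of_mem_cochains f.2.1) (finiteLength_of_mem_cochains g.2.1),
    map_wordSum (finiteLength_of_mem_cochains hc.1)]
  refine finsum_congr fun n => ?_
  rw [Pi.single_eq_same, omegaSharp, omega, mul_one]

theorem rhoEven_evenBracket (hd : IsDGA 𝒜 d) (hTr : IsSymmetricTrace 𝒜 d Tr)
    (hω : Function.Bijective (omegaHH 𝒜 d Tr)) (x y : HCeven 𝒜 d) :
    rhoEven hd hTr hω (evenBracket hd hTr hω x y) =
      poisson hd hTr (rhoEven hd hTr hω x) (rhoEven hd hTr hω y) := by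
  obtain ⟨α, hα, hx⟩ := mem_HCeven.1 x.2
  obtain ⟨β, hβ, hy⟩ := mem_HCeven.1 y.2
  obtain ⟨f, hf, hfα, hX⟩ := exists_wordField hd hTr hω hα
  obtain ⟨g, hg, hgβ, hY⟩ := exists_wordField hd hTr hω hβ
  refine Subtype.ext ?_
  change rho 𝒜 hd (cycBracket 𝒜 d Tr hω x y) = (poissonFun hd hTr _ _ : Fun 𝒜 hd)
  rw [poissonFun_eq hd hTr (p := ⟨_, pairR_mem_invariants hd α.2⟩)
    (q := ⟨_, pairR_mem_invariants hd β.2⟩) ?_ ?_ hX hY, ← hx, ← hy,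
    rho_cycBracket hd hTr hω hf hg hfα hgβ hX hY]
  · rw [← rho_cls, hx]; rfl
  · rw [← rho_cls, hy]; rfl

theorem apply_eq_zero_of_mem_vanish {U : Type*} [AddCommGroup U] [Module k U]
    {p : OddPart 𝒜 → U} (hp : p ∈ vanish 𝒜 d U) {a : OddPart 𝒜} (ha : a ∈ MC 𝒜 d) : p a = 0 := by
  obtain ⟨G, -, rfl⟩ := mem_vanish.1 hp
  exact (congrArg (G a) ha).trans (map_zero _)

/-- At a Maurer-Cartan element a Hamiltonian vector field is a Hamiltonian vector. -/
theorem IsHamiltonianField.isHamiltonianVector {ψ : OddPart 𝒜 → k} {X : OddPart 𝒜 → OddPart 𝒜}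
    (hX : IsHamiltonianField 𝒜 d Tr ψ X) {a : OddPart 𝒜} (ha : a ∈ MC 𝒜 d) :
    IsHamiltonianVector 𝒜 d Tr ψ a (X a) := by
  obtain ⟨H, -, K, hK, h⟩ := hX.hamilton
  refine ⟨apply_eq_zero_of_mem_vanish hX.tangent ha, fun Y hY => (h a Y).congr_deriv ?_⟩
  rw [hY, map_zero, apply_eq_zero_of_mem_vanish hK ha, LinearMap.zero_apply, add_zero, add_zero]

/-- Two Hamiltonian vectors of the same function at `a` have equal pairings with `ker d_a`, and the
other vector lies in that kernel. The two vectors can be replaced one after the other, using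
antisymmetry for the second. -/
theorem IsHamiltonianVector.trace_eq (hTr : IsSymmetricTrace 𝒜 d Tr) {ψ χ : OddPart 𝒜 → k}
    {a X X₁ Y Y₁ : OddPart 𝒜} (hX : IsHamiltonianVector 𝒜 d Tr ψ a X)
    (hX₁ : IsHamiltonianVector 𝒜 d Tr ψ a X₁) (hY : IsHamiltonianVector 𝒜 d Tr χ a Y)
    (hY₁ : IsHamiltonianVector 𝒜 d Tr χ a Y₁) : Tr ((X₁ : A) * Y₁) = Tr ((X : A) * Y) := by
  have h1 : trForm 𝒜 Tr X₁ Y₁ = trForm 𝒜 Tr X Y₁ := (hX₁.2 Y₁ hY₁.1).unique (hX.2 Y₁ hY₁.1)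
  have h2 : trForm 𝒜 Tr Y₁ X = trForm 𝒜 Tr Y X := (hY₁.2 X hX.1).unique (hY.2 X hX.1)
  exact h1.trans (by rw [trForm_antisymm hTr, h2, ← trForm_antisymm hTr]; rfl)

/-- The equality of `ρ`-images holds modulo multiples of the curvature, hence numerically at a
Maurer-Cartan element, with the values there of the fields from `exists_wordField`. `trace_eq` then
passes to arbitrary Hamiltonian vectors. -/
theorem pairR_eq_of_isHamiltonianVector (hd : IsDGA 𝒜 d) (hTr : IsSymmetricTrace 𝒜 d Tr)
    (hω : Function.Bijective (omegaHH 𝒜 d Tr)) {α β γ : cycZ 𝒜 d}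
    (hα : (α : ℕ → List A → A → k) ∈ cycZeven 𝒜 d) (hβ : (β : ℕ → List A → A → k) ∈ cycZeven 𝒜 d)
    (h : cls (cycB 𝒜 d) γ = cycBracket 𝒜 d Tr hω (cls (cycB 𝒜 d) α) (cls (cycB 𝒜 d) β))
    {a : OddPart 𝒜} (ha : a ∈ MC 𝒜 d) {X Y : OddPart 𝒜}
    (hX : IsHamiltonianVector 𝒜 d Tr (pairR 𝒜 α) a X)
    (hY : IsHamiltonianVector 𝒜 d Tr (pairR 𝒜 β) a Y) : pairR 𝒜 γ a = Tr ((X : A) * Y) := by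
  obtain ⟨f, hf, hfα, hXf⟩ := exists_wordField hd hTr hω hα
  obtain ⟨g, hg, hgβ, hYg⟩ := exists_wordField hd hTr hω hβ
  have h1 := congrArg (rho 𝒜 hd) h
  rw [rho_cls, rho_cycBracket hd hTr hω hf hg hfα hgβ hXf hYg] at h1
  have h2 := apply_eq_zero_of_mem_vanish (cls_eq_cls.1 h1) ha
  exact (sub_eq_zero.1 h2).trans
    (hX.trace_eq hTr (hXf.isHamiltonianVector ha) hY (hYg.isHamiltonianVector ha))

end

end MCRep

end

/-! ### The representation theorem. -/

open MCRep in
theorem theorem1 {k : Type*} [RCLike k] {A : Type*} [Ring A] [Algebra k A]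
    (𝒜 : ℤ → Submodule k A) [GradedAlgebra 𝒜] (d : A →ₗ[k] A) (hd : IsDGA 𝒜 d)
    (Tr : A →ₗ[k] k) (hTr : IsSymmetricTrace 𝒜 d Tr)
    (hω : Function.Bijective (omegaHH 𝒜 d Tr)) (hBV : IsBVAlgebra 𝒜 d Tr hω) :
    StructureMapsWellDefined 𝒜 d Tr ∧ RhoWellDefined 𝒜 hd ∧
    ∃ (br : HCeven 𝒜 d →ₗ[k] HCeven 𝒜 d →ₗ[k] HCeven 𝒜 d)
      (pb : hamFun 𝒜 hd Tr →ₗ[k] hamFun 𝒜 hd Tr →ₗ[k] hamFun 𝒜 hd Tr)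
      (ρ : HCeven 𝒜 d →ₗ[k] hamFun 𝒜 hd Tr),
      -- the bracket `I(𝓑 x ⊔ 𝓑 y)` is a Lie bracket on the even part
      (∀ x y, (br x y : HC 𝒜 d) = cycBracket 𝒜 d Tr hω x y) ∧ IsLieBracket br ∧
      -- the Poisson bracket `ω(X^ψ, X^χ)` is a well-defined Lie bracket
      (∀ (ψ χ : hamFun 𝒜 hd Tr) (θ : Fun 𝒜 hd),
        IsPoissonBracket 𝒜 hd Tr ψ χ θ ↔ θ = pb ψ χ) ∧ IsLieBracket pb ∧
      -- `ρ` is a map of Lie algebras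
      (∀ x, (ρ x : Fun 𝒜 hd) = rho 𝒜 hd x) ∧ (∀ x y, ρ (br x y) = pb (ρ x) (ρ y)) ∧
      -- at each Maurer-Cartan element the bracket is `ω` of any Hamiltonian vectors there
      ∀ α β γ : cycZ 𝒜 d, (α : ℕ → List A → A → k) ∈ cycZeven 𝒜 d →
        (β : ℕ → List A → A → k) ∈ cycZeven 𝒜 d →
        cls (cycB 𝒜 d) γ = cycBracket 𝒜 d Tr hω (cls (cycB 𝒜 d) α) (cls (cycB 𝒜 d) β) →
        ∀ a ∈ MC 𝒜 d, ∀ X Y : OddPart 𝒜, IsHamiltonianVector 𝒜 d Tr (pairR 𝒜 α) a X →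
          IsHamiltonianVector 𝒜 d Tr (pairR 𝒜 β) a Y →
          pairR 𝒜 γ a = Tr ((X : A) * Y) := by
  exact ⟨structureMapsWellDefined hd hTr, rhoWellDefined hd, evenBracket hd hTr hω, poisson hd hTr,
    rhoEven hd hTr hω, fun _ _ => rfl, isLieBracket_evenBracket hd hTr hω hBV,
    isPoissonBracket_iff hd hTr, isLieBracket_poisson hd hTr, fun _ => rfl,
    rhoEven_evenBracket hd hTr hω, fun _ _ _ hα hβ h _ ha _ _ hX hY =>
      pairR_eq_of_isHamiltonianVector hd hTr hω hα hβ h ha hX hY⟩
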